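/- Fix a field $k$ and let $X$ be a scheme locally of finite type over $k$. All monoids are commutative, sheaves are sheaves for the Zariski topology. A monoid is *sharp* if $0$ is its only unit, *fine* if it is finitely generated and cancellative, *toric* if it is fine, saturated and its group of fractions is torsion-free. A toric monoid $P$ (or the toric variety $\operatorname{Spec}k[P]$) is *Gorenstein* if there is $\rho_P\in P$ with $\rho_P+P=\operatorname{int}P$, where $\operatorname{int} P$ is the set of elements of $P$ lying in no proper face; then $\operatorname{Spec}k[P]/(\chi^{\rho_P})$ is its reduced boundary divisor. A *log structure* on a scheme $U$ is a sheaf of monoids $\mathcal M_U$ with a homomorphism $\alpha:\mathcal M_U\to(\mathcal O_U,\cdot)$ inducing a bijection $\alpha^{-1}(\mathcal O_U^\times)\to\mathcal O_U^\times$; its *ghost sheaf* is $\overline{\mathcal M}_U=\mathcal M_U/\mathcal M_U^\times$. Let $\overline{\mathcal M}_X$ be a sheaf of monoids on $X$ with fine sharp stalks. A *pre-gtc atlas* $\overline{\mathcal G}$ on $(X,\overline{\mathcal M}_X)$ consists of an étale covering $g_i:U_i\to X$, log structures $(\mathcal M_{U_i},\alpha_i)$ on the $U_i$, and identifications $\overline{\mathcal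 M}_{U_i}\simeq g_i^{-1}\overline{\mathcal M}_X$ (write $q_i:\mathcal M_{U_i}\to g_i^{-1}\overline{\mathcal M}_X$ for the quotient map), such that - (i) for each $i$ there are a Gorenstein toric monoid $P_i$ with element $\rho_i=\rho_{P_i}$ and an étale $k$-morphism $U_i\to\operatorname{Spec}k[P_i]/(\chi^{\rho_i})$ inducing the log structure of $U_i$, i.e. $\mathcal M_{U_i}$ is the log structure associated to $P_i\to\Gamma(U_i,\mathcal O_{U_i})$; - (ii) for $x\in X$ and $p\in\overline{\mathcal M}_{X,x}$ the ideal generated by $\alpha_i(q_i^{-1}(p))$ is independent of $i$, i.e. there is an ideal $J_{x,p}\subset\mathcal O_{X,x}$ such that for every $i$ and every $u\in U_i$ over $x$ the ideal of $\mathcal O_{U_i,u}$ generated by $\alpha_i(q_i^{-1}(p))$ equals $J_{x,p}\mathcal O_{U_i,u}$. The ideal $J_{x,p}$ is then unique. Let $I(\overline{\mathcal G},x)=\sum_{p\neq0}J_{x,p}\subset\mathcal O_{X,x}$. A section $\rho\in\Gamma(X,\overline{\mathcal M}_X)$ is *distinguished* if for all $i$ its pull-back to $U_i$ is the section of $\overline{\mathcal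 M}_{U_i}$ given by $\rho_i$ (for the chosen étale maps in (i)). For a monoid $N$ and $r\in N$ let $N/\!/(r)$ be the monoid obtained from $N$ by collapsing the ideal $(r)=r+N$ to one point $\infty$; for the section $\rho$, $\overline{\mathcal M}_X/\!/(\rho)$ denotes the corresponding quotient sheaf, with stalks $\overline{\mathcal M}_{X,x}/\!/(\rho_x)$. An *ideal* of a monoid $P$ is a subset $I$ with $P+I\subset I$ which contains the absorbing element $\infty$ if $P$ has an absorbing element $\infty\ne0$ (otherwise $I=\emptyset$ is allowed); it is *prime* if $P\setminus I$ is a submonoid. $\operatorname{Spec}P$ is the set of prime ideals with the topology generated by the sets $D(f)=\{\mathfrak p\mid f\notin\mathfrak p\}$, endowed with the sheaf of monoids with stalks $P_{\mathfrak p}=S^{-1}P/(S^{-1}P)^\times$, $S=P\setminus\mathfrak p$, whose sections are locally given by fractions. A *Kato fan* is a topological space with a sheaf of sharp monoids that is locally isomorphic to some $\operatorname{Spec}P$; it is *locally of finite type* if the monoids $P$ can be chosen finitely generated. **Proposition.** Let $\overline{\mathcal G}$ be a pre-gtc atlas on $(X,\overline{\mathcal M}_X)$. There is a unique distinguished section $\rho\in\Gamma(X,\overline{\mathcal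 M}_X)$, and the following hold. 1. $I(\overline{\mathcal G},x)\subset\mathcal O_{X,x}$ is a prime ideal for every $x\in X$. 2. The set $F(X)=\{x\in X\mid I(\overline{\mathcal G},x)=\mathfrak m_x\}$, with the subspace topology and the monoid sheaf $M_{F(X)}=(\overline{\mathcal M}_X/\!/(\rho))|_{F(X)}$, is a Kato fan locally of finite type. 3. There is a morphism $\pi:(X,\overline{\mathcal M}_X/\!/(\rho))\to(F(X),M_{F(X)})$ of spaces with monoid sheaves which maps each $x\in X$ to the point of $X$ corresponding to the prime ideal $I(\overline{\mathcal G},x)$ of $\mathcal O_{X,x}$, which restricts to the identity on $(F(X),M_{F(X)})$, and for which the map $\pi^{-1}M_{F(X)}\to\overline{\mathcal M}_X/\!/(\rho)$ is bijective. -/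

import Mathlib

open CategoryTheory CategoryTheory.Limits TopologicalSpace Opposite AlgebraicGeometry

universe u v

noncomputable section

namespace GTC

/-! ### Colimits of commutative monoids (needed for stalks) -/

/-- The smallest congruence on a monoid whose quotient is commutative. -/
def commCon (N : Type u) [Monoid N] : Con N := conGen fun a b => ∃ x y, a = x * y ∧ b = y * x

instance commConCommMonoid (N : Type u) [Monoid N] : CommMonoid (commCon N).Quotient where
  mul_comm a b := by
    induction a, b using Con.induction_on₂ with
    | _ x y => exact (Con.eq _).2 (ConGen.Rel.of _ _ ⟨x, y, rfl, rfl⟩)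

/-- Universal property of the abelianization of a monoid. -/
def abelianizationEquiv (N : MonCat.{u}) (Q : CommMonCat.{u}) :
    (CommMonCat.of (commCon N).Quotient ⟶ Q) ≃ (N ⟶ (forget₂ CommMonCat MonCat).obj Q) where
  toFun f := MonCat.ofHom (f.hom.comp (commCon N).mk')
  invFun f := CommMonCat.ofHom ((commCon N).lift (M := N) (P := Q) f.hom (Con.conGen_le.2 (by
    rintro _ _ ⟨x, y, rfl, rfl⟩
    show f.hom (x * y) = f.hom (y * x)
    rw [map_mul, map_mul]
    exact mul_comm (G := Q) _ _)))
  left_inv f := by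
    ext x
    rfl
  right_inv f := by
    ext x
    rfl

instance : HasColimits CommMonCat.{u} :=
  haveI : Reflective (forget₂ CommMonCat.{u} MonCat.{u}) :=
    { L := Adjunction.leftAdjointOfEquiv (G := forget₂ CommMonCat.{u} MonCat.{u})
        abelianizationEquiv (fun _ _ _ _ _ => rfl)
      adj := Adjunction.adjunctionOfEquivLeft abelianizationEquiv (fun _ _ _ _ _ => rfl) }
  hasColimits_of_reflective (forget₂ CommMonCat.{u} MonCat.{u})

/-! ### Sheaves of monoids given by locally prescribed sections -/

/-- For a family of monoids `A x` on a space `T`, a choice of submonoids of "basic" sections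
`U → ∐ A x`, stable under restriction. -/
structure BasicSections (T : TopCat.{u}) (A : T → Type u) [∀ x, CommMonoid (A x)] where
  basic : ∀ U : Opens T, Submonoid (∀ x : U, A x)
  res : ∀ {U V : Opens T} (i : U ⟶ V) (s : ∀ x : V, A x), s ∈ basic V →
    (fun x : U => s (i x)) ∈ basic U

namespace BasicSections

variable {T : TopCat.{u}} {A : T → Type u} [∀ x, CommMonoid (A x)] (B : BasicSections T A)

/-- The condition of being locally a basic section. -/
def locally : TopCat.LocalPredicate A :=
  TopCat.PrelocalPredicate.sheafify
    { pred := fun {U} s => s ∈ B.basic U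
      res := fun i s hs => B.res i s hs }

/-- The monoid of those `s : U → ∐ A x` which are locally basic sections. -/
def sections (U : Opens T) : Submonoid (∀ x : U, A x) where
  carrier := {s | B.locally.pred s}
  one_mem' x := ⟨U, x.2, 𝟙 _, (B.basic U).one_mem⟩
  mul_mem' {a b} ha hb x := by
    obtain ⟨V, hV, i, h⟩ := ha x
    obtain ⟨W, hW, j, h'⟩ := hb x
    exact ⟨V ⊓ W, ⟨hV, hW⟩, homOfLE inf_le_left ≫ i,
      (B.basic _).mul_mem (B.res (homOfLE inf_le_left : V ⊓ W ⟶ V) _ h)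
        (B.res (homOfLE inf_le_right : V ⊓ W ⟶ W) _ h')⟩

/-- Restriction of sections. -/
def resHom {U V : Opens T} (i : U ⟶ V) : B.sections V →* B.sections U where
  toFun s := ⟨fun x => s.1 (i x), B.locally.res i s.1 s.2⟩
  map_one' := rfl
  map_mul' _ _ := rfl

/-- The presheaf of sections which are locally basic. -/
def presheaf : TopCat.Presheaf CommMonCat.{u} T where
  obj U := CommMonCat.of (B.sections U.unop)
  map i := CommMonCat.ofHom (B.resHom i.unop)

theorem presheaf_isSheaf : B.presheaf.IsSheaf := by
  rw [TopCat.Presheaf.isSheaf_iff_isSheaf_comp (forget CommMonCat.{u})]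
  exact TopCat.Presheaf.isSheaf_of_iso
    (NatIso.ofComponents (fun U => Iso.refl _) (fun _ => rfl))
    (TopCat.subpresheafToTypes.isSheaf B.locally)

/-- The sheaf of sections which are locally basic. -/
def sheaf : TopCat.Sheaf CommMonCat.{u} T := ⟨B.presheaf, B.presheaf_isSheaf⟩

end BasicSections

/-! ### Quotients of monoid sheaves -/

section Quotient

variable {T : TopCat.{u}} (M : TopCat.Presheaf CommMonCat.{u} T) (c : ∀ x : T, Con (M.stalk x))

/-- A section of `M` over `U`, viewed as a family of elements of the quotients `M_x / c_x`. -/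
def quotientSection (U : Opens T) : M.obj (op U) →* ∀ x : U, (c x.1).Quotient :=
  MonoidHom.pi fun x => (c x.1).mk'.comp (M.germ U x.1 x.2).hom

/-- The families induced by sections of `M`. -/
def quotientBasic : BasicSections T fun x => (c x).Quotient where
  basic U := MonoidHom.mrange (quotientSection M c U)
  res := by
    rintro U V i _ ⟨m, rfl⟩
    refine ⟨M.map i.op m, ?_⟩
    funext x
    exact congrArg (c x.1).mk' (M.germ_res_apply i x.1 x.2 m)

/-- The quotient sheaf `M / c`: the sheaf of families of elements of the quotients `M_x / c_x`
of the stalks that are locally induced by sections of `M`. -/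
def quotientSheaf : TopCat.Sheaf CommMonCat.{u} T := (quotientBasic M c).sheaf

/-- The quotient map `M → M / c`. -/
def toQuotientSheaf : M ⟶ (quotientSheaf M c).presheaf where
  app U := CommMonCat.ofHom ((quotientSection M c U.unop).codRestrict
    ((quotientBasic M c).sections U.unop) fun m x => ⟨U.unop, x.2, 𝟙 _, m, rfl⟩)
  naturality U V i := by
    ext m
    apply Subtype.ext
    funext x
    exact congrArg (c x.1).mk' (M.germ_res_apply i.unop x.1 x.2 m)

end Quotient

/-- The congruence `a ∼ b ↔ a` and `b` differ by a unit, with quotient `N / N^×`. -/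
def unitsCon (N : Type u) [CommMonoid N] : Con N where
  r a b := Associated a b
  iseqv := ⟨Associated.refl, Associated.symm, Associated.trans⟩
  mul' h h' := h.mul_mul h'

/-- The congruence collapsing the ideal `(r) = r N` to one point `∞`, with quotient `N // (r)`,
which is `N ∖ (r)` together with `∞`. -/
def idealCon {N : Type u} [CommMonoid N] (r : N) : Con N where
  r a b := a = b ∨ (r ∣ a ∧ r ∣ b)
  iseqv :=
    ⟨fun _ => Or.inl rfl,
      fun h => h.elim (fun h => Or.inl h.symm) fun h => Or.inr ⟨h.2, h.1⟩, by
        rintro a b c (rfl | h) (rfl | h')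
        · exact Or.inl rfl
        · exact Or.inr h'
        · exact Or.inr h
        · exact Or.inr ⟨h.1, h'.2⟩⟩
  mul' := by
    rintro a b c d (rfl | h) (rfl | h')
    · exact Or.inl rfl
    · exact Or.inr ⟨h'.1.mul_left _, h'.2.mul_left _⟩
    · exact Or.inr ⟨h.1.mul_right _, h.2.mul_right _⟩
    · exact Or.inr ⟨h.1.mul_right _, h.2.mul_right _⟩

/-! ### Monoidal spaces and restriction to a subset -/

/-- A commutative monoid is sharp if its only unit is the neutral element. -/
def IsSharp (N : Type u) [CommMonoid N] : Prop := ∀ a : N, IsUnit a → a = 1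

/-- A monoidal space is a space with a sheaf of (commutative) monoids with sharp stalks. -/
def IsMonoidalSpace (T : SheafedSpace CommMonCat.{u}) : Prop :=
  ∀ t : T, IsSharp (T.presheaf.stalk t)

section Restrict

variable (T : SheafedSpace CommMonCat.{u}) (S : Set T)

/-- The families over an open subset of `S` of germs of sections on open subsets of `T`. -/
def subsetBasic : BasicSections (TopCat.of S) fun x => T.presheaf.stalk x.1 where
  basic U :=
    { carrier := {s | ∃ (W : Opens T) (hW : ∀ x : U, x.1.1 ∈ W) (m : T.presheaf.obj (op W)),
        ∀ x : U, s x = T.presheaf.germ W x.1.1 (hW x) m}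
      one_mem' := ⟨⊤, fun _ => trivial, 1, fun x => (map_one (T.presheaf.germ ⊤ x.1.1 _).hom).symm⟩
      mul_mem' := by
        rintro a b ⟨W, hW, m, h⟩ ⟨W', hW', m', h'⟩
        refine ⟨W ⊓ W', fun x => ⟨hW x, hW' x⟩,
          T.presheaf.map (homOfLE inf_le_left : W ⊓ W' ⟶ W).op m *
            T.presheaf.map (homOfLE inf_le_right : W ⊓ W' ⟶ W').op m', fun x => ?_⟩
        rw [Pi.mul_apply, h x, h' x]
        exact (congrArg₂ (· * ·)
          (T.presheaf.germ_res_apply (homOfLE inf_le_left : W ⊓ W' ⟶ W) x.1.1 ⟨hW x, hW' x⟩ m)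
          (T.presheaf.germ_res_apply (homOfLE inf_le_right : W ⊓ W' ⟶ W') x.1.1 ⟨hW x, hW' x⟩
            m')).symm.trans (map_mul (T.presheaf.germ (W ⊓ W') x.1.1 ⟨hW x, hW' x⟩).hom _ _).symm }
  res := by
    rintro U V i s ⟨W, hW, m, h⟩
    exact ⟨W, fun x => hW ⟨x.1, i.le x.2⟩, m, fun x => h ⟨x.1, i.le x.2⟩⟩

/-- The subset `S` with the subspace topology and the restriction (inverse image) of the sheaf. -/
def restrictSubset : SheafedSpace CommMonCat.{u} where
  carrier := TopCat.of S
  presheaf := (subsetBasic T S).presheaf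
  IsSheaf := (subsetBasic T S).presheaf_isSheaf

/-- The inclusion of a subset. -/
def subsetInclusion : restrictSubset T S ⟶ T := InducedCategory.homMk
  { base := TopCat.ofHom ⟨Subtype.val, continuous_subtype_val⟩
    c :=
      { app := fun W => CommMonCat.ofHom
          { toFun := fun m => ⟨fun x => T.presheaf.germ W.unop x.1.1 x.2 m,
              fun x => ⟨_, x.2, 𝟙 _, W.unop, fun y => y.2, m, fun _ => rfl⟩⟩
            map_one' := Subtype.ext <| funext fun x =>
              map_one (T.presheaf.germ W.unop x.1.1 x.2).hom
            map_mul' := fun a b => Subtype.ext <| funext fun x =>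
              map_mul (T.presheaf.germ W.unop x.1.1 x.2).hom a b }
        naturality := fun U V i => by
          ext m
          apply Subtype.ext
          funext x
          exact T.presheaf.germ_res_apply i.unop x.1.1 x.2 m } }

end Restrict

/-! ### Kato fans -/

/-- A prime ideal of a commutative monoid `P` (written multiplicatively): a subset `I` with
`P I ⊆ I` whose complement is a submonoid. An ideal is required to contain the absorbing element
`∞` whenever `P` has an absorbing element `∞ ≠ 1`; otherwise the empty ideal is allowed. -/
@[ext]
structure PrimeIdeal (P : Type u) [CommMonoid P] where
  carrier : Set P
  mul_mem : ∀ a b, b ∈ carrier → a * b ∈ carrier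
  absorbing_mem : ∀ z : P, z ≠ 1 → (∀ a, a * z = z) → z ∈ carrier
  one_notMem : 1 ∉ carrier
  mem_or_mem : ∀ a b, a * b ∈ carrier → a ∈ carrier ∨ b ∈ carrier

/-- The complement of a prime ideal. -/
def PrimeIdeal.primeCompl {P : Type u} [CommMonoid P] (I : PrimeIdeal P) : Submonoid P where
  carrier := I.carrierᶜ
  one_mem' := I.one_notMem
  mul_mem' {a b} ha hb h := (I.mem_or_mem a b h).elim ha hb

/-- The topology generated by the sets `D(f)` of prime ideals not containing `f`. -/
instance (P : Type u) [CommMonoid P] : TopologicalSpace (PrimeIdeal P) :=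
  TopologicalSpace.generateFrom {D | ∃ f : P, D = {I : PrimeIdeal P | f ∉ I.carrier}}

section Spec

variable (P : Type u) [CommMonoid P]

/-- The space of prime ideals of a monoid. -/
abbrev specTop : TopCat.{u} := TopCat.of (PrimeIdeal P)

/-- The stalk `P_I = S⁻¹P / (S⁻¹P)^×`, where `S = P ∖ I`. -/
abbrev SpecStalk (I : specTop P) : Type u := Associates (Localization I.primeCompl)

/-- The families given by a single fraction `a / f`. -/
def specBasic : BasicSections (specTop P) (SpecStalk P) where
  basic U :=
    { carrier := {s | ∃ a f : P, ∀ I : U, ∃ hf : f ∈ I.1.primeCompl,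
        s I = Associates.mk (Localization.mk a ⟨f, hf⟩)}
      one_mem' := ⟨1, 1, fun I => ⟨I.1.primeCompl.one_mem, by
        rw [Pi.one_apply, ← Associates.mk_one]
        exact congrArg Associates.mk Localization.mk_one.symm⟩⟩
      mul_mem' := by
        rintro s t ⟨a, f, h⟩ ⟨b, g, h'⟩
        refine ⟨a * b, f * g, fun I => ?_⟩
        obtain ⟨hf, h⟩ := h I
        obtain ⟨hg, h'⟩ := h' I
        refine ⟨I.1.primeCompl.mul_mem hf hg, ?_⟩
        rw [Pi.mul_apply, h, h', Associates.mk_mul_mk, Localization.mk_mul]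
        rfl }
  res := by
    rintro U V i s ⟨a, f, h⟩
    exact ⟨a, f, fun I => h ⟨I.1, i.le I.2⟩⟩

/-- The affine Kato fan `Spec P`: the space of prime ideals of `P` with the sheaf of families of
elements of `P_I` which are locally given by fractions. -/
def monoidSpec : SheafedSpace CommMonCat.{u} where
  carrier := specTop P
  presheaf := (specBasic P).presheaf
  IsSheaf := (specBasic P).presheaf_isSheaf

end Spec

/-- A Kato fan is a monoidal space that is locally isomorphic to some `Spec P`. -/
def IsKatoFan (T : SheafedSpace CommMonCat.{u}) : Prop :=
  IsMonoidalSpace T ∧ ∀ t : T, ∃ V : Opens T, t ∈ V ∧ ∃ (P : Type u) (_ : CommMonoid P),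
    Nonempty (T.restrict V.isOpenEmbedding ≅ monoidSpec P)

/-- A Kato fan is locally of finite type if the monoids `P` can be chosen finitely generated. -/
def IsKatoFanLocallyOfFiniteType (T : SheafedSpace CommMonCat.{u}) : Prop :=
  IsMonoidalSpace T ∧ ∀ t : T, ∃ V : Opens T, t ∈ V ∧ ∃ (P : Type u) (_ : CommMonoid P),
    Monoid.FG P ∧ Nonempty (T.restrict V.isOpenEmbedding ≅ monoidSpec P)

/-! ### Fine and toric monoids -/

/-- A fine sharp monoid: finitely generated, integral (cancellative), without nontrivial units. -/
structure IsFineSharp (P : Type u) [CommMonoid P] : Prop where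
  fg : Monoid.FG P
  cancel : IsCancelMul P
  sharp : IsSharp P

/-- A toric monoid, i.e. `σ^∨ ∩ M` for a strongly convex rational polyhedral cone `σ`:
a fine saturated monoid with torsion-free group of fractions. -/
structure IsToric (P : Type u) [CommMonoid P] : Prop where
  fg : Monoid.FG P
  cancel : IsCancelMul P
  saturated : ∀ (a b : P) (n : ℕ), n ≠ 0 → b ^ n ∣ a ^ n → b ∣ a
  torsionFree : IsMulTorsionFree P

/-- `p` lies in the interior of `P = σ^∨ ∩ M`, i.e. in no proper face of `P`:
for every `q` some multiple `n p` lies in `q + P` (in additive notation). -/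
def IsInterior {P : Type u} [CommMonoid P] (p : P) : Prop := ∀ q : P, ∃ n : ℕ, q ∣ p ^ n

/-- `ρ + P = int P` (in additive notation); an element `ρ` with this property exists if and only if
the toric variety `Spec k[P]` is Gorenstein. -/
def IsGorensteinElement {P : Type u} [CommMonoid P] (ρ : P) : Prop :=
  ∀ p : P, ρ ∣ p ↔ IsInterior p

/-! ### Log structures -/

/-- A log structure on a scheme (for the Zariski topology): a sheaf of monoids `M` with a
homomorphism `α` to the multiplicative monoid of the structure sheaf such that `α` induces a
bijection `α⁻¹(𝒪^×) → 𝒪^×`. -/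
structure LogStructure (U : Scheme.{u}) where
  M : TopCat.Sheaf CommMonCat.{u} U
  α : ∀ V : U.Opens, M.presheaf.obj (op V) →* Γ(U, V)
  naturality : ∀ {V W : U.Opens} (i : V ⟶ W) (m : M.presheaf.obj (op W)),
    α V (M.presheaf.map i.op m) = U.presheaf.map i.op (α W m)
  bijective : ∀ (V : U.Opens) (f : Γ(U, V)), IsUnit f → ∃! m : M.presheaf.obj (op V), α V m = f

namespace LogStructure

variable {U : Scheme.{u}} (L : LogStructure U)

/-- The ghost sheaf `M / M^×`. -/
def ghost : TopCat.Sheaf CommMonCat.{u} U :=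
  quotientSheaf L.M.presheaf fun x => unitsCon (L.M.presheaf.stalk x)

/-- The quotient map `M → M / M^×`. -/
def toGhost : L.M.presheaf ⟶ L.ghost.presheaf :=
  toQuotientSheaf L.M.presheaf fun x => unitsCon (L.M.presheaf.stalk x)

/-- The map `θ : P → Γ(U, M)` is a chart: it exhibits `(M, α)` as the log structure associated to
the prelog structure `β = α ∘ θ : P → 𝒪`, i.e. for each `u` the stalk `M_u` is the amalgamated sum
of `P` and `𝒪_u^× ≅ M_u^×` over `β_u⁻¹(𝒪_u^×)`. Explicitly, `M_u` consists of products of elements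
`θ_u(p)` and units, and `θ_u(p) w = θ_u(p') w'` only if there are `r, r'` in `β_u⁻¹(𝒪_u^×)` with
`p r = p' r'` and `w / θ_u(r) = w' / θ_u(r')`. -/
structure IsChart {P : Type u} [CommMonoid P] (θ : P →* L.M.presheaf.obj (op ⊤)) : Prop where
  generates : ∀ (x : U) (m : L.M.presheaf.stalk x), ∃ (p : P) (w : L.M.presheaf.stalk x), IsUnit w ∧
    m = L.M.presheaf.germ ⊤ x trivial (θ p) * w
  relations : ∀ (x : U) (p p' : P) (w w' : L.M.presheaf.stalk x), IsUnit w → IsUnit w' →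
    L.M.presheaf.germ ⊤ x trivial (θ p) * w = L.M.presheaf.germ ⊤ x trivial (θ p') * w' →
    ∃ r r' : P, IsUnit (U.presheaf.germ ⊤ x trivial (L.α ⊤ (θ r))) ∧
      IsUnit (U.presheaf.germ ⊤ x trivial (L.α ⊤ (θ r'))) ∧ p * r = p' * r' ∧
      w * L.M.presheaf.germ ⊤ x trivial (θ r') = w' * L.M.presheaf.germ ⊤ x trivial (θ r)

end LogStructure

/-! ### Pre-gtc atlases -/

/-- The coordinate ring `k[P] / (χ^ρ)`. -/
abbrev boundaryRing (k : Type u) [Field k] (P : Type u) [CommMonoid P] (ρ : P) : CommRingCat.{u} :=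
  CommRingCat.of (MonoidAlgebra k P ⧸ Ideal.span {MonoidAlgebra.of k P ρ})

/-- The function `χ^p` in `k[P] / (χ^ρ)`. -/
def character (k : Type u) [Field k] {P : Type u} [CommMonoid P] (ρ p : P) : boundaryRing k P ρ :=
  Ideal.Quotient.mk _ (MonoidAlgebra.of k P p)

/-- For a log structure `L` on a `k`-scheme `U`: an étale `k`-morphism `f` from `U` to the reduced
boundary divisor `Z = Spec k[P] / (χ^ρ)` of a Gorenstein affine toric variety, inducing the log
structure `L`, i.e. `L` is the log structure associated to `P → 𝒪_U`, `p ↦ f^*(χ^p)`. -/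
structure BoundaryChart {k : Type u} [Field k] {U : Scheme.{u}} (s : U ⟶ Spec (CommRingCat.of k))
    (L : LogStructure U) where
  P : Type u
  [commMonoid : CommMonoid P]
  toric : IsToric P
  ρ : P
  gorenstein : IsGorensteinElement ρ
  f : U ⟶ Spec (boundaryRing k P ρ)
  etale : Etale f
  comp_toBase : f ≫ Spec.map (CommRingCat.ofHom (algebraMap k (boundaryRing k P ρ))) = s
  θ : P →* L.M.presheaf.obj (op ⊤)
  compatible : ∀ p, L.α ⊤ (θ p) =
    f.appTop ((Scheme.ΓSpecIso (boundaryRing k P ρ)).inv (character k ρ p))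
  chart : L.IsChart θ

attribute [instance] BoundaryChart.commMonoid

/-- An identification of the ghost sheaf of a log structure on `U` with the inverse image of the
monoid sheaf `M` along `g : U → X`, given by its adjoint `M → g_* (ghost sheaf)`. -/
structure Framing {U X : Scheme.{u}} (g : U ⟶ X) (M : TopCat.Sheaf CommMonCat.{u} X)
    (L : LogStructure U) where
  hom : M.presheaf ⟶ (TopCat.Presheaf.pushforward CommMonCat.{u} g.base).obj L.ghost.presheaf
  bijective : ∀ u : U, Function.Bijective
    ((TopCat.Presheaf.stalkFunctor CommMonCat.{u} (g u)).map hom ≫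
      L.ghost.presheaf.stalkPushforward CommMonCat.{u} g.base u)

namespace Framing

variable {U X : Scheme.{u}} {g : U ⟶ X} {M : TopCat.Sheaf CommMonCat.{u} X} {L : LogStructure U}
  (φ : Framing g M L)

/-- The isomorphism from the stalk of `M` at `g u` to the stalk of the ghost sheaf at `u`. -/
def stalkMap (u : U) : M.presheaf.stalk (g u) ⟶ L.ghost.presheaf.stalk u :=
  (TopCat.Presheaf.stalkFunctor CommMonCat.{u} (g u)).map φ.hom ≫
    L.ghost.presheaf.stalkPushforward CommMonCat.{u} g.base u

/-- For `p` in the stalk of `M` at `g u`, the ideal of `𝒪_{U,u}` generated by `α (q⁻¹ (p))`, where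
`q` is the quotient map to the ghost sheaf. -/
def ideal (u : U) (p : M.presheaf.stalk (g u)) : Ideal (U.presheaf.stalk u) :=
  Ideal.span {a | ∃ (V : U.Opens) (hu : u ∈ V) (m : L.M.presheaf.obj (op V)),
    L.ghost.presheaf.germ V u hu (L.toGhost.app (op V) m) = φ.stalkMap u p ∧
      a = U.presheaf.germ V u hu (L.α V m)}

end Framing

/-- A pre-gtc atlas on a `k`-scheme `X` with a monoid sheaf `M`: an étale covering `U i → X` by
schemes with log structures, with identifications of their ghost sheaves with the inverse images
of `M`, which are induced by étale maps to boundary divisors of Gorenstein affine toric varieties,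
and such that the ideals generated by `α (q⁻¹ (p))` do not depend on the member of the covering:
for all `x : X` and `p : M_x` there is an ideal of `𝒪_{X,x}` which generates the corresponding
ideal of `𝒪_{U i,u}` for each `i` and each `u : U i` over `x`. -/
structure PreGTCAtlas {k : Type u} [Field k] {X : Scheme.{u}} (s : X ⟶ Spec (CommRingCat.of k))
    (M : TopCat.Sheaf CommMonCat.{u} X) where
  ι : Type v
  U : ι → Scheme.{u}
  g : ∀ i, U i ⟶ X
  etale : ∀ i, Etale (g i)
  covers : ∀ x : X, ∃ (i : ι) (u : U i), g i u = x
  log : ∀ i, LogStructure (U i)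
  framing : ∀ i, Framing (g i) M (log i)
  chart : ∀ i, BoundaryChart (g i ≫ s) (log i)
  independent : ∃ J : ∀ x : X, M.presheaf.stalk x → Ideal (X.presheaf.stalk x),
    ∀ (i : ι) (u : U i) (p : M.presheaf.stalk (g i u)),
      (J (g i u) p).map ((g i).stalkMap u).hom = (framing i).ideal u p

namespace PreGTCAtlas

variable {k : Type u} [Field k] {X : Scheme.{u}} {s : X ⟶ Spec (CommRingCat.of k)}
  {M : TopCat.Sheaf CommMonCat.{u} X} (G : PreGTCAtlas.{u, v} s M)

/-- The ideal of `𝒪_{X,x}` generated by `α (q⁻¹ (p))`; by faithful flatness of étale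
morphisms on stalks it is determined by the ideals on the covering. -/
def sectionIdeal (x : X) (p : M.presheaf.stalk x) : Ideal (X.presheaf.stalk x) :=
  G.independent.choose x p

/-- The ideal `I(G, x)`, generated by the ideals of all `p ≠ 1` (equivalently by the images of the
elements of a chart at `x` which are not mapped to units). -/
def ideal (x : X) : Ideal (X.presheaf.stalk x) :=
  ⨆ (p : M.presheaf.stalk x) (_ : p ≠ 1), G.sectionIdeal x p

/-- `ρ` is the distinguished section of `M`: its pull-back to each `U i` is the section given by the
element `ρ` with `ρ + P = int P`. -/
def IsDistinguished (ρ : M.presheaf.obj (op ⊤)) : Prop :=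
  ∀ (i : G.ι) (u : G.U i),
    (G.framing i).stalkMap u (M.presheaf.germ ⊤ (G.g i u) trivial ρ) =
      (G.log i).ghost.presheaf.germ ⊤ u trivial
        ((G.log i).toGhost.app (op ⊤) ((G.chart i).θ (G.chart i).ρ))

/-- The set `F(X)` of points where `I(G, x)` is the maximal ideal. -/
def fanSet : Set X := {x | G.ideal x = IsLocalRing.maximalIdeal (X.presheaf.stalk x)}

end PreGTCAtlas

/-- The space `X` with the monoid sheaf `M // (ρ)`, whose stalks are the quotients of `M_x` by the
ideals generated by `ρ`. -/
def quotientSpace {X : Scheme.{u}} (M : TopCat.Sheaf CommMonCat.{u} X) (ρ : M.presheaf.obj (op ⊤)) :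
    SheafedSpace CommMonCat.{u} where
  carrier := X
  presheaf := (quotientSheaf M.presheaf fun x => idealCon (M.presheaf.germ ⊤ x trivial ρ)).presheaf
  IsSheaf := (quotientSheaf M.presheaf fun x => idealCon (M.presheaf.germ ⊤ x trivial ρ)).property

namespace PreGTCAtlas

variable {k : Type u} [Field k] {X : Scheme.{u}} {s : X ⟶ Spec (CommRingCat.of k)}
  {M : TopCat.Sheaf CommMonCat.{u} X} (G : PreGTCAtlas.{u, v} s M)

/-- The set `F(X)` with the subspace topology and the restriction of the sheaf `M // (ρ)`. -/
def fan (ρ : M.presheaf.obj (op ⊤)) : SheafedSpace CommMonCat.{u} :=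
  restrictSubset (quotientSpace M ρ) G.fanSet

/-- The inclusion of `F(X)` into `X` with the sheaf `M // (ρ)`. -/
def fanInclusion (ρ : M.presheaf.obj (op ⊤)) : G.fan ρ ⟶ quotientSpace M ρ :=
  subsetInclusion (quotientSpace M ρ) G.fanSet

end PreGTCAtlas

end GTC

end

noncomputable section

namespace GTC

/-! ### Monoid algebras of toric monoids are integrally closed -/

section MonoidAlgebra

variable {k : Type*} [Field k] {F H : Type*} [CommMonoid F] [CommGroup H]

/-! Everything is read off the charts. Let `u : G.U i` lie over `x`, let P be the toric monoid of
the chart, and let `face u` consist of those p for which χ^p is invertible at `u`. This face never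
contains ρ, because χ^ρ = 0. By the chart axioms, M_x is the localization of P at this face modulo
units (`κ_surjective`, `κ_eq_iff`), and the generization maps of M are localizations at faces modulo
units as well. Condition (ii) says that I(G, x) generates in the local ring at `u` the ideal of all
χ^p with p outside `face u` (`map_ideal`). By faithful flatness I(G, x) is the contraction of that
ideal.

Primality: for a face F avoiding ρ, the quotient of k[P]/(χ^ρ) by all χ^p with p ∉ F is k[F]. As F
is again toric, k[F] is a normal domain, and a local ring of an étale algebra over a normal domain
is a domain (`exists_mul_eq_zero_of_etale`). So for each face F ⊇ `face u` avoiding ρ the functions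
outside F generate a prime ideal (`isPrime_faceIdeal`). It defines a generization `facePoint` of
`u`, whose face is exactly F and whose maximal ideal is generated by the functions outside F. The
case F = `face u` shows that I(G, x) is prime and produces π(x).

The fan: the images in X of the points `facePoint` are exactly the points of F(X) that generize x,
and inclusion of faces corresponds to generization (`g_eq_facePoint`, `specializes_of_mem_fanSet`).
Faces of P between `face u` and P that avoid ρ are the faces of M_x avoiding ρ, hence the primes of
M_x // (ρ), since a prime must contain ∞. Finite type enters through noetherianity: locally there
are only finitely many fan points, so near x every fan point generizes π(x)
(`exists_nhds_specializes_proj`). Thus the generizations in F(X) of t ∈ F(X) form its smallest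
neighbourhood, which is Spec of M_t // (ρ). The structure sheaves agree because both stalks are
localizations modulo units (`chartStalkEquiv`).

The retraction is continuous by the same neighbourhood statement. It is bijective on stalks because
x and π(x) have the same face, so that M_x → M_π(x) is bijective
(`bijective_stalkSpecializes_proj`).

The distinguished section: the image of ρ in M_x is again a Gorenstein element, and such an element
is unique in a sharp cancellative monoid. The germs are therefore independent of the chart and glue.
-/

/-- If `F` embeds into its group of fractions `H`, then `k[H]` is the localization of `k[F]` at the
monomials. -/
theorem isLocalization_mapDomain (j : F →* H) (hj : Function.Injective j)
    (hgen : ∀ h : H, ∃ a b : F, j a = h * j b) :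
    letI := (MonoidAlgebra.mapDomainRingHom k j).toAlgebra
    IsLocalization ((⊤ : Submonoid F).map (MonoidAlgebra.of k F)) (MonoidAlgebra k H) := by
  let := (MonoidAlgebra.mapDomainRingHom k j).toAlgebra
  have hmap : ∀ x : MonoidAlgebra k F, algebraMap (MonoidAlgebra k F) (MonoidAlgebra k H) x =
    MonoidAlgebra.mapDomainRingHom k j x := fun _ => rfl
  refine ⟨?_, ?_, ?_⟩
  · rintro ⟨_, a, -, rfl⟩
    rw [hmap]
    refine IsUnit.of_mul_eq_one (MonoidAlgebra.of k H (j a)⁻¹) ?_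
    simp [MonoidAlgebra.one_def, MonoidAlgebra.single_mul_single]
  · intro z
    refine MonoidAlgebra.induction_on (motive := fun z => ∃ x : MonoidAlgebra k F ×
      ((⊤ : Submonoid F).map (MonoidAlgebra.of k F)), z * algebraMap _ (MonoidAlgebra k H) x.2.1 =
        algebraMap (MonoidAlgebra k F) (MonoidAlgebra k H) x.1) z ?_ ?_ ?_
    · intro h
      obtain ⟨a, b, hab⟩ := hgen h
      refine ⟨⟨MonoidAlgebra.of k F a, ⟨_, b, trivial, rfl⟩⟩, ?_⟩
      rw [hmap, hmap]
      simp [hab, MonoidAlgebra.single_mul_single]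
    · intro x y hx hy
      obtain ⟨⟨a, s⟩, hx⟩ := hx
      obtain ⟨⟨b, t⟩, hy⟩ := hy
      refine ⟨⟨a * t + b * s, s * t⟩, ?_⟩
      simp only [map_add, map_mul, Submonoid.coe_mul] at hx hy ⊢
      rw [← hx, ← hy]
      ring
    · intro r x hx
      obtain ⟨⟨a, s⟩, hx⟩ := hx
      refine ⟨⟨r • a, s⟩, ?_⟩
      simp only at hx ⊢
      rw [smul_mul_assoc, hx, hmap, hmap]
      exact (map_smul (MonoidAlgebra.mapDomainAlgHom k k j) r a).symm
  · intro x y h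
    exact ⟨1, by rw [MonoidAlgebra.mapDomain_injective hj h]⟩

/-- If all `d h ^ n` lie in a finitely generated saturated monoid, then so does `h`. -/
theorem mem_range_of_forall_mul_pow (hF : IsToric F) (j : F →* H) (hj : Function.Injective j)
    (hgen : ∀ h : H, ∃ a b : F, j a = h * j b) (d h : H) (H1 : ∀ n : ℕ, ∃ a, j a = d * h ^ n) :
    ∃ a, j a = h := by
  obtain ⟨s, hs⟩ := hF.fg.1
  have hex : ∀ a : F, ∃ c : s → ℕ, ∏ i, i.1 ^ c i = a := by
    intro a
    have ha : a ∈ Submonoid.closure (s : Set F) := hs ▸ Submonoid.mem_top a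
    obtain ⟨c, hc⟩ := Submonoid.mem_closure_finset.1 ha
    exact ⟨fun i => c i.1, (Finset.prod_coe_sort s fun a => a ^ c a).trans hc.2⟩
  choose a ha using H1
  choose c hc using fun n => hex (a n)
  -- Dickson's lemma for the exponent vectors: some `a m` divides a later `a n`, and cancelling
  -- leaves a positive power of `h` in the image of `F`.
  obtain ⟨m, n, hmn, hle⟩ := WellQuasiOrderedLE.wqo (α := s → ℕ) c
  have hx : (∏ i, i.1 ^ (c n i - c m i)) * a m = a n := by
    rw [← hc m, ← hc n, ← Finset.prod_mul_distrib]
    refine Finset.prod_congr rfl fun i _ => ?_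
    rw [← pow_add, Nat.sub_add_cancel (hle i)]
  have hx' : j (∏ i, i.1 ^ (c n i - c m i)) = h ^ (n - m) := by
    have h1 := congrArg j hx
    rw [map_mul, ha, ha] at h1
    have h2 : h ^ n = h ^ (n - m) * h ^ m := by rw [← pow_add, Nat.sub_add_cancel hmn.le]
    rw [h2] at h1
    have : j (∏ i, i.1 ^ (c n i - c m i)) * (d * h ^ m) = h ^ (n - m) * (d * h ^ m) := by
      rw [h1]; ac_rfl
    exact mul_right_cancel this
  obtain ⟨p, q, hpq⟩ := hgen h
  have hdvd : q ^ (n - m) ∣ p ^ (n - m) := by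
    refine ⟨∏ i, i.1 ^ (c n i - c m i), hj ?_⟩
    rw [map_mul, hx', map_pow, map_pow, hpq, mul_pow, mul_comm]
  obtain ⟨r, hr⟩ := hF.saturated p q _ (Nat.sub_ne_zero_of_lt hmn) hdvd
  refine ⟨r, ?_⟩
  have := congrArg j hr
  rw [map_mul, hpq, mul_comm] at this
  exact (mul_left_cancel this).symm

section Order

variable [LinearOrder H] [IsOrderedMonoid H]

/-- In an ordered cancellative group only one pair of exponents can reach the product of the upper
bounds, so leading terms multiply. -/
theorem coeff_mul_top {f g : MonoidAlgebra k H} {a b : H} (ha : ∀ x ∈ f.coeff.support, x ≤ a)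
    (hb : ∀ x ∈ g.coeff.support, x ≤ b) : (f * g).coeff (a * b) = f.coeff a * g.coeff b := by
  refine MonoidAlgebra.coeff_mul_mul_of_uniqueMul fun x y hx hy h => ?_
  have h1 := ha x hx
  have h2 := hb y hy
  rcases h1.lt_or_eq with h1' | rfl
  · exact absurd h (mul_lt_mul_of_lt_of_le h1' h2).ne
  · exact ⟨rfl, mul_left_cancel h⟩

theorem le_top_of_mem_support_mul {f g : MonoidAlgebra k H} {a b : H}
    (ha : ∀ x ∈ f.coeff.support, x ≤ a) (hb : ∀ x ∈ g.coeff.support, x ≤ b) :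
    ∀ x ∈ (f * g).coeff.support, x ≤ a * b := by
  classical
  intro x hx
  obtain ⟨y, hy, z, hz, rfl⟩ := Finset.mem_mul.1 (MonoidAlgebra.support_coeff_mul_subset f g hx)
  exact mul_le_mul' (ha y hy) (hb z hz)

theorem coeff_pow_top {f : MonoidAlgebra k H} {a : H} (ha : ∀ x ∈ f.coeff.support, x ≤ a) (n : ℕ) :
    (f ^ n).coeff (a ^ n) = f.coeff a ^ n ∧ ∀ x ∈ (f ^ n).coeff.support, x ≤ a ^ n := by
  induction n with
  | zero =>
    classical
    simp [MonoidAlgebra.one_def]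
  | succ n ih =>
    simp only [pow_succ]
    exact ⟨by rw [coeff_mul_top ih.2 ha, ih.1], le_top_of_mem_support_mul ih.2 ha⟩

/-- Induction on the number of terms. If r yⁿ lies in k[F] for all n, then so do the leading
exponents d mⁿ, hence m comes from F. Removing that leading term keeps y almost integral. -/
theorem mem_range_of_isAlmostIntegral (hF : IsToric F) (j : F →* H) (hj : Function.Injective j)
    (hgen : ∀ h : H, ∃ a b : F, j a = h * j b) (y : MonoidAlgebra k H) :
    letI := (MonoidAlgebra.mapDomainRingHom k j).toAlgebra
    IsAlmostIntegral (MonoidAlgebra k F) y → y ∈ (MonoidAlgebra.mapDomainRingHom k j).range := by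
  let := (MonoidAlgebra.mapDomainRingHom k j).toAlgebra
  intro hy
  induction hn : y.coeff.support.card using Nat.strong_induction_on generalizing y with
  | _ n ih =>
  by_cases h0 : y = 0
  · rw [h0]; exact zero_mem _
  have hne : y.coeff.support.Nonempty := by
    rw [Finsupp.support_nonempty_iff]
    exact fun h => h0 (MonoidAlgebra.coeff_injective (by simpa using h))
  obtain ⟨m, hm, hmax⟩ := y.coeff.support.exists_max_image id hne
  have hrange : ∀ z ∈ (MonoidAlgebra.mapDomainRingHom k j).range, ∀ h ∈ z.coeff.support,
      ∃ a, j a = h := by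
    rintro _ ⟨z, rfl⟩ h hh
    classical
    obtain ⟨a, -, ha⟩ := Finset.mem_image.1 (Finsupp.mapDomain_support hh)
    exact ⟨a, ha⟩
  have hmem : ∃ a, j a = m := by
    -- The multiplier `r` is nonzero and stays so in k[H]; its leading exponent is the constant `d`
    -- needed for `mem_range_of_forall_mul_pow`.
    obtain ⟨r, hr, hr'⟩ := hy
    have hr0 : r ≠ 0 := by
      rintro rfl
      exact one_ne_zero (hr.1 1 (by simp))
    have hjr : MonoidAlgebra.mapDomainRingHom k j r ≠ 0 := fun h =>
      hr0 (MonoidAlgebra.mapDomain_injective hj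
        (h.trans (map_zero (MonoidAlgebra.mapDomainRingHom k j)).symm))
    have hne' : (MonoidAlgebra.mapDomainRingHom k j r).coeff.support.Nonempty := by
      rw [Finsupp.support_nonempty_iff]
      exact fun h => hjr (MonoidAlgebra.coeff_injective (by simpa using h))
    obtain ⟨d, hd, hdmax⟩ := Finset.exists_max_image _ id hne'
    refine mem_range_of_forall_mul_pow hF j hj hgen d m fun n => hrange _ (hr' n) _ ?_
    rw [Algebra.smul_def, Finsupp.mem_support_iff]
    have h1 := coeff_pow_top hmax n
    erw [coeff_mul_top hdmax h1.2, h1.1]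
    exact mul_ne_zero (Finsupp.mem_support_iff.1 hd) (pow_ne_zero _ (Finsupp.mem_support_iff.1 hm))
  obtain ⟨a, rfl⟩ := hmem
  have hs : MonoidAlgebra.single (j a) (y.coeff (j a)) =
      MonoidAlgebra.mapDomainRingHom k j (MonoidAlgebra.single a (y.coeff (j a))) := by simp
  have hsub : y - MonoidAlgebra.single (j a) (y.coeff (j a)) ∈
      (MonoidAlgebra.mapDomainRingHom k j).range := by
    refine ih _ ?_ _ ?_ rfl
    · rw [← hn]
      refine Finset.card_lt_card ⟨fun x hx => ?_, fun h => ?_⟩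
      · rw [Finsupp.mem_support_iff] at hx ⊢
        intro hx0
        classical
        by_cases hxa : j a = x
        · subst hxa; simp at hx
        · simp [hxa, hx0] at hx
      · simpa using h hm
    · refine (completeIntegralClosure (MonoidAlgebra k F) (MonoidAlgebra k H)).sub_mem hy ?_
      rw [hs]
      exact (completeIntegralClosure (MonoidAlgebra k F) (MonoidAlgebra k H)).algebraMap_mem _
  have := add_mem hsub (hs ▸ ⟨_, rfl⟩ : MonoidAlgebra.single (j a) (y.coeff (j a)) ∈
    (MonoidAlgebra.mapDomainRingHom k j).range)
  simpa using this

/-- An integral fraction lies in the normal ring k[H]. There it is integral over k[F], hence almost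
integral since k[H] is a localization of k[F], and the leading term argument applies. -/
theorem isIntegrallyClosed_monoidAlgebra_of_embedding [IsDomain (MonoidAlgebra k F)]
    (hF : IsToric F) (j : F →* H)
    (hj : Function.Injective j) (hgen : ∀ h : H, ∃ a b : F, j a = h * j b)
    (hH : IsIntegrallyClosed (MonoidAlgebra k H)) : IsIntegrallyClosed (MonoidAlgebra k F) := by
  let := (MonoidAlgebra.mapDomainRingHom k j).toAlgebra
  set S := (⊤ : Submonoid F).map (MonoidAlgebra.of k F)
  have : IsLocalization S (MonoidAlgebra k H) := isLocalization_mapDomain j hj hgen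
  have hS : S ≤ nonZeroDivisors (MonoidAlgebra k F) := by
    rintro _ ⟨a, -, rfl⟩
    rw [mem_nonZeroDivisors_iff_ne_zero]
    simp
  let K := FractionRing (MonoidAlgebra k F)
  let : Algebra (MonoidAlgebra k H) K :=
    (IsLocalization.lift (M := S) (g := algebraMap (MonoidAlgebra k F) K)
      fun y => IsLocalization.map_units K ⟨y.1, hS y.2⟩).toAlgebra
  have : IsScalarTower (MonoidAlgebra k F) (MonoidAlgebra k H) K :=
    IsScalarTower.of_algebraMap_eq fun x => (IsLocalization.lift_eq _ x).symm
  have : IsFractionRing (MonoidAlgebra k H) K :=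
    IsFractionRing.isFractionRing_of_isDomain_of_isLocalization S _ _
  refine (isIntegrallyClosed_iff K).2 fun {x} hx => ?_
  obtain ⟨y, rfl⟩ := (isIntegrallyClosed_iff K).1 hH (hx.tower_top (A := MonoidAlgebra k H))
  have hy : IsIntegral (MonoidAlgebra k F) y := by
    rwa [isIntegral_algebraMap_iff (IsFractionRing.injective (MonoidAlgebra k H) K)] at hx
  obtain ⟨z, hz⟩ := mem_range_of_isAlmostIntegral hF j hj hgen y
    (hy.isAlmostIntegral_of_isLocalization S hS)
  exact ⟨z, by rw [← hz]; exact IsScalarTower.algebraMap_apply _ _ K z⟩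

end Order

/-- Laurent polynomials are a localization of the normal polynomial ring. The lexicographic order is
carried along only for its role in the leading term argument. -/
theorem isIntegrallyClosed_laurent (n : ℕ) :
    IsIntegrallyClosed (MonoidAlgebra k (Multiplicative (Lex (Fin n →₀ ℤ)))) := by
  let A := Multiplicative (Fin n →₀ ℕ)
  let j : A →* Multiplicative (Lex (Fin n →₀ ℤ)) :=
    AddMonoidHom.toMultiplicative
      ((Finsupp.mapRange.addMonoidHom (Nat.castAddMonoidHom ℤ) : (Fin n →₀ ℕ) →+ (Fin n →₀ ℤ)) :
        (Fin n →₀ ℕ) →+ Lex (Fin n →₀ ℤ))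
  have hj : Function.Injective j :=
    Finsupp.mapRange_injective (Nat.cast : ℕ → ℤ) Nat.cast_zero Nat.cast_injective
  have hgen : ∀ h, ∃ a b : A, j a = h * j b := by
    intro h
    let h' : Fin n →₀ ℤ := h
    -- The positive and negative parts of the exponent vector.
    refine ⟨Multiplicative.ofAdd (h'.mapRange Int.toNat rfl),
      Multiplicative.ofAdd ((-h').mapRange Int.toNat rfl), ?_⟩
    have : ((h'.mapRange Int.toNat rfl).mapRange (Nat.cast : ℕ → ℤ) rfl) =
        h' + ((-h').mapRange Int.toNat rfl).mapRange (Nat.cast : ℕ → ℤ) rfl := by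
      ext i
      simp
      omega
    exact this
  let e : MvPolynomial (Fin n) k ≃+* MonoidAlgebra k A := AddMonoidAlgebra.toMultiplicative k _
  have : IsDomain (MonoidAlgebra k A) :=
      MulEquiv.isDomain (MvPolynomial (Fin n) k) e.symm.toMulEquiv
  have : IsIntegrallyClosed (MonoidAlgebra k A) := .of_equiv e
  let := (MonoidAlgebra.mapDomainRingHom k j).toAlgebra
  have := isLocalization_mapDomain (k := k) j hj hgen
  refine isIntegrallyClosed_of_isLocalization (R := MonoidAlgebra k A) _
    ((⊤ : Submonoid A).map (MonoidAlgebra.of k A)) ?_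
  rintro _ ⟨a, -, rfl⟩
  rw [mem_nonZeroDivisors_iff_ne_zero]
  simp

/-- The group of fractions is finitely generated and torsion-free, hence free of finite rank; a
basis transports the lexicographic order to it. -/
theorem IsToric.exists_embedding (hF : IsToric F) :
    ∃ (n : ℕ) (j : F →* Multiplicative (Lex (Fin n →₀ ℤ))), Function.Injective j ∧
      ∀ h, ∃ a b : F, j a = h * j b := by
  have := hF.fg
  have := hF.cancel
  have := hF.torsionFree
  let : CancelCommMonoid F := { ‹CommMonoid F› with mul_left_cancel := hF.cancel.1.1 }
  let e := (Module.finBasis ℤ (Algebra.GrothendieckAddGroup (Additive F))).repr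
  let j₀ : Additive F →+ (Fin _ →₀ ℤ) :=
    e.toAddEquiv.toAddMonoidHom.comp (AddLocalization.addMonoidOf ⊤).toAddMonoidHom
  refine ⟨_, AddMonoidHom.toMultiplicative j₀, ?_, ?_⟩
  · refine e.injective.comp (Algebra.GrothendieckAddGroup.of_injective (M := Additive F))
  · intro h
    obtain ⟨g, hg⟩ := e.surjective h
    obtain ⟨⟨a, b⟩, hab⟩ := (AddLocalization.addMonoidOf (⊤ : AddSubmonoid (Additive F))).surj g
    refine ⟨a, b.1, ?_⟩
    have := congrArg e hab
    rw [map_add, hg] at this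
    exact this.symm

theorem IsToric.isDomain (hF : IsToric F) : IsDomain (MonoidAlgebra k F) := by
  obtain ⟨n, j, hj, -⟩ := hF.exists_embedding
  have : IsDomain (MonoidAlgebra k (Multiplicative (Lex (Fin n →₀ ℤ)))) :=
    NoZeroDivisors.to_isDomain _
  exact (MonoidAlgebra.mapDomain_injective (R := k) hj).isDomain
    (MonoidAlgebra.mapDomainRingHom k j)

theorem IsToric.isIntegrallyClosed (hF : IsToric F) : IsIntegrallyClosed (MonoidAlgebra k F) := by
  obtain ⟨n, j, hj, hgen⟩ := hF.exists_embedding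
  have := hF.isDomain (k := k)
  exact isIntegrallyClosed_monoidAlgebra_of_embedding hF j hj hgen (isIntegrallyClosed_laurent n)

end MonoidAlgebra

/-! ### Étale algebras over normal domains -/

section Etale

open TensorProduct

/-- This encodes that B is locally a domain. Over the fraction field K of C, the base change of B is
a finite product of fields, so a generates the same ideal as an idempotent e. This e is integral
over B. Integral closure commutes with smooth base change and C is integrally closed, so e already
lies in B. -/
theorem exists_mul_eq_zero_of_etale {C B : Type*} [CommRing C] [IsDomain C] [IsIntegrallyClosed C]
    [CommRing B] [Algebra C B] [Algebra.Etale C B] {a b : B} (hab : a * b = 0) :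
    ∃ e : B, e * b = 0 ∧ (1 - e) * a = 0 := by
  let K := FractionRing C
  let R := K ⊗[C] B
  have : Module.Finite K R := Algebra.FormallyUnramified.finite_of_free K R
  have : IsArtinianRing R := IsArtinianRing.of_finite K R
  have : IsReduced R := Algebra.FormallyUnramified.isReduced_of_field K R
  have : IsSemisimpleRing R := IsArtinianRing.isSemisimpleRing_of_isReduced R
  let σ : R ≃ₐ[C] B ⊗[C] K := Algebra.TensorProduct.comm C K B
  let i : B →ₐ[B] B ⊗[C] K := Algebra.ofId B _
  have hi : Function.Injective i := by
    have : Module.Flat C B := inferInstance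
    have h := Module.Flat.lTensor_preserves_injective_linearMap (M := B)
      (Algebra.linearMap C K) (IsFractionRing.injective C K)
    intro x y hxy
    have h1 : (Algebra.linearMap C K).lTensor B (x ⊗ₜ 1) =
        (Algebra.linearMap C K).lTensor B (y ⊗ₜ 1) := by
      simp only [LinearMap.lTensor_tmul, Algebra.linearMap_apply, map_one]
      exact hxy
    simpa using congrArg (TensorProduct.rid C B) (h h1)
  obtain ⟨e, he, hspan⟩ := IsSemisimpleRing.ideal_eq_span_idempotent (Ideal.span {σ.symm (i a)})
  obtain ⟨r, hr⟩ := Ideal.mem_span_singleton'.1 (hspan ▸ Ideal.mem_span_singleton_self _ :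
    σ.symm (i a) ∈ Ideal.span {e})
  obtain ⟨t, ht⟩ := Ideal.mem_span_singleton'.1 (hspan ▸ Ideal.mem_span_singleton_self _ :
    e ∈ Ideal.span {σ.symm (i a)})
  have hint : IsIntegral B (σ e) := by
    refine ⟨Polynomial.X ^ 2 - Polynomial.X,
      Polynomial.monic_X_pow_sub (lt_of_le_of_lt Polynomial.degree_X_le (by norm_num)), ?_⟩
    have : σ e * σ e = σ e := by rw [← map_mul, he.eq]
    simp [pow_two, this]
  obtain ⟨z, hz⟩ := (TensorProduct.toIntegralClosure_bijective_of_smooth (R := C) (S := B)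
    (B := K)).2 ⟨σ e, hint⟩
  have hz' : Algebra.TensorProduct.map (AlgHom.id B B) (integralClosure C K).val z = σ e :=
    congrArg Subtype.val hz
  -- Elements of K integral over C lie in C, so tensoring with the integral closure gives nothing
  -- beyond B.
  have hrange : ∀ z : B ⊗[C] integralClosure C K, ∃ c : B,
      i c = Algebra.TensorProduct.map (AlgHom.id B B) (integralClosure C K).val z := by
    intro z
    induction z with
    | zero => exact ⟨0, by simp⟩
    | tmul x y =>
      obtain ⟨c, hc⟩ := (isIntegrallyClosed_iff K).1 ‹_› y.2
      refine ⟨c • x, ?_⟩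
      simp only [i, Algebra.TensorProduct.map_tmul, AlgHom.coe_id, id_eq, Subalgebra.coe_val]
      rw [← hc, Algebra.algebraMap_eq_smul_one, TensorProduct.tmul_smul, TensorProduct.smul_tmul']
      rfl
    | add x y hx hy =>
      obtain ⟨c, hc⟩ := hx
      obtain ⟨d, hd⟩ := hy
      exact ⟨c + d, by rw [map_add, map_add, hc, hd]⟩
  obtain ⟨c, hc⟩ := hrange z
  rw [hz'] at hc
  refine ⟨c, hi ?_, hi ?_⟩
  · rw [map_mul, hc, ← ht, map_mul, AlgEquiv.apply_symm_apply, mul_assoc, ← map_mul, hab]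
    simp
  · rw [map_mul, map_sub, hc, map_one, map_zero, ← σ.apply_symm_apply (i a), ← hr, map_mul]
    have : σ e * σ e = σ e := by rw [← map_mul, he.eq]
    linear_combination (-σ r) * this

/-- If `C = A / I` is a normal domain and `O` is a local ring of an étale `A`-algebra `B` such that
`I O ≠ O`, then `I O` is prime and the images in `O` of the elements of `A ∖ I` do not lie in
`I O`. -/
theorem isPrime_map_of_etale {A B C O : Type*} [CommRing A] [CommRing B] [CommRing C] [CommRing O]
    [Algebra A B] [Algebra.Etale A B] [Algebra A C] [IsDomain C] [IsIntegrallyClosed C]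
    (hsurj : Function.Surjective (algebraMap A C))
    (I : Ideal A) (hker : RingHom.ker (algebraMap A C) = I)
    (q : Ideal B) [q.IsPrime] [Algebra B O] [IsLocalization.AtPrime O q]
    (hq : I.map (algebraMap A B) ≤ q) :
    ((I.map (algebraMap A B)).map (algebraMap B O)).IsPrime ∧
    ∀ a ∉ I, algebraMap B O (algebraMap A B a) ∉ (I.map (algebraMap A B)).map (algebraMap B O) := by
  set QB : Ideal B := I.map (algebraMap A B) with hQB
  let π : B →ₐ[A] C ⊗[A] B := Algebra.TensorProduct.includeRight
  have hπ : ∀ b, π b = 0 → b ∈ QB := by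
    intro b hb
    -- Right exactness, after identifying A ⊗ B with B: the kernel of B → C ⊗ B is I B.
    have h := Algebra.TensorProduct.rTensor_ker (R := A) (S := A) (C := B) (Algebra.ofId A C) hsurj
    have hb' : (1 ⊗ₜ b : A ⊗[A] B) ∈
        RingHom.ker (Algebra.TensorProduct.map (Algebra.ofId A C) (AlgHom.id A B)) := by
      rw [RingHom.mem_ker, Algebra.TensorProduct.map_tmul, map_one]
      exact hb
    rw [h] at hb'
    have h2 := Ideal.mem_map_of_mem (Algebra.TensorProduct.lid A B) hb'
    have h3 : RingHom.ker (Algebra.ofId A C) = I := hker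
    have h4 : (Algebra.TensorProduct.lid A B) (1 ⊗ₜ b) = b := by simp
    rw [h3, h4] at h2
    refine (Ideal.map_le_iff_le_comap.2 (Ideal.map_le_iff_le_comap.2 fun a ha => ?_)) h2
    have h5 : (Algebra.TensorProduct.lid A B) (a ⊗ₜ 1) = algebraMap A B a := by
      simp [Algebra.algebraMap_eq_smul_one]
    change (Algebra.TensorProduct.lid A B) (a ⊗ₜ 1) ∈ QB
    rw [h5]
    exact Ideal.mem_map_of_mem _ ha
  have hπQ : ∀ b ∈ QB, π b = 0 := by
    intro b hb
    have : QB ≤ RingHom.ker π := by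
      rw [hQB, Ideal.map_le_iff_le_comap]
      intro a ha
      rw [← hker, RingHom.mem_ker] at ha
      rw [Ideal.mem_comap, RingHom.mem_ker, AlgHom.commutes,
        IsScalarTower.algebraMap_apply A C, ha, map_zero]
    exact this hb
  have hπs : Function.Surjective π := by
    intro z
    induction z with
    | zero => exact ⟨0, map_zero _⟩
    | tmul c b =>
      obtain ⟨a, rfl⟩ := hsurj c
      refine ⟨a • b, ?_⟩
      change (1 : C) ⊗ₜ[A] (a • b) = algebraMap A C a ⊗ₜ b
      rw [TensorProduct.tmul_smul, TensorProduct.smul_tmul', Algebra.algebraMap_eq_smul_one]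
    | add x y hx hy =>
      obtain ⟨c, hc⟩ := hx
      obtain ⟨d, hd⟩ := hy
      exact ⟨c + d, by rw [map_add, hc, hd]⟩
  have hnot : ∀ a ∉ I, algebraMap B O (algebraMap A B a) ∉ QB.map (algebraMap B O) := by
    intro a ha h
    obtain ⟨m, hm, hmp⟩ := (IsLocalization.algebraMap_mem_map_algebraMap_iff q.primeCompl O _ _).1 h
    have h1 := hπQ _ hmp
    rw [← hker, RingHom.mem_ker] at ha
    rw [map_mul, AlgHom.commutes, IsScalarTower.algebraMap_apply A C, mul_comm,
      ← Algebra.smul_def] at h1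
    -- C ⊗ B is flat over the domain C, hence torsion-free, so the nonzero image of `a` cannot kill
    -- the image of `m` unless `m` lies in I B.
    have : Module.Flat C (C ⊗[A] B) := inferInstance
    exact hm (hq (hπ _ ((smul_eq_zero.1 h1).resolve_left ha)))
  refine ⟨⟨fun h => ?_, fun {x y} hxy => ?_⟩, hnot⟩
  · refine hnot 1 (fun h1 => ?_) (h ▸ Submodule.mem_top)
    exact Ideal.IsPrime.ne_top ‹_› ((Ideal.eq_top_iff_one _).2
      (hq (by simpa using Ideal.mem_map_of_mem (algebraMap A B) h1)))
  · obtain ⟨a, s, rfl⟩ := IsLocalization.exists_mk'_eq q.primeCompl x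
    obtain ⟨b, t, rfl⟩ := IsLocalization.exists_mk'_eq q.primeCompl y
    rw [← IsLocalization.mk'_mul, IsLocalization.mk'_mem_map_algebraMap_iff] at hxy
    obtain ⟨m, hm, hab⟩ := hxy
    rw [IsLocalization.mk'_mem_map_algebraMap_iff, IsLocalization.mk'_mem_map_algebraMap_iff]
    have h := hπQ _ hab
    rw [← mul_assoc, map_mul] at h
    -- One of `e` and `1 - e` lies outside q and becomes a unit in O; it kills one of the two
    -- factors modulo I.
    obtain ⟨e, he, he'⟩ := exists_mul_eq_zero_of_etale (C := C) h
    obtain ⟨e, rfl⟩ := hπs e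
    rw [← map_mul] at he
    rw [← map_one π, ← map_sub, ← map_mul] at he'
    by_cases heq : e ∈ q
    · left
      refine ⟨(1 - e) * m, q.primeCompl.mul_mem (fun h => ?_) hm, ?_⟩
      · exact Ideal.IsPrime.ne_top ‹_› ((Ideal.eq_top_iff_one _).2 (by simpa using add_mem h heq))
      · rw [mul_assoc]
        exact hπ _ he'
    · right
      exact ⟨e, heq, hπ _ he⟩

end Etale

/-! ### Faces -/

section Face

variable {P : Type u} [CommMonoid P]

/-- A submonoid is a face if it contains the factors of its elements. -/
def IsFace (F : Submonoid P) : Prop := ∀ a b : P, a * b ∈ F → a ∈ F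

theorem IsFace.mul_mem_iff {F : Submonoid P} (hF : IsFace F) {a b : P} :
    a * b ∈ F ↔ a ∈ F ∧ b ∈ F :=
  ⟨fun h => ⟨hF a b h, hF b a (mul_comm a b ▸ h)⟩, fun h => F.mul_mem h.1 h.2⟩

/-- A product lies in a face only if all its factors do, so the generators inside the face suffice.
This yields both finite generation of faces and their finite number. -/
theorem IsFace.eq_closure {F : Submonoid P} (hF : IsFace F) {s : Set P}
    (hs : Submonoid.closure s = ⊤) : Submonoid.closure (s ∩ F) = F := by
  refine le_antisymm (Submonoid.closure_le.2 Set.inter_subset_right) fun x hx => ?_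
  have h : x ∈ Submonoid.closure s := hs ▸ Submonoid.mem_top x
  induction h using Submonoid.closure_induction with
  | mem y hy => exact Submonoid.subset_closure ⟨hy, hx⟩
  | one => exact one_mem _
  | mul a b _ _ ha hb =>
    exact mul_mem (ha (hF.mul_mem_iff.1 hx).1) (hb (hF.mul_mem_iff.1 hx).2)

theorem IsFace.fg {F : Submonoid P} (hF : IsFace F) (hP : Monoid.FG P) : F.FG := by
  classical
  obtain ⟨s, hs⟩ := hP.1
  refine ⟨s.filter (· ∈ F), ?_⟩
  convert hF.eq_closure hs using 2
  ext; simp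

theorem finite_setOf_isFace (hP : Monoid.FG P) : {F : Submonoid P | IsFace F}.Finite := by
  obtain ⟨s, hs⟩ := hP.1
  refine (s.finite_toSet.finite_subsets.image fun t => Submonoid.closure t).subset ?_
  intro F hF
  exact ⟨(s : Set P) ∩ F, Set.inter_subset_left, IsFace.eq_closure hF hs⟩

theorem IsToric.face (hP : IsToric P) {F : Submonoid P} (hF : IsFace F) : IsToric F where
  fg := (Monoid.fg_iff_submonoid_fg F).2 (hF.fg hP.fg)
  cancel :=
    have := hP.cancel
    inferInstance
  saturated a b n hn h := by
    obtain ⟨c, hc⟩ := h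
    obtain ⟨d, hd⟩ := hP.saturated a.1 b.1 n hn ⟨c.1, congrArg Subtype.val hc⟩
    exact ⟨⟨d, (hF.mul_mem_iff.1 (hd ▸ a.2)).2⟩, Subtype.ext hd⟩
  torsionFree := ⟨fun n hn a b h => Subtype.ext
    (hP.torsionFree.pow_left_injective hn (congrArg Subtype.val h))⟩

variable (k : Type u) [Field k]

open Classical in
/-- The projection `k[P] → k[F]` to the monoid algebra of a face. -/
def faceProj {F : Submonoid P} (hF : IsFace F) : MonoidAlgebra k P →ₐ[k] MonoidAlgebra k F :=
  MonoidAlgebra.lift k (MonoidAlgebra k F) P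
    { toFun := fun p => if h : p ∈ F then MonoidAlgebra.of k F ⟨p, h⟩ else 0
      map_one' := by
        rw [dif_pos F.one_mem]
        exact map_one _
      map_mul' := fun a b => by
        by_cases ha : a ∈ F
        · by_cases hb : b ∈ F
          · rw [dif_pos ha, dif_pos hb, dif_pos (F.mul_mem ha hb), ← map_mul]
            rfl
          · rw [dif_neg hb, dif_neg fun h => hb (hF.mul_mem_iff.1 h).2, mul_zero]
        · rw [dif_neg ha, dif_neg fun h => ha (hF.mul_mem_iff.1 h).1, zero_mul] }

theorem faceProj_of_mem {F : Submonoid P} (hF : IsFace F) {p : P} (hp : p ∈ F) :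
    faceProj k hF (MonoidAlgebra.of k P p) = MonoidAlgebra.of k F ⟨p, hp⟩ := by
  simp [faceProj, hp]

theorem faceProj_of_notMem {F : Submonoid P} (hF : IsFace F) {p : P} (hp : p ∉ F) :
    faceProj k hF (MonoidAlgebra.of k P p) = 0 := by
  simp [faceProj, hp]

/-- Monomials in the face are fixed and the others are killed. This determines the kernel of the
projection to k[F]. -/
theorem sub_faceProj_mem {F : Submonoid P} (hF : IsFace F) (y : MonoidAlgebra k P) :
    y - MonoidAlgebra.mapDomainRingHom k F.subtype (faceProj k hF y) ∈
      Ideal.span {x | ∃ p ∉ F, x = MonoidAlgebra.of k P p} := by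
  refine MonoidAlgebra.induction_on
    (motive := fun y => y - MonoidAlgebra.mapDomainRingHom k F.subtype (faceProj k hF y) ∈
      Ideal.span {x | ∃ p ∉ F, x = MonoidAlgebra.of k P p}) y ?_ ?_ ?_
  · intro p
    by_cases hp : p ∈ F
    · rw [faceProj_of_mem k hF hp]
      simp
    · rw [faceProj_of_notMem k hF hp, map_zero, sub_zero]
      exact Ideal.subset_span ⟨p, hp, rfl⟩
  · intro x y hx hy
    rw [map_add, map_add, add_sub_add_comm]
    exact add_mem hx hy
  · intro r x hx
    have : MonoidAlgebra.mapDomainRingHom k F.subtype (faceProj k hF (r • x)) =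
        r • MonoidAlgebra.mapDomainRingHom k F.subtype (faceProj k hF x) := by
      rw [map_smul]
      exact map_smul (MonoidAlgebra.mapDomainAlgHom k k F.subtype) r _
    rw [this, ← smul_sub, Algebra.smul_def]
    exact Ideal.mul_mem_left _ _ hx

variable {ρ : P}

/-- The projection `k[P] / (χ^ρ) → k[F]` for a face `F` which does not contain `ρ`. -/
def boundaryFaceProj {F : Submonoid P} (hF : IsFace F) (hρ : ρ ∉ F) :
    boundaryRing k P ρ →+* MonoidAlgebra k F :=
  Ideal.Quotient.lift _ (faceProj k hF).toRingHom fun a ha => by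
    have : Ideal.span {MonoidAlgebra.of k P ρ} ≤ RingHom.ker (faceProj k hF).toRingHom := by
      rw [Ideal.span_le, Set.singleton_subset_iff]
      exact faceProj_of_notMem k hF hρ
    exact this ha

theorem boundaryFaceProj_character_of_mem {F : Submonoid P} (hF : IsFace F) (hρ : ρ ∉ F) {p : P}
    (hp : p ∈ F) : boundaryFaceProj k hF hρ (character k ρ p) = MonoidAlgebra.of k F ⟨p, hp⟩ :=
  faceProj_of_mem k hF hp

theorem boundaryFaceProj_character_of_notMem {F : Submonoid P} (hF : IsFace F) (hρ : ρ ∉ F) {p : P}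
    (hp : p ∉ F) : boundaryFaceProj k hF hρ (character k ρ p) = 0 :=
  faceProj_of_notMem k hF hp

theorem boundaryFaceProj_surjective {F : Submonoid P} (hF : IsFace F) (hρ : ρ ∉ F) :
    Function.Surjective (boundaryFaceProj k hF hρ) := by
  intro z
  refine ⟨Ideal.Quotient.mk _ (MonoidAlgebra.mapDomainRingHom k F.subtype z), ?_⟩
  refine MonoidAlgebra.induction_on
    (motive := fun z => faceProj k hF (MonoidAlgebra.mapDomainRingHom k F.subtype z) = z) z ?_ ?_ ?_
  · intro p
    have := faceProj_of_mem k hF p.2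
    simpa using this
  · intro x y hx hy
    rw [map_add, map_add, hx, hy]
  · intro r x hx
    have : MonoidAlgebra.mapDomainRingHom k F.subtype (r • x) =
        r • MonoidAlgebra.mapDomainRingHom k F.subtype x :=
      map_smul (MonoidAlgebra.mapDomainAlgHom k k F.subtype) r x
    rw [this, map_smul, hx]

theorem ker_boundaryFaceProj {F : Submonoid P} (hF : IsFace F) (hρ : ρ ∉ F) :
    RingHom.ker (boundaryFaceProj k hF hρ) = Ideal.span {x | ∃ p ∉ F, x = character k ρ p} := by
  refine le_antisymm ?_ (Ideal.span_le.2 ?_)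
  · intro x hx
    obtain ⟨y, rfl⟩ := Ideal.Quotient.mk_surjective x
    have hy : faceProj k hF y = 0 := hx
    have h := Ideal.mem_map_of_mem (Ideal.Quotient.mk (Ideal.span {MonoidAlgebra.of k P ρ}))
      (sub_faceProj_mem k hF y)
    rw [hy, map_zero, sub_zero, Ideal.map_span] at h
    refine Ideal.span_mono ?_ h
    rintro _ ⟨_, ⟨p, hp, rfl⟩, rfl⟩
    exact ⟨p, hp, rfl⟩
  · rintro _ ⟨p, hp, rfl⟩
    exact boundaryFaceProj_character_of_notMem k hF hρ hp

/-- In a local ring `O` of an étale algebra over `k[P] / (χ^ρ)`, the ideal generated by the `χ^p`,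
`p ∉ F`, is prime and contains no `χ^p` with `p ∈ F`. -/
theorem isPrime_span_character (hP : IsToric P) {F : Submonoid P} (hF : IsFace F) (hρ : ρ ∉ F)
    {B : Type u} [CommRing B] [Algebra (boundaryRing k P ρ) B]
      [Algebra.Etale (boundaryRing k P ρ) B]
    (q : Ideal B) [q.IsPrime]
    (hq : ∀ p ∉ F, algebraMap (boundaryRing k P ρ) B (character k ρ p) ∈ q)
    {O : Type u} [CommRing O] [Algebra B O] [IsLocalization.AtPrime O q] :
    (Ideal.span {x | ∃ p ∉ F, x = algebraMap B O
      (algebraMap (boundaryRing k P ρ) B (character k ρ p))}).IsPrime ∧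
    ∀ p ∈ F, algebraMap B O (algebraMap (boundaryRing k P ρ) B (character k ρ p)) ∉
      Ideal.span {x | ∃ p ∉ F, x = algebraMap B O
        (algebraMap (boundaryRing k P ρ) B (character k ρ p))} := by
  have : IsDomain (MonoidAlgebra k F) := (hP.face hF).isDomain
  have : IsIntegrallyClosed (MonoidAlgebra k F) := (hP.face hF).isIntegrallyClosed
  let : Algebra (boundaryRing k P ρ) (MonoidAlgebra k F) := (boundaryFaceProj k hF hρ).toAlgebra
  have hmap : Ideal.span {x | ∃ p ∉ F, x = algebraMap B O
      (algebraMap (boundaryRing k P ρ) B (character k ρ p))} =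
      ((Ideal.span {x | ∃ p ∉ F, x = character k ρ p}).map
        (algebraMap (boundaryRing k P ρ) B)).map (algebraMap B O) := by
    rw [Ideal.map_span, Ideal.map_span]
    congr 1
    ext x
    constructor
    · rintro ⟨p, hp, rfl⟩
      exact ⟨_, ⟨_, ⟨p, hp, rfl⟩, rfl⟩, rfl⟩
    · rintro ⟨_, ⟨_, ⟨p, hp, rfl⟩, rfl⟩, rfl⟩
      exact ⟨p, hp, rfl⟩
  rw [hmap]
  have key := isPrime_map_of_etale (O := O) (boundaryFaceProj_surjective k hF hρ)
    (Ideal.span {x | ∃ p ∉ F, x = character k ρ p}) (ker_boundaryFaceProj k hF hρ) q (by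
      rw [Ideal.map_span, Ideal.span_le]
      rintro _ ⟨_, ⟨p, hp, rfl⟩, rfl⟩
      exact hq p hp)
  refine ⟨key.1, fun p hp => key.2 _ fun h => ?_⟩
  rw [← ker_boundaryFaceProj k hF hρ, RingHom.mem_ker,
    boundaryFaceProj_character_of_mem k hF hρ hp] at h
  simp at h

end Face

/-! ### Stalks of sheaves of families -/

namespace BasicSections

variable {T : TopCat.{u}} {A : T → Type u} [∀ x, CommMonoid (A x)] (B : BasicSections T A)

/-- The values of sections at a point. -/
def evalCocone (x : T) : Cocone ((OpenNhds.inclusion x).op ⋙ B.presheaf) where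
  pt := CommMonCat.of (A x)
  ι :=
    { app := fun U => CommMonCat.ofHom
        { toFun := fun s => s.1 ⟨x, U.unop.2⟩
          map_one' := rfl
          map_mul' := fun _ _ => rfl }
      naturality := fun _ _ _ => rfl }

/-- The value of a germ of a section. -/
def eval (x : T) : B.presheaf.stalk x →* A x :=
  (colimit.desc _ (B.evalCocone x) : B.presheaf.stalk x ⟶ CommMonCat.of (A x)).hom

theorem eval_germ (x : T) (U : Opens T) (hx : x ∈ U) (s : B.presheaf.obj (op U)) :
    B.eval x (B.presheaf.germ U x hx s) = s.1 ⟨x, hx⟩ :=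
  ConcreteCategory.congr_hom (colimit.ι_desc (B.evalCocone x) (op ⟨U, hx⟩)) s

theorem mem_sections_of_basic {U : Opens T} {s : ∀ x : U, A x} (h : s ∈ B.basic U) :
    s ∈ B.sections U := fun x => ⟨U, x.2, 𝟙 _, h⟩

theorem exists_basic {U : Opens T} (s : B.presheaf.obj (op U)) {x : T} (hx : x ∈ U) :
    ∃ (V : Opens T) (_ : x ∈ V) (h : V ≤ U), (fun y : V => s.1 ⟨y.1, h y.2⟩) ∈ B.basic V := by
  obtain ⟨V, hV, i, h⟩ := s.2 ⟨x, hx⟩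
  exact ⟨V, hV, i.le, h⟩

/-- Germs are locally basic, so it is enough that equality of two basic sections at a point spreads
to a neighbourhood. The quotient sheaves, the restriction to the fan and Spec of a monoid all get
their stalks this way. -/
theorem eval_injective (x : T)
    (H : ∀ (U : Opens T) (hx : x ∈ U) (s t : ∀ y : U, A y), s ∈ B.basic U → t ∈ B.basic U →
      s ⟨x, hx⟩ = t ⟨x, hx⟩ → ∃ (V : Opens T) (_ : x ∈ V) (h : V ≤ U), ∀ y : V,
        s ⟨y.1, h y.2⟩ = t ⟨y.1, h y.2⟩) : Function.Injective (B.eval x) := by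
  intro a b hab
  obtain ⟨U, hU, s, rfl⟩ := B.presheaf.exists_germ_eq a
  obtain ⟨V, hV, t, rfl⟩ := B.presheaf.exists_germ_eq b
  rw [eval_germ, eval_germ] at hab
  obtain ⟨U', hU', iU, hs⟩ := B.exists_basic s hU
  obtain ⟨V', hV', iV, ht⟩ := B.exists_basic t hV
  obtain ⟨W, hW, i, h⟩ := H (U' ⊓ V') ⟨hU', hV'⟩ _ _ (B.res (homOfLE inf_le_left) _ hs)
    (B.res (homOfLE inf_le_right) _ ht) hab
  have hWU : W ≤ U := i.trans (inf_le_left.trans iU)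
  have hWV : W ≤ V := i.trans (inf_le_right.trans iV)
  refine B.presheaf.germ_ext W hW (homOfLE hWU) (homOfLE hWV) ?_
  exact Subtype.ext (funext h)

theorem eval_surjective (x : T)
    (H : ∀ a : A x, ∃ (U : Opens T) (hx : x ∈ U), ∃ s ∈ B.basic U, s ⟨x, hx⟩ = a) :
    Function.Surjective (B.eval x) := by
  intro a
  obtain ⟨U, hx, s, hs, rfl⟩ := H a
  exact ⟨B.presheaf.germ U x hx ⟨s, B.mem_sections_of_basic hs⟩, eval_germ _ _ _ _ _⟩

end BasicSections

section Quotient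

variable {T : TopCat.{u}} (M : TopCat.Presheaf CommMonCat.{u} T) (c : ∀ x : T, Con (M.stalk x))

/-- The map from the stalks of a quotient sheaf to the quotients of the stalks. -/
def quotientEval (x : T) : (quotientSheaf M c).presheaf.stalk x →* (c x).Quotient :=
  (quotientBasic M c).eval x

theorem quotientEval_germ (x : T) (U : Opens T) (hx : x ∈ U)
    (s : (quotientSheaf M c).presheaf.obj (op U)) :
    quotientEval M c x ((quotientSheaf M c).presheaf.germ U x hx s) = s.1 ⟨x, hx⟩ :=
  (quotientBasic M c).eval_germ x U hx s

theorem exists_rep (x : T) (U : Opens T) (hx : x ∈ U)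
    (s : (quotientSheaf M c).presheaf.obj (op U)) :
    ∃ (V : Opens T) (_ : x ∈ V) (h : V ≤ U) (m : M.obj (op V)), ∀ (y : T) (hy : y ∈ V),
      s.1 ⟨y, h hy⟩ = (c y).mk' (M.germ V y hy m) := by
  obtain ⟨V, hV, h, m, hm⟩ := (quotientBasic M c).exists_basic s hx
  exact ⟨V, hV, h, m, fun y hy => (congrFun hm ⟨y, hy⟩).symm⟩

theorem quotientEval_surjective (x : T) : Function.Surjective (quotientEval M c x) := by
  refine (quotientBasic M c).eval_surjective x fun a => ?_
  obtain ⟨a, rfl⟩ := Con.mk'_surjective a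
  obtain ⟨U, hx, m, rfl⟩ := M.exists_germ_eq a
  exact ⟨U, hx, _, ⟨m, rfl⟩, rfl⟩

theorem quotientEval_injective (x : T)
    (H : ∀ (U : Opens T) (hx : x ∈ U) (m m' : M.obj (op U)),
      c x (M.germ U x hx m) (M.germ U x hx m') → ∃ (V : Opens T) (_ : x ∈ V) (h : V ≤ U),
        ∀ (y : T) (hy : y ∈ V), c y (M.germ U y (h hy) m) (M.germ U y (h hy) m')) :
    Function.Injective (quotientEval M c x) := by
  refine (quotientBasic M c).eval_injective x ?_
  rintro U hx _ _ ⟨m, rfl⟩ ⟨m', rfl⟩ h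
  obtain ⟨V, hV, i, h⟩ := H U hx m m' ((Con.eq _).1 h)
  exact ⟨V, hV, i, fun y => (Con.eq _).2 (h y.1 y.2)⟩

end Quotient

section Germs

variable {T : TopCat.{u}} (M : TopCat.Presheaf CommMonCat.{u} T)

/-- Relations between germs hold on a neighbourhood. -/
theorem exists_nhds_of_germ_eq {x : T} {U : Opens T} (hx : x ∈ U) {m m' : M.obj (op U)}
    (h : M.germ U x hx m = M.germ U x hx m') : ∃ (V : Opens T) (_ : x ∈ V) (i : V ≤ U),
      M.map (homOfLE i).op m = M.map (homOfLE i).op m' := by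
  obtain ⟨V, hV, i, j, h⟩ := M.germ_eq x hx hx m m' h
  exact ⟨V, hV, i.le, h⟩

theorem exists_nhds_dvd {x : T} {U : Opens T} (hx : x ∈ U) {m m' : M.obj (op U)}
    (h : M.germ U x hx m ∣ M.germ U x hx m') : ∃ (V : Opens T) (_ : x ∈ V) (i : V ≤ U),
      M.map (homOfLE i).op m ∣ M.map (homOfLE i).op m' := by
  obtain ⟨a, ha⟩ := h
  obtain ⟨V, hV, a, rfl⟩ := M.exists_germ_eq a
  have hUV : x ∈ U ⊓ V := ⟨hx, hV⟩
  have h1 : M.germ (U ⊓ V) x hUV (M.map (homOfLE inf_le_left).op m') =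
      M.germ (U ⊓ V) x hUV (M.map (homOfLE inf_le_left).op m *
        M.map (homOfLE inf_le_right).op a) := by
    rw [map_mul, TopCat.Presheaf.germ_res_apply, TopCat.Presheaf.germ_res_apply,
      TopCat.Presheaf.germ_res_apply, ha]
  obtain ⟨W, hW, i, h⟩ := exists_nhds_of_germ_eq M _ h1
  refine ⟨W, hW, i.trans inf_le_left, M.map (homOfLE (i.trans inf_le_right)).op a, ?_⟩
  rw [map_mul] at h
  simp only [← ConcreteCategory.comp_apply, ← Functor.map_comp] at h
  exact h

theorem germ_map_dvd {U V : Opens T} (i : V ≤ U) {y : T} (hy : y ∈ V) {m m' : M.obj (op U)}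
    (h : M.map (homOfLE i).op m ∣ M.map (homOfLE i).op m') :
    M.germ U y (i hy) m ∣ M.germ U y (i hy) m' := by
  have := map_dvd (M.germ V y hy).hom h
  erw [TopCat.Presheaf.germ_res_apply, TopCat.Presheaf.germ_res_apply] at this
  exact this

theorem germ_eq_of_map_eq {U V : Opens T} (i : V ≤ U) {y : T} (hy : y ∈ V) {m m' : M.obj (op U)}
    (h : M.map (homOfLE i).op m = M.map (homOfLE i).op m') :
    M.germ U y (i hy) m = M.germ U y (i hy) m' := by
  rw [← M.germ_res_apply (homOfLE i) y hy, h, M.germ_res_apply]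

theorem exists_nhds_associated {x : T} {U : Opens T} (hx : x ∈ U) {m m' : M.obj (op U)}
    (h : Associated (M.germ U x hx m) (M.germ U x hx m')) :
    ∃ (V : Opens T) (_ : x ∈ V) (i : V ≤ U),
      Associated (M.map (homOfLE i).op m) (M.map (homOfLE i).op m') := by
  -- The unit is opened up so that it and its inverse both extend to sections; the relation `a * b =
  -- 1` then has to be spread out as well.
  obtain ⟨⟨a, b, hab, _⟩, ha⟩ := h
  simp only at ha
  obtain ⟨V, hV, a, rfl⟩ := M.exists_germ_eq a
  obtain ⟨V', hV', b, rfl⟩ := M.exists_germ_eq b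
  let W := U ⊓ V ⊓ V'
  have iU : W ≤ U := inf_le_left.trans inf_le_left
  have iV : W ≤ V := inf_le_left.trans inf_le_right
  have iV' : W ≤ V' := inf_le_right
  have hW : x ∈ W := ⟨⟨hx, hV⟩, hV'⟩
  have h1 : M.germ W x hW (M.map (homOfLE iV).op a * M.map (homOfLE iV').op b) =
      M.germ W x hW 1 := by
    rw [map_mul, TopCat.Presheaf.germ_res_apply, TopCat.Presheaf.germ_res_apply, hab, map_one]
  have h2 : M.germ W x hW (M.map (homOfLE iU).op m * M.map (homOfLE iV).op a) =
      M.germ W x hW (M.map (homOfLE iU).op m') := by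
    rw [map_mul, TopCat.Presheaf.germ_res_apply, TopCat.Presheaf.germ_res_apply,
      TopCat.Presheaf.germ_res_apply, ha]
  obtain ⟨W₁, hW₁, i₁, h1⟩ := exists_nhds_of_germ_eq M _ h1
  obtain ⟨W₂, hW₂, i₂, h2⟩ := exists_nhds_of_germ_eq M _ h2
  have j₁ : W₁ ⊓ W₂ ≤ W₁ := inf_le_left
  have j₂ : W₁ ⊓ W₂ ≤ W₂ := inf_le_right
  have h1 := congrArg (M.map (homOfLE j₁).op) h1
  have h2 := congrArg (M.map (homOfLE j₂).op) h2
  simp only [map_mul, map_one, ← ConcreteCategory.comp_apply, ← Functor.map_comp] at h1 h2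
  refine ⟨W₁ ⊓ W₂, ⟨hW₁, hW₂⟩, j₁.trans (i₁.trans iU), ?_⟩
  exact ⟨⟨_, _, h1, (mul_comm _ _).trans h1⟩, h2⟩

theorem germ_map_associated {U V : Opens T} (i : V ≤ U) {y : T} (hy : y ∈ V) {m m' : M.obj (op U)}
    (h : Associated (M.map (homOfLE i).op m) (M.map (homOfLE i).op m')) :
    Associated (M.germ U y (i hy) m) (M.germ U y (i hy) m') := by
  have := h.map (M.germ V y hy).hom
  erw [TopCat.Presheaf.germ_res_apply, TopCat.Presheaf.germ_res_apply] at this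
  exact this

theorem quotientEval_unitsCon_bijective (x : T) :
    Function.Bijective (quotientEval M (fun x => unitsCon (M.stalk x)) x) := by
  refine ⟨quotientEval_injective _ _ _ fun U hx m m' h => ?_, quotientEval_surjective _ _ _⟩
  obtain ⟨V, hV, i, h⟩ := exists_nhds_associated M hx h
  exact ⟨V, hV, i, fun y hy => germ_map_associated M i hy h⟩

theorem quotientEval_idealCon_bijective (ρ : M.obj (op ⊤)) (x : T) :
    Function.Bijective (quotientEval M (fun x => idealCon (M.germ ⊤ x trivial ρ)) x) := by
  refine ⟨quotientEval_injective _ _ _ fun U hx m m' h => ?_, quotientEval_surjective _ _ _⟩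
  rcases h with h | ⟨h, h'⟩
  · obtain ⟨V, hV, i, h⟩ := exists_nhds_of_germ_eq M hx h
    exact ⟨V, hV, i, fun y hy => Or.inl (germ_eq_of_map_eq M i hy h)⟩
  · have hρ : ∀ y (hy : y ∈ U), M.germ ⊤ y trivial ρ =
        M.germ U y hy (M.map (homOfLE le_top).op ρ) := fun y hy => by
      rw [TopCat.Presheaf.germ_res_apply]
    rw [hρ x hx] at h h'
    obtain ⟨V, hV, i, h⟩ := exists_nhds_dvd M hx h
    obtain ⟨V', hV', i', h'⟩ := exists_nhds_dvd M hx h'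
    refine ⟨V ⊓ V', ⟨hV, hV'⟩, inf_le_left.trans i, fun y hy => Or.inr ?_⟩
    rw [hρ y (i hy.1)]
    exact ⟨germ_map_dvd M i hy.1 h, germ_map_dvd M i' hy.2 h'⟩

end Germs

/-! ### Stalks of log structures -/

namespace LogStructure

variable {U : Scheme.{u}} (L : LogStructure U)

/-- The cocone of the maps from sections of the log structure to the local ring. -/
def stalkCocone (x : U) : Cocone ((OpenNhds.inclusion x).op ⋙ L.M.presheaf) where
  pt := CommMonCat.of (U.presheaf.stalk x)
  ι :=
    { app := fun V => CommMonCat.ofHom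
        (((U.presheaf.germ V.unop.1 x V.unop.2).hom : _ →* U.presheaf.stalk x).comp (L.α V.unop.1))
      naturality := fun V W i => by
        ext m
        refine (congrArg (U.presheaf.germ W.unop.1 x W.unop.2)
          (L.naturality (homOfLE i.unop.le) m)).trans ?_
        exact U.presheaf.germ_res_apply (homOfLE i.unop.le) x W.unop.2 (L.α V.unop.1 m) }

/-- The homomorphism from the stalk of a log structure to the local ring. -/
def stalkα (x : U) : L.M.presheaf.stalk x →* U.presheaf.stalk x :=
  (colimit.desc _ (L.stalkCocone x) :
    L.M.presheaf.stalk x ⟶ CommMonCat.of (U.presheaf.stalk x)).hom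

theorem stalkα_germ (x : U) (V : U.Opens) (hx : x ∈ V) (m : L.M.presheaf.obj (op V)) :
    L.stalkα x (L.M.presheaf.germ V x hx m) = U.presheaf.germ V x hx (L.α V m) :=
  ConcreteCategory.congr_hom (colimit.ι_desc (L.stalkCocone x) (op ⟨V, hx⟩)) m

theorem stalkα_specializes {v u : U} (h : v ⤳ u) (a : L.M.presheaf.stalk u) :
    L.stalkα v (L.M.presheaf.stalkSpecializes h a) =
      U.presheaf.stalkSpecializes h (L.stalkα u a) := by
  obtain ⟨V, hV, m, rfl⟩ := L.M.presheaf.exists_germ_eq a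
  rw [TopCat.Presheaf.germ_stalkSpecializes_apply, stalkα_germ, stalkα_germ,
    TopCat.Presheaf.germ_stalkSpecializes_apply]

theorem isUnit_of_isUnit_α {V : U.Opens} {m : L.M.presheaf.obj (op V)} (h : IsUnit (L.α V m)) :
    IsUnit m := by
  obtain ⟨f, hf⟩ := h.exists_right_inv
  obtain ⟨m', hm', -⟩ := L.bijective V f (IsUnit.of_mul_eq_one _ ((mul_comm _ _).trans hf))
  refine IsUnit.of_mul_eq_one m' ((L.bijective V 1 isUnit_one).unique ?_ (map_one _))
  rw [map_mul, hm', hf]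

/-- If the function is invertible at the point, it is so on its basic open set, and there the log
structure axiom supplies an inverse section. -/
theorem isUnit_stalkα_iff (x : U) (a : L.M.presheaf.stalk x) :
    IsUnit (L.stalkα x a) ↔ IsUnit a := by
  refine ⟨fun h => ?_, fun h => h.map _⟩
  obtain ⟨V, hV, m, rfl⟩ := L.M.presheaf.exists_germ_eq a
  rw [stalkα_germ] at h
  have hx : x ∈ U.basicOpen (L.α V m) := (U.mem_basicOpen _ x hV).2 h
  have hunit := U.toRingedSpace.isUnit_res_basicOpen (L.α V m)
  have i : U.basicOpen (L.α V m) ≤ V := U.basicOpen_le _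
  have h1 : IsUnit (L.α (U.basicOpen (L.α V m)) (L.M.presheaf.map (homOfLE i).op m)) := by
    rw [L.naturality]
    exact hunit
  have h2 := (L.isUnit_of_isUnit_α h1).map (L.M.presheaf.germ _ x hx).hom
  erw [TopCat.Presheaf.germ_res_apply] at h2
  exact h2

/-- The quotient map to the ghost sheaf on stalks. -/
def ghostMk (x : U) : L.M.presheaf.stalk x →* L.ghost.presheaf.stalk x :=
  ((TopCat.Presheaf.stalkFunctor CommMonCat.{u} x).map L.toGhost).hom

theorem ghostMk_germ (x : U) (V : U.Opens) (hx : x ∈ V) (m : L.M.presheaf.obj (op V)) :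
    L.ghostMk x (L.M.presheaf.germ V x hx m) =
      L.ghost.presheaf.germ V x hx (L.toGhost.app (op V) m) :=
  TopCat.Presheaf.stalkFunctor_map_germ_apply V x hx L.toGhost m

theorem quotientEval_ghostMk (x : U) (a : L.M.presheaf.stalk x) :
    quotientEval L.M.presheaf (fun x => unitsCon (L.M.presheaf.stalk x)) x (L.ghostMk x a) =
      (unitsCon _).mk' a := by
  obtain ⟨V, hV, m, rfl⟩ := L.M.presheaf.exists_germ_eq a
  rw [ghostMk_germ]
  exact quotientEval_germ _ _ _ _ _ _

theorem ghostMk_surjective (x : U) : Function.Surjective (L.ghostMk x) := by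
  intro b
  obtain ⟨a, ha⟩ := Con.mk'_surjective
    (quotientEval L.M.presheaf (fun x => unitsCon (L.M.presheaf.stalk x)) x b)
  refine ⟨a, (quotientEval_unitsCon_bijective L.M.presheaf x).1 ?_⟩
  rw [quotientEval_ghostMk, ← ha]

theorem ghostMk_eq_iff (x : U) (a b : L.M.presheaf.stalk x) :
    L.ghostMk x a = L.ghostMk x b ↔ Associated a b := by
  refine ((quotientEval_unitsCon_bijective L.M.presheaf x).1.eq_iff).symm.trans ?_
  rw [quotientEval_ghostMk, quotientEval_ghostMk]
  exact Con.eq _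

theorem ghostMk_specializes {v u : U} (h : v ⤳ u) (a : L.M.presheaf.stalk u) :
    L.ghostMk v (L.M.presheaf.stalkSpecializes h a) =
      L.ghost.presheaf.stalkSpecializes h (L.ghostMk u a) := by
  obtain ⟨V, hV, m, rfl⟩ := L.M.presheaf.exists_germ_eq a
  rw [TopCat.Presheaf.germ_stalkSpecializes_apply, ghostMk_germ, ghostMk_germ,
    TopCat.Presheaf.germ_stalkSpecializes_apply]

end LogStructure

namespace Framing

variable {U X : Scheme.{u}} {g : U ⟶ X} {M : TopCat.Sheaf CommMonCat.{u} X} {L : LogStructure U}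
  (φ : Framing g M L)

theorem stalkMap_germ (u : U) (V : X.Opens) (hu : g u ∈ V) (m : M.presheaf.obj (op V)) :
    φ.stalkMap u (M.presheaf.germ V (g u) hu m) =
      L.ghost.presheaf.germ (g ⁻¹ᵁ V) u hu (φ.hom.app (op V) m) := by
  have h1 := TopCat.Presheaf.stalkFunctor_map_germ_apply V (g u) hu φ.hom m
  have h2 := ConcreteCategory.congr_hom (TopCat.Presheaf.stalkPushforward_germ CommMonCat.{u} g.base
    L.ghost.presheaf V u hu) (φ.hom.app (op V) m)
  exact (congrArg (L.ghost.presheaf.stalkPushforward CommMonCat.{u} g.base u) h1).trans h2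

theorem stalkMap_specializes {v u : U} (h : v ⤳ u) (a : M.presheaf.stalk (g u)) :
    φ.stalkMap v (M.presheaf.stalkSpecializes (h.map g.continuous) a) =
      L.ghost.presheaf.stalkSpecializes h (φ.stalkMap u a) := by
  obtain ⟨V, hV, m, rfl⟩ := M.presheaf.exists_germ_eq a
  rw [TopCat.Presheaf.germ_stalkSpecializes_apply, stalkMap_germ, stalkMap_germ]
  exact (TopCat.Presheaf.germ_stalkSpecializes_apply L.ghost.presheaf (U := g ⁻¹ᵁ V) hV h _).symm

/-- The isomorphism between stalks of `M` and of the ghost sheaf. -/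
def stalkEquiv (u : U) : M.presheaf.stalk (g u) ≃* L.ghost.presheaf.stalk u :=
  MulEquiv.ofBijective (φ.stalkMap u).hom (φ.bijective u)

/-- The quotient map from the log structure to the inverse image of `M` on stalks. -/
def quot (u : U) : L.M.presheaf.stalk u →* M.presheaf.stalk (g u) :=
  (φ.stalkEquiv u).symm.toMonoidHom.comp (L.ghostMk u)

theorem stalkMap_quot (u : U) (a : L.M.presheaf.stalk u) :
    φ.stalkMap u (φ.quot u a) = L.ghostMk u a :=
  (φ.stalkEquiv u).apply_symm_apply _

theorem stalkMap_injective (u : U) : Function.Injective (φ.stalkMap u) := (φ.bijective u).1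

theorem quot_surjective (u : U) : Function.Surjective (φ.quot u) :=
  (φ.stalkEquiv u).symm.surjective.comp (L.ghostMk_surjective u)

theorem quot_eq_iff (u : U) (a b : L.M.presheaf.stalk u) :
    φ.quot u a = φ.quot u b ↔ Associated a b := by
  rw [← L.ghostMk_eq_iff, ← stalkMap_quot, ← stalkMap_quot, (φ.stalkMap_injective u).eq_iff]

theorem quot_specializes {v u : U} (h : v ⤳ u) (a : L.M.presheaf.stalk u) :
    φ.quot v (L.M.presheaf.stalkSpecializes h a) =
      M.presheaf.stalkSpecializes (h.map g.continuous) (φ.quot u a) := by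
  apply φ.stalkMap_injective
  rw [stalkMap_quot, stalkMap_specializes, stalkMap_quot, L.ghostMk_specializes]

/-- Two lifts of a ghost element differ by a unit, so the ideal is generated by the function of a
single lift. -/
theorem ideal_quot (u : U) (a : L.M.presheaf.stalk u) :
    φ.ideal u (φ.quot u a) = Ideal.span {L.stalkα u a} := by
  apply le_antisymm
  · refine Ideal.span_le.2 ?_
    rintro _ ⟨V, hu, m, hm, rfl⟩
    rw [stalkMap_quot, ← L.ghostMk_germ, L.ghostMk_eq_iff] at hm
    rw [← L.stalkα_germ]
    exact Ideal.mem_span_singleton.2 (hm.symm.map (L.stalkα u)).dvd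
  · refine Ideal.span_le.2 ?_
    rintro _ rfl
    obtain ⟨V, hu, m, rfl⟩ := L.M.presheaf.exists_germ_eq a
    exact Ideal.subset_span ⟨V, hu, m, by rw [stalkMap_quot, L.ghostMk_germ],
      L.stalkα_germ u V hu m⟩

end Framing

/-! ### Faces of a chart and their ideals -/

namespace BoundaryChart

variable {k : Type u} [Field k] {U : Scheme.{u}} {s : U ⟶ Spec (CommRingCat.of k)}
  {L : LogStructure U} (c : BoundaryChart s L)

/-- The germ in the log structure of an element of the chart. -/
def germ (u : U) : c.P →* L.M.presheaf.stalk u :=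
  (L.M.presheaf.germ ⊤ u trivial).hom.comp c.θ

/-- The germ of the function defined by an element of the chart. -/
def χ (u : U) : c.P →* U.presheaf.stalk u := (L.stalkα u).comp (c.germ u)

theorem germ_specializes {v u : U} (h : v ⤳ u) (p : c.P) :
    L.M.presheaf.stalkSpecializes h (c.germ u p) = c.germ v p :=
  TopCat.Presheaf.germ_stalkSpecializes_apply L.M.presheaf (U := ⊤) trivial h (c.θ p)

theorem χ_specializes {v u : U} (h : v ⤳ u) (p : c.P) :
    U.presheaf.stalkSpecializes h (c.χ u p) = c.χ v p := by
  change U.presheaf.stalkSpecializes h (L.stalkα u _) = L.stalkα v _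
  rw [← L.stalkα_specializes, germ_specializes]

theorem χ_eq (u : U) (p : c.P) : c.χ u p = U.presheaf.germ ⊤ u trivial
    (c.f.appTop ((Scheme.ΓSpecIso (boundaryRing k c.P c.ρ)).inv (character k c.ρ p))) := by
  rw [← c.compatible]
  exact L.stalkα_germ u ⊤ trivial (c.θ p)

theorem isUnit_χ_iff (u : U) (p : c.P) : IsUnit (c.χ u p) ↔ IsUnit (c.germ u p) :=
  L.isUnit_stalkα_iff u _

theorem χ_ρ (u : U) : c.χ u c.ρ = 0 := by
  have h : character k c.ρ c.ρ = 0 :=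
    Ideal.Quotient.eq_zero_iff_mem.2 (Ideal.mem_span_singleton_self _)
  rw [χ_eq, h, map_zero, map_zero, map_zero]

/-- The face of elements which are invertible at `u`. -/
def face (u : U) : Submonoid c.P := (IsUnit.submonoid (U.presheaf.stalk u)).comap (c.χ u)

theorem mem_face {u : U} {p : c.P} : p ∈ c.face u ↔ IsUnit (c.χ u p) := Iff.rfl

theorem isFace_face (u : U) : IsFace (c.face u) := fun a b h => by
  rw [mem_face, map_mul] at h
  exact isUnit_of_mul_isUnit_left h

theorem ρ_notMem_face (u : U) : c.ρ ∉ c.face u := by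
  rw [mem_face, χ_ρ]
  exact not_isUnit_zero

theorem face_mono {v u : U} (h : v ⤳ u) : c.face u ≤ c.face v := fun p hp => by
  rw [mem_face, ← c.χ_specializes h]
  exact IsUnit.map (U.presheaf.stalkSpecializes h).hom hp

theorem exists_germ_mul (u : U) (m : L.M.presheaf.stalk u) : ∃ p, Associated (c.germ u p) m := by
  obtain ⟨p, w, hw, rfl⟩ := c.chart.generates u m
  exact ⟨p, hw.unit, rfl⟩

/-- The chart relations in ghost form: modulo units, the stalk of the log structure is P localized
at the face of elements invertible at the point. -/
theorem associated_germ_iff (u : U) (p p' : c.P) : Associated (c.germ u p) (c.germ u p') ↔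
    ∃ r ∈ c.face u, ∃ r' ∈ c.face u, p * r = p' * r' := by
  constructor
  · rintro ⟨w, hw⟩
    have hw' : c.germ u p * w = c.germ u p' * 1 := by rw [hw, mul_one]
    obtain ⟨r, r', hr, hr', h, -⟩ := c.chart.relations u p p' w 1 w.isUnit isUnit_one hw'
    refine ⟨r, ?_, r', ?_, h⟩
    · rw [mem_face]
      convert hr using 1
      exact L.stalkα_germ u ⊤ trivial (c.θ r)
    · rw [mem_face]
      convert hr' using 1
      exact L.stalkα_germ u ⊤ trivial (c.θ r')
  · rintro ⟨r, hr, r', hr', h⟩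
    rw [mem_face, isUnit_χ_iff] at hr hr'
    have := congrArg (c.germ u) h
    rw [map_mul, map_mul] at this
    exact ((associated_mul_isUnit_left_iff hr).2 (Associated.refl (c.germ u p))).symm.trans
      (this ▸ (associated_mul_isUnit_left_iff hr').2 (Associated.refl (c.germ u p')))

/-- The ideal of the local ring at `u` generated by the functions outside a face. -/
def faceIdeal (u : U) (F : Submonoid c.P) : Ideal (U.presheaf.stalk u) :=
  Ideal.span {x | ∃ p ∉ F, x = c.χ u p}

/-- On an affine neighbourhood the chart gives an étale algebra over k[P]/(χ^ρ), to which
`isPrime_span_character` applies. The condition `c.face u ≤ F` ensures that the functions outside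
`F` vanish at `u`. -/
theorem isPrime_faceIdeal (u : U) {F : Submonoid c.P} (hF : IsFace F) (hρ : c.ρ ∉ F)
    (hu : c.face u ≤ F) : (c.faceIdeal u F).IsPrime ∧ ∀ p ∈ F, c.χ u p ∉ c.faceIdeal u F := by
  obtain ⟨W, hW, huW, -⟩ := exists_isAffineOpen_mem_and_subset (U := (⊤ : U.Opens)) (x := u) trivial
  let A := boundaryRing k c.P c.ρ
  have e : W ≤ c.f ⁻¹ᵁ ⊤ := le_top
  have het := c.etale
  let φ : A →+* Γ(U, W) := ((Scheme.ΓSpecIso A).inv ≫ c.f.appLE ⊤ W e).hom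
  have hφ : φ.Etale := by
    have := (RingHom.Etale.respectsIso.2) (c.f.appLE ⊤ W e).hom
      (Scheme.ΓSpecIso A).symm.commRingCatIsoToRingEquiv
      (c.f.etale_appLE (isAffineOpen_top _) hW e)
    exact this
  let : Algebra A Γ(U, W) := φ.toAlgebra
  have : Algebra.Etale A Γ(U, W) := hφ
  have hloc := hW.isLocalization_stalk ⟨u, huW⟩
  let : Algebra Γ(U, W) (U.presheaf.stalk u) := U.presheaf.algebra_section_stalk ⟨u, huW⟩
  have hχ : ∀ p, c.χ u p = algebraMap Γ(U, W) (U.presheaf.stalk u)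
      (algebraMap A Γ(U, W) (character k c.ρ p)) := by
    intro p
    rw [χ_eq]
    have h1 : c.f.appLE ⊤ W e = c.f.appTop ≫ U.presheaf.map (homOfLE le_top).op := rfl
    have h2 : algebraMap A Γ(U, W) (character k c.ρ p) = U.presheaf.map (homOfLE le_top).op
      (c.f.appTop ((Scheme.ΓSpecIso A).inv (character k c.ρ p))) := rfl
    rw [h2]
    exact (U.presheaf.germ_res_apply (homOfLE (le_top : W ≤ ⊤)) u huW _).symm
  have key := isPrime_span_character k c.toric hF hρ (hW.primeIdealOf ⟨u, huW⟩).asIdeal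
    (fun p hp => by
      by_contra h
      refine hp (hu ?_)
      rw [mem_face, hχ]
      exact (IsLocalization.AtPrime.isUnit_to_map_iff (U.presheaf.stalk u)
        (hW.primeIdealOf ⟨u, huW⟩).asIdeal _).2 h) (O := U.presheaf.stalk u)
  have hset : c.faceIdeal u F = Ideal.span {x | ∃ p ∉ F, x = algebraMap Γ(U, W) (U.presheaf.stalk u)
      (algebraMap A Γ(U, W) (character k c.ρ p))} := by
    rw [faceIdeal]
    simp only [hχ]
  rw [hset]
  refine ⟨key.1, fun p hp => ?_⟩
  rw [hχ]
  exact key.2 p hp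

end BoundaryChart

/-! ### Generizations and local rings -/

section Scheme

variable {X : Scheme.{u}}

theorem fromSpecStalk_specializes (x : X) (q : PrimeSpectrum (X.presheaf.stalk x)) :
    X.fromSpecStalk x q ⤳ x := by
  have : X.fromSpecStalk x q ∈ Set.range (X.fromSpecStalk x) := ⟨q, rfl⟩
  rwa [Scheme.range_fromSpecStalk] at this

theorem fromSpecStalk_comap_closedPoint {x y : X} (h : y ⤳ x) :
    X.fromSpecStalk x (Spec.map (X.presheaf.stalkSpecializes h)
      (IsLocalRing.closedPoint (X.presheaf.stalk y))) = y := by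
  have h1 := Scheme.fromSpecStalk_closedPoint (x := y)
  rw [← Scheme.SpecMap_stalkSpecializes_fromSpecStalk h] at h1
  exact h1

theorem fromSpecStalk_specializes_of_le (x : X) {q q' : PrimeSpectrum (X.presheaf.stalk x)}
    (h : q.asIdeal ≤ q'.asIdeal) : X.fromSpecStalk x q ⤳ X.fromSpecStalk x q' :=
  Specializes.map ((PrimeSpectrum.le_iff_specializes q q').1 h) (X.fromSpecStalk x).continuous

/-- If `y` is the generization of `x` given by the prime `q`, then `a` is invertible at `y` if and
only if `a ∉ q`. -/
theorem isUnit_stalkSpecializes_iff {x y : X} (q : PrimeSpectrum (X.presheaf.stalk x))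
    (hy : X.fromSpecStalk x q = y) (h : y ⤳ x) (a : X.presheaf.stalk x) :
    IsUnit (X.presheaf.stalkSpecializes h a) ↔ a ∉ q.asIdeal := by
  have hq : q = Spec.map (X.presheaf.stalkSpecializes h)
      (IsLocalRing.closedPoint (X.presheaf.stalk y)) :=
    (X.fromSpecStalk x).isEmbedding.injective
      (hy.trans (fromSpecStalk_comap_closedPoint h).symm)
  have : a ∈ q.asIdeal ↔ X.presheaf.stalkSpecializes h a ∈
      IsLocalRing.maximalIdeal (X.presheaf.stalk y) := by
    rw [hq]
    rfl
  rw [this, IsLocalRing.mem_maximalIdeal, mem_nonunits_iff, not_not]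

/-- The hypothesis says that the prime ideal defining the generization contains the maximal ideal,
so it is the closed point. -/
theorem eq_of_forall_not_isUnit {x y : X} (h : y ⤳ x)
    (H : ∀ a ∈ IsLocalRing.maximalIdeal (X.presheaf.stalk x),
      ¬ IsUnit (X.presheaf.stalkSpecializes h a)) : y = x := by
  rw [← fromSpecStalk_comap_closedPoint h]
  have : Spec.map (X.presheaf.stalkSpecializes h)
      (IsLocalRing.closedPoint (X.presheaf.stalk y)) =
      IsLocalRing.closedPoint (X.presheaf.stalk x) := by
    refine PrimeSpectrum.ext ((IsLocalRing.maximalIdeal.isMaximal _).eq_of_le ?_ ?_).symm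
    · exact (PrimeSpectrum.isPrime _).ne_top
    · exact fun a ha => H a ha
  rw [this, Scheme.fromSpecStalk_closedPoint]

/-- The maximal ideal at a generization is generated by the corresponding prime ideal. -/
theorem map_stalkSpecializes_eq_maximalIdeal {x y : X} (q : PrimeSpectrum (X.presheaf.stalk x))
    (hy : X.fromSpecStalk x q = y) (h : y ⤳ x) :
    q.asIdeal.map (X.presheaf.stalkSpecializes h).hom =
      IsLocalRing.maximalIdeal (X.presheaf.stalk y) := by
  apply le_antisymm
  · rw [Ideal.map_le_iff_le_comap]
    intro a ha
    rw [Ideal.mem_comap, IsLocalRing.mem_maximalIdeal, mem_nonunits_iff]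
    exact fun h' => (isUnit_stalkSpecializes_iff q hy h a).1 h' ha
  · obtain ⟨W, hW, hxW, -⟩ := exists_isAffineOpen_mem_and_subset
      (U := (⊤ : X.Opens)) (x := x) trivial
    have hyW : y ∈ W := h.mem_open W.2 hxW
    have hloc := hW.isLocalization_stalk ⟨y, hyW⟩
    let : Algebra Γ(X, W) (X.presheaf.stalk y) := X.presheaf.algebra_section_stalk ⟨y, hyW⟩
    rw [← IsLocalization.AtPrime.map_eq_maximalIdeal (hW.primeIdealOf ⟨y, hyW⟩).asIdeal
      (X.presheaf.stalk y), Ideal.map_le_iff_le_comap]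
    intro b hb
    have hb' : ¬ IsUnit (X.presheaf.germ W y hyW b) := fun hu =>
      (IsLocalization.AtPrime.isUnit_to_map_iff (X.presheaf.stalk y)
        (hW.primeIdealOf ⟨y, hyW⟩).asIdeal b).1 hu hb
    have hg : X.presheaf.stalkSpecializes h (X.presheaf.germ W x hxW b) =
        X.presheaf.germ W y hyW b := TopCat.Presheaf.germ_stalkSpecializes_apply _ _ _ _
    rw [← hg, isUnit_stalkSpecializes_iff q hy h, not_not] at hb'
    have := Ideal.mem_map_of_mem (X.presheaf.stalkSpecializes h).hom hb'
    rw [Ideal.mem_comap]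
    convert this using 1
    exact hg.symm

variable {U : Scheme.{u}} (g : U ⟶ X)

theorem comap_map_stalkMap [Flat g] (u : U) (I : Ideal (X.presheaf.stalk (g u))) :
    (I.map (g.stalkMap u).hom).comap (g.stalkMap u).hom = I := by
  let := (g.stalkMap u).hom.toAlgebra
  have : Module.Flat (X.presheaf.stalk (g u)) (U.presheaf.stalk u) := Flat.stalkMap g u
  have : IsLocalHom (algebraMap (X.presheaf.stalk (g u)) (U.presheaf.stalk u)) :=
    inferInstanceAs (IsLocalHom (g.stalkMap u).hom)
  have : Module.FaithfullyFlat (X.presheaf.stalk (g u)) (U.presheaf.stalk u) :=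
    Module.FaithfullyFlat.of_flat_of_isLocalHom
  exact Ideal.comap_map_eq_self_of_faithfullyFlat I

/-- Going down: a flat local homomorphism is faithfully flat, so it is surjective on spectra of
local rings. -/
theorem exists_generization [Flat g] (u : U) {y : X} (h : y ⤳ g u) : ∃ v, v ⤳ u ∧ g v = y := by
  let := (g.stalkMap u).hom.toAlgebra
  have : Module.Flat (X.presheaf.stalk (g u)) (U.presheaf.stalk u) := Flat.stalkMap g u
  have : IsLocalHom (algebraMap (X.presheaf.stalk (g u)) (U.presheaf.stalk u)) :=
    inferInstanceAs (IsLocalHom (g.stalkMap u).hom)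
  have : Module.FaithfullyFlat (X.presheaf.stalk (g u)) (U.presheaf.stalk u) :=
    Module.FaithfullyFlat.of_flat_of_isLocalHom
  have hy : y ∈ Set.range (X.fromSpecStalk (g u)) := by
    rw [Scheme.range_fromSpecStalk]
    exact h
  obtain ⟨q, rfl⟩ := hy
  obtain ⟨q', hq'⟩ := PrimeSpectrum.comap_surjective_of_faithfullyFlat
    (B := U.presheaf.stalk u) q
  refine ⟨U.fromSpecStalk u q', fromSpecStalk_specializes u q', ?_⟩
  have := congrArg (fun f => f q') (Scheme.SpecMap_stalkMap_fromSpecStalk g (x := u))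
  rw [← hq']
  exact this.symm

end Scheme

/-! ### Generic points of the strata of a chart -/

namespace BoundaryChart

variable {k : Type u} [Field k] {U : Scheme.{u}} {s : U ⟶ Spec (CommRingCat.of k)}
  {L : LogStructure U} (c : BoundaryChart s L)

theorem faceIdeal_mono (u : U) {F F' : Submonoid c.P} (h : F ≤ F') :
    c.faceIdeal u F' ≤ c.faceIdeal u F := by
  refine Ideal.span_mono ?_
  rintro _ ⟨p, hp, rfl⟩
  exact ⟨p, fun h' => hp (h h'), rfl⟩

theorem map_faceIdeal {v u : U} (h : v ⤳ u) (F : Submonoid c.P) :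
    (c.faceIdeal u F).map (U.presheaf.stalkSpecializes h).hom = c.faceIdeal v F := by
  rw [faceIdeal, faceIdeal, Ideal.map_span]
  congr 1
  ext x
  constructor
  · rintro ⟨_, ⟨p, hp, rfl⟩, rfl⟩
    exact ⟨p, hp, c.χ_specializes h p⟩
  · rintro ⟨p, hp, rfl⟩
    exact ⟨_, ⟨p, hp, rfl⟩, c.χ_specializes h p⟩

/-- The generic point of the stratum of a face near `u`. -/
def facePoint (u : U) {F : Submonoid c.P} (hF : IsFace F) (hρ : c.ρ ∉ F) (hu : c.face u ≤ F) : U :=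
  U.fromSpecStalk u ⟨c.faceIdeal u F, (c.isPrime_faceIdeal u hF hρ hu).1⟩

section

variable (u : U) {F : Submonoid c.P} (hF : IsFace F) (hρ : c.ρ ∉ F) (hu : c.face u ≤ F)

theorem facePoint_specializes : c.facePoint u hF hρ hu ⤳ u := fromSpecStalk_specializes _ _

/-- Both halves of `isPrime_faceIdeal` are used: elements outside `F` lie in the prime ideal, and
those of `F` stay out of it. -/
theorem face_facePoint : c.face (c.facePoint u hF hρ hu) = F := by
  ext p
  rw [mem_face, ← c.χ_specializes (c.facePoint_specializes u hF hρ hu)]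
  refine (isUnit_stalkSpecializes_iff _ rfl _ _).trans
    ⟨fun h => by_contra fun hp => h (Ideal.subset_span ⟨p, hp, rfl⟩),
    (c.isPrime_faceIdeal u hF hρ hu).2 p⟩

theorem faceIdeal_facePoint : c.faceIdeal (c.facePoint u hF hρ hu) F =
    IsLocalRing.maximalIdeal (U.presheaf.stalk (c.facePoint u hF hρ hu)) := by
  rw [← c.map_faceIdeal (c.facePoint_specializes u hF hρ hu)]
  exact map_stalkSpecializes_eq_maximalIdeal _ rfl _

theorem facePoint_specializes_facePoint {F' : Submonoid c.P} (hF' : IsFace F') (hρ' : c.ρ ∉ F')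
    (hu' : c.face u ≤ F') (h : F ≤ F') : c.facePoint u hF' hρ' hu' ⤳ c.facePoint u hF hρ hu :=
  fromSpecStalk_specializes_of_le u (c.faceIdeal_mono u h)

/-- Functions that are not invertible at `v` lie in the prime ideal of `v`, so the generic point of
the stratum of `v` generizes `v` and not merely `u`. -/
theorem facePoint_face_specializes {v : U} (h : v ⤳ u) :
    c.facePoint u (c.isFace_face v) (c.ρ_notMem_face v) (c.face_mono h) ⤳ v := by
  have hv := fromSpecStalk_comap_closedPoint h
  conv_rhs => rw [← hv]
  refine fromSpecStalk_specializes_of_le u ?_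
  change c.faceIdeal u (c.face v) ≤ _
  refine Ideal.span_le.2 ?_
  rintro _ ⟨p, hp, rfl⟩
  change U.presheaf.stalkSpecializes h (c.χ u p) ∈ IsLocalRing.maximalIdeal _
  rw [c.χ_specializes h]
  exact hp

end

theorem isOpen_setOf_mem_face (p : c.P) : IsOpen {u : U | p ∈ c.face u} := by
  convert (U.basicOpen (L.α ⊤ (c.θ p))).2 using 1
  ext u
  change IsUnit (c.χ u p) ↔ u ∈ U.basicOpen (L.α ⊤ (c.θ p))
  rw [Scheme.mem_basicOpen (U := ⊤) U (L.α ⊤ (c.θ p)) u trivial]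
  exact iff_of_eq (congrArg IsUnit (L.stalkα_germ u ⊤ trivial (c.θ p)))

theorem isClosed_setOf_face_le (F : Submonoid c.P) : IsClosed {u : U | c.face u ≤ F} := by
  have : {u : U | c.face u ≤ F} = ⋂ p ∈ {p : c.P | p ∉ F}, {u : U | p ∈ c.face u}ᶜ := by
    ext u
    simp only [Set.mem_ofPred_eq, Set.mem_iInter, Set.mem_compl_iff]
    exact ⟨fun h p hp hp' => hp (h hp'), fun h p hp => by_contra fun hp' => h p hp' hp⟩
  rw [this]
  exact isClosed_biInter fun p _ => (c.isOpen_setOf_mem_face p).isClosed_compl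

end BoundaryChart

/-! ### Gorenstein elements -/

theorem IsInterior.of_dvd {P : Type*} [CommMonoid P] {a b : P} (ha : IsInterior a) (h : a ∣ b) :
    IsInterior b := fun q => by
  obtain ⟨n, hn⟩ := ha q
  exact ⟨n, hn.trans (pow_dvd_pow_of_dvd h n)⟩

theorem IsGorensteinElement.isInterior {P : Type*} [CommMonoid P] {ρ : P}
    (h : IsGorensteinElement ρ) : IsInterior ρ := (h ρ).1 dvd_rfl

/-- The map behaves like localization at a face modulo units. An interior image `f p` can be
corrected by an element `r` of that face so that `p * r` is interior in P, hence divisible by ρ;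
applying `f` removes `r`. -/
theorem IsGorensteinElement.map {P N : Type*} [CommMonoid P] [CommMonoid N] {ρ : P}
    (hρ : IsGorensteinElement ρ) (f : P →* N) (hf : Function.Surjective f)
    (hker : ∀ p p', f p = f p' → ∃ r r', f r = 1 ∧ f r' = 1 ∧ p * r = p' * r') :
    IsGorensteinElement (f ρ) := by
  intro n
  have hint : IsInterior (f ρ) := fun q => by
    obtain ⟨q, rfl⟩ := hf q
    obtain ⟨n, hn⟩ := hρ.isInterior q
    exact ⟨n, map_pow f ρ n ▸ map_dvd f hn⟩
  refine ⟨fun h => hint.of_dvd h, fun h => ?_⟩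
  obtain ⟨p, rfl⟩ := hf n
  obtain ⟨m, ⟨a, ha⟩⟩ := h (f ρ)
  obtain ⟨a, rfl⟩ := hf a
  rw [← map_pow, ← map_mul] at ha
  obtain ⟨r, r', hr, hr', h⟩ := hker _ _ ha
  have h1 : IsInterior (p ^ m * r) := hρ.isInterior.of_dvd ⟨a * r', by rw [h, mul_assoc]⟩
  have h2 : IsInterior (p * r) := fun q => by
    obtain ⟨l, hl⟩ := h1 q
    -- The exponent m + 1, instead of m, guarantees that `r` divides its own power even when m = 0.
    refine ⟨(m + 1) * l, hl.trans ?_⟩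
    rw [pow_mul]
    refine pow_dvd_pow_of_dvd ?_ l
    rw [mul_pow]
    exact mul_dvd_mul (pow_dvd_pow p (Nat.le_succ m)) (dvd_pow_self r (Nat.succ_ne_zero m))
  have h3 := map_dvd f ((hρ _).2 h2)
  rwa [map_mul, hr, mul_one] at h3

/-- Two such elements divide one another; by cancellation the factors are units, and sharpness makes
them trivial. -/
theorem IsGorensteinElement.unique {N : Type*} [CommMonoid N] (hN : IsFineSharp N) {ρ ρ' : N}
    (h : IsGorensteinElement ρ) (h' : IsGorensteinElement ρ') : ρ = ρ' := by
  have := hN.cancel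
  obtain ⟨a, ha⟩ := (h ρ').2 h'.isInterior
  obtain ⟨b, hb⟩ := (h' ρ).2 h.isInterior
  have hab : a * b = 1 := by
    have : ρ * (a * b) = ρ * 1 := by rw [← mul_assoc, ← ha, ← hb, mul_one]
    exact mul_left_cancel this
  rw [ha, hN.sharp a (IsUnit.of_mul_eq_one b hab), mul_one]

/-! ### Gluing of sections from germs -/

section Gluing

variable {T : TopCat.{u}} (M : TopCat.Sheaf CommMonCat.{u} T)

theorem exists_section_of_germs (a : ∀ x : T, M.presheaf.stalk x)
    (H : ∀ x : T, ∃ (V : Opens T) (_ : x ∈ V) (m : M.presheaf.obj (op V)), ∀ (y : T) (hy : y ∈ V),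
      M.presheaf.germ V y hy m = a y) :
    ∃ m : M.presheaf.obj (op ⊤), ∀ x, M.presheaf.germ ⊤ x trivial m = a x := by
  choose V hV m hm using H
  obtain ⟨s, hs, -⟩ := M.existsUnique_gluing' V ⊤ (fun x => homOfLE le_top)
    (fun x _ => Opens.mem_iSup.2 ⟨x, hV x⟩) m (fun x y => by
      apply TopCat.Presheaf.section_ext M
      intro z hz
      erw [TopCat.Presheaf.germ_res_apply, TopCat.Presheaf.germ_res_apply]
      exact (hm x z hz.1).trans (hm y z hz.2).symm)
  refine ⟨s, fun x => ?_⟩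
  rw [← hm x x (hV x), ← hs x]
  exact (M.presheaf.germ_res_apply _ _ _ _).symm

end Gluing

namespace PreGTCAtlas

variable {k : Type u} [Field k] {X : Scheme.{u}} {s : X ⟶ Spec (CommRingCat.of k)}
  {M : TopCat.Sheaf CommMonCat.{u} X} (G : PreGTCAtlas.{u, v} s M)

/-! ### The charts of an atlas on stalks -/

instance (i : G.ι) : Etale (G.g i) := G.etale i

/-- The map from a chart to the stalks of `M`. -/
def κ (i : G.ι) (u : G.U i) : (G.chart i).P →* M.presheaf.stalk (G.g i u) :=
  ((G.framing i).quot u).comp ((G.chart i).germ u)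

section

variable {i : G.ι} (u : G.U i)

theorem κ_surjective : Function.Surjective (G.κ i u) := by
  intro m
  obtain ⟨a, rfl⟩ := (G.framing i).quot_surjective u m
  obtain ⟨p, hp⟩ := (G.chart i).exists_germ_mul u a
  exact ⟨p, ((G.framing i).quot_eq_iff u _ _).2 hp⟩

/-- Together with `κ_surjective` this presents M_x as a localization of P modulo units, which turns
questions about M into questions about faces of P. -/
theorem κ_eq_iff (p p' : (G.chart i).P) : G.κ i u p = G.κ i u p' ↔
    ∃ r ∈ (G.chart i).face u, ∃ r' ∈ (G.chart i).face u, p * r = p' * r' :=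
  ((G.framing i).quot_eq_iff u _ _).trans ((G.chart i).associated_germ_iff u p p')

theorem κ_eq_one_iff (p : (G.chart i).P) : G.κ i u p = 1 ↔ p ∈ (G.chart i).face u := by
  rw [BoundaryChart.mem_face, BoundaryChart.isUnit_χ_iff, ← associated_one_iff_isUnit,
    ← (G.framing i).quot_eq_iff, map_one]
  rfl

theorem κ_specializes {u v : G.U i} (h : v ⤳ u) (p : (G.chart i).P) :
    M.presheaf.stalkSpecializes (h.map (G.g i).continuous) (G.κ i u p) = G.κ i v p := by
  refine ((G.framing i).quot_specializes h _).symm.trans ?_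
  rw [(G.chart i).germ_specializes h]
  rfl

theorem sectionIdeal_κ (p : (G.chart i).P) :
    (G.sectionIdeal (G.g i u) (G.κ i u p)).map ((G.g i).stalkMap u).hom =
      Ideal.span {(G.chart i).χ u p} :=
  (G.independent.choose_spec i u _).trans ((G.framing i).ideal_quot u _)

/-- The nontrivial elements of M_x are the images of the chart elements outside the face, and each
contributes a principal ideal upstairs. -/
theorem map_ideal : (G.ideal (G.g i u)).map ((G.g i).stalkMap u).hom =
    (G.chart i).faceIdeal u ((G.chart i).face u) := by
  rw [ideal, Ideal.map_iSup]
  simp only [Ideal.map_iSup]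
  apply le_antisymm
  · refine iSup₂_le fun m hm => ?_
    obtain ⟨p, rfl⟩ := G.κ_surjective u m
    rw [sectionIdeal_κ, Ideal.span_le, Set.singleton_subset_iff]
    exact Ideal.subset_span ⟨p, fun h => hm ((G.κ_eq_one_iff u p).2 h), rfl⟩
  · refine Ideal.span_le.2 ?_
    rintro _ ⟨p, hp, rfl⟩
    refine Ideal.mem_iSup_of_mem (G.κ i u p) (Ideal.mem_iSup_of_mem
      (fun h => hp ((G.κ_eq_one_iff u p).1 h)) ?_)
    rw [sectionIdeal_κ]
    exact Ideal.mem_span_singleton_self _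

theorem ideal_eq_comap : G.ideal (G.g i u) =
    ((G.chart i).faceIdeal u ((G.chart i).face u)).comap ((G.g i).stalkMap u).hom := by
  rw [← map_ideal, comap_map_stalkMap]

theorem isPrime_faceIdeal_face :
    ((G.chart i).faceIdeal u ((G.chart i).face u)).IsPrime :=
  ((G.chart i).isPrime_faceIdeal u ((G.chart i).isFace_face u)
    ((G.chart i).ρ_notMem_face u) le_rfl).1

theorem mem_fanSet_of_faceIdeal_eq (h : (G.chart i).faceIdeal u ((G.chart i).face u) =
    IsLocalRing.maximalIdeal _) : G.g i u ∈ G.fanSet := by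
  change G.ideal (G.g i u) = _
  rw [ideal_eq_comap, h]
  exact IsLocalRing.maximalIdeal_comap _

end

theorem isPrime_ideal (x : X) : (G.ideal x).IsPrime := by
  obtain ⟨i, u, rfl⟩ := G.covers x
  rw [ideal_eq_comap]
  have := G.isPrime_faceIdeal_face u
  exact Ideal.IsPrime.comap _

/-! ### The retraction to the fan on points -/

/-- The point of `X` given by the prime ideal `I(G, x)`. -/
def proj (x : X) : X := X.fromSpecStalk x ⟨G.ideal x, G.isPrime_ideal x⟩

theorem proj_specializes (x : X) : G.proj x ⤳ x := fromSpecStalk_specializes _ _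

section

variable {i : G.ι} (u : G.U i)

/-- I(G, x) is the contraction of a face ideal, so the point it defines is the image of the generic
point of the stratum through `u`. -/
theorem proj_g : G.proj (G.g i u) = G.g i ((G.chart i).facePoint u ((G.chart i).isFace_face u)
    ((G.chart i).ρ_notMem_face u) le_rfl) := by
  have h := congrArg (fun f => f ⟨_, G.isPrime_faceIdeal_face u⟩)
    (Scheme.SpecMap_stalkMap_fromSpecStalk (G.g i) (x := u))
  refine Eq.trans ?_ h
  exact congrArg (X.fromSpecStalk (G.g i u)) (PrimeSpectrum.ext (G.ideal_eq_comap u))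

theorem g_facePoint_mem_fanSet {F : Submonoid (G.chart i).P} (hF : IsFace F)
    (hρ : (G.chart i).ρ ∉ F) (hu : (G.chart i).face u ≤ F) :
    G.g i ((G.chart i).facePoint u hF hρ hu) ∈ G.fanSet := by
  apply mem_fanSet_of_faceIdeal_eq
  rw [(G.chart i).face_facePoint u hF hρ hu]
  exact (G.chart i).faceIdeal_facePoint u hF hρ hu

/-- Over a fan point the maximal ideal downstairs is I(G, x), which lands in the face ideal
upstairs. With an unchanged face this ideal stays proper at `v'`, so nothing in the maximal ideal
becomes invertible and the image point cannot move. -/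
theorem g_eq_of_face_eq {v v' : G.U i} (hv : G.g i v ∈ G.fanSet) (h : v' ⤳ v)
    (hf : (G.chart i).face v' = (G.chart i).face v) : G.g i v' = G.g i v := by
  refine eq_of_forall_not_isUnit (h.map (G.g i).continuous) fun a ha hu => ?_
  rw [← show G.ideal _ = _ from hv] at ha
  have h1 := Ideal.mem_map_of_mem ((G.g i).stalkMap v).hom ha
  rw [map_ideal] at h1
  have h2 := Ideal.mem_map_of_mem ((G.U i).presheaf.stalkSpecializes h).hom h1
  rw [(G.chart i).map_faceIdeal h, ← hf] at h2
  have h3 := Scheme.Hom.stalkSpecializes_stalkMap_apply (G.g i) v' v h a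
  have h4 := (G.isPrime_faceIdeal_face v').ne_top
  refine h4 (Ideal.eq_top_of_isUnit_mem _ h2 ?_)
  erw [← h3]
  exact hu.map ((G.g i).stalkMap v').hom

/-- A fan point generizing the image of `u` is determined by its face in the chart. -/
theorem g_eq_facePoint {v : G.U i} (hv : G.g i v ∈ G.fanSet) (h : v ⤳ u) :
    G.g i v = G.g i ((G.chart i).facePoint u ((G.chart i).isFace_face v)
      ((G.chart i).ρ_notMem_face v) ((G.chart i).face_mono h)) :=
  (G.g_eq_of_face_eq hv ((G.chart i).facePoint_face_specializes u h)
    ((G.chart i).face_facePoint _ _ _ _)).symm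

end

theorem proj_mem_fanSet (x : X) : G.proj x ∈ G.fanSet := by
  obtain ⟨i, u, rfl⟩ := G.covers x
  rw [proj_g]
  exact G.g_facePoint_mem_fanSet _ _ _ _

theorem proj_eq_self {x : X} (hx : x ∈ G.fanSet) : G.proj x = x := by
  have : (⟨G.ideal x, G.isPrime_ideal x⟩ : PrimeSpectrum _) =
      IsLocalRing.closedPoint (X.presheaf.stalk x) := PrimeSpectrum.ext hx
  rw [proj, this, Scheme.fromSpecStalk_closedPoint]

/-! ### Specialization maps of `M` -/

/-- Generizations lift to the étale chart, where both stalks are quotients of the same monoid P. -/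
theorem stalkSpecializes_surjective (G : PreGTCAtlas.{u, v} s M) {x y : X} (h : y ⤳ x) :
    Function.Surjective (M.presheaf.stalkSpecializes h) := by
  obtain ⟨i, u, rfl⟩ := G.covers x
  obtain ⟨v, hv, rfl⟩ := exists_generization (G.g i) u h
  intro m
  obtain ⟨p, rfl⟩ := G.κ_surjective v m
  exact ⟨_, G.κ_specializes hv p⟩

/-- On the chart this is `κ_eq_iff` at the generization: the map inverts the elements of a larger
face and then kills the units. -/
theorem exists_of_stalkSpecializes_eq (G : PreGTCAtlas.{u, v} s M) {x y : X} (h : y ⤳ x)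
    {a b : M.presheaf.stalk x}
    (hab : M.presheaf.stalkSpecializes h a = M.presheaf.stalkSpecializes h b) :
    ∃ r r', M.presheaf.stalkSpecializes h r = 1 ∧ M.presheaf.stalkSpecializes h r' = 1 ∧
      a * r = b * r' := by
  obtain ⟨i, u, rfl⟩ := G.covers x
  obtain ⟨v, hv, rfl⟩ := exists_generization (G.g i) u h
  obtain ⟨p, rfl⟩ := G.κ_surjective u a
  obtain ⟨p', rfl⟩ := G.κ_surjective u b
  erw [G.κ_specializes hv, G.κ_specializes hv, κ_eq_iff] at hab
  obtain ⟨r, hr, r', hr', h'⟩ := hab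
  refine ⟨G.κ i u r, G.κ i u r', ?_, ?_, ?_⟩
  · erw [G.κ_specializes hv, κ_eq_one_iff]; exact hr
  · erw [G.κ_specializes hv, κ_eq_one_iff]; exact hr'
  · rw [← map_mul, h', map_mul]

/-- The point given by I(G, x) has the same chart face as x, so no further element is inverted. -/
theorem bijective_stalkSpecializes_proj (x : X) :
    Function.Bijective (M.presheaf.stalkSpecializes (G.proj_specializes x)) := by
  refine ⟨fun a b hab => ?_, G.stalkSpecializes_surjective _⟩
  have key : ∀ r, M.presheaf.stalkSpecializes (G.proj_specializes x) r = 1 → r = 1 := by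
    obtain ⟨i, u, rfl⟩ := G.covers x
    intro r hr
    obtain ⟨p, rfl⟩ := G.κ_surjective u r
    have hw := (G.chart i).facePoint_specializes u ((G.chart i).isFace_face u)
      ((G.chart i).ρ_notMem_face u) le_rfl
    -- Stated for a variable `y`, since the projection equals the image of the face point only
    -- propositionally and the specialization map depends on it.
    have h2 : ∀ {y : X} (hy : y ⤳ G.g i u) (_ : y = G.g i ((G.chart i).facePoint u
        ((G.chart i).isFace_face u) ((G.chart i).ρ_notMem_face u) le_rfl)),
        M.presheaf.stalkSpecializes hy (G.κ i u p) = 1 → G.κ i u p = 1 := by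
      rintro y hy rfl h
      erw [G.κ_specializes hw, κ_eq_one_iff, (G.chart i).face_facePoint] at h
      rwa [κ_eq_one_iff]
    exact h2 _ (G.proj_g u) hr
  obtain ⟨r, r', hr, hr', h⟩ := G.exists_of_stalkSpecializes_eq _ hab
  rwa [key r hr, key r' hr', mul_one, mul_one] at h

/-- The hypothesis compares the faces of the two points in a common chart, and both points are
images of face points, for which inclusion of faces gives specialization. -/
theorem specializes_of_mem_fanSet {x y y' : X} (hy : y ∈ G.fanSet) (hy' : y' ∈ G.fanSet)
    (h : y ⤳ x) (h' : y' ⤳ x) (H : ∀ m, M.presheaf.stalkSpecializes h m = 1 →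
      M.presheaf.stalkSpecializes h' m = 1) : y' ⤳ y := by
  obtain ⟨i, u, rfl⟩ := G.covers x
  obtain ⟨v, hv, rfl⟩ := exists_generization (G.g i) u h
  obtain ⟨v', hv', rfl⟩ := exists_generization (G.g i) u h'
  rw [G.g_eq_facePoint u hy hv, G.g_eq_facePoint u hy' hv']
  refine Specializes.map ((G.chart i).facePoint_specializes_facePoint u _ _ _ _ _ _
    fun p hp => ?_) (G.g i).continuous
  rw [← κ_eq_one_iff, ← G.κ_specializes hv'] 
  apply H
  erw [G.κ_specializes hv, κ_eq_one_iff]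
  exact hp

/-! ### The distinguished section -/

theorem isDistinguished_iff (ρ : M.presheaf.obj (op ⊤)) : G.IsDistinguished ρ ↔
    ∀ (i : G.ι) (u : G.U i), M.presheaf.germ ⊤ (G.g i u) trivial ρ = G.κ i u (G.chart i).ρ := by
  refine forall_congr' fun i => forall_congr' fun u => ?_
  rw [← ((G.framing i).stalkMap_injective u).eq_iff]
  have h1 : (G.framing i).stalkMap u (G.κ i u (G.chart i).ρ) =
      (G.log i).ghost.presheaf.germ ⊤ u trivial
        ((G.log i).toGhost.app (op ⊤) ((G.chart i).θ (G.chart i).ρ)) :=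
    ((G.framing i).stalkMap_quot u _).trans ((G.log i).ghostMk_germ u ⊤ trivial _)
  rw [h1]

theorem isGorensteinElement_κ {i : G.ι} (u : G.U i) :
    IsGorensteinElement (G.κ i u (G.chart i).ρ) := by
  refine (G.chart i).gorenstein.map _ (G.κ_surjective u) fun p p' h => ?_
  obtain ⟨r, hr, r', hr', h⟩ := (G.κ_eq_iff u p p').1 h
  exact ⟨r, r', (G.κ_eq_one_iff u r).2 hr, (G.κ_eq_one_iff u r').2 hr', h⟩

/-- The Gorenstein germ at each point is unique, so it is the same from every chart. An equality of
ghost germs upstairs holds on an open W and descends to its image, which is open because étale maps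
are open. -/
theorem exists_isDistinguished (hM : ∀ x : X, IsFineSharp (M.presheaf.stalk x)) :
    ∃ ρ, G.IsDistinguished ρ := by
  have hex : ∀ x : X, ∃ a : M.presheaf.stalk x, IsGorensteinElement a := fun x => by
    obtain ⟨i, u, rfl⟩ := G.covers x
    exact ⟨_, G.isGorensteinElement_κ u⟩
  choose a ha using hex
  have hκ : ∀ (i) (u : G.U i), a (G.g i u) = G.κ i u (G.chart i).ρ := fun i u =>
    (ha _).unique (hM _) (G.isGorensteinElement_κ u)
  have hloc : ∀ x : X, ∃ (V : X.Opens) (_ : x ∈ V) (m : M.presheaf.obj (op V)),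
      ∀ (y : X) (hy : y ∈ V), M.presheaf.germ V y hy m = a y := by
    intro x
    obtain ⟨i, u, rfl⟩ := G.covers x
    obtain ⟨V, hV, m, hm⟩ := M.presheaf.exists_germ_eq (a (G.g i u))
    have h1 : (G.log i).ghost.presheaf.germ (G.g i ⁻¹ᵁ V) u hV ((G.framing i).hom.app (op V) m) =
        (G.log i).ghost.presheaf.germ ⊤ u trivial
        ((G.log i).toGhost.app (op ⊤) ((G.chart i).θ (G.chart i).ρ)) := by
      rw [← Framing.stalkMap_germ, hm, hκ]
      exact ((G.framing i).stalkMap_quot u _).trans ((G.log i).ghostMk_germ u ⊤ trivial _)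
    obtain ⟨W, hW, j, j', h2⟩ := TopCat.Presheaf.germ_eq _ _ _ _ _ _ h1
    let W' : X.Opens := ⟨G.g i '' W, (G.g i).isOpenMap _ W.2⟩
    have hW' : W' ≤ V := by
      rintro _ ⟨w, hw, rfl⟩
      exact j.le hw
    refine ⟨W', ⟨u, hW, rfl⟩, M.presheaf.map (homOfLE hW').op m, ?_⟩
    rintro _ ⟨w, hw, rfl⟩
    erw [TopCat.Presheaf.germ_res_apply]
    apply (G.framing i).stalkMap_injective w
    rw [Framing.stalkMap_germ, hκ]
    refine Eq.trans ?_ ((G.framing i).stalkMap_quot w _).symm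
    refine Eq.trans ?_ ((G.log i).ghostMk_germ w ⊤ trivial _).symm
    rw [← TopCat.Presheaf.germ_res_apply _ j w hw]
    erw [h2]
    exact TopCat.Presheaf.germ_res_apply _ j' w hw _
  obtain ⟨ρ, hρ⟩ := exists_section_of_germs M a hloc
  exact ⟨ρ, (G.isDistinguished_iff ρ).2 fun i u => (hρ _).trans (hκ i u)⟩

variable {ρ : M.presheaf.obj (op ⊤)}

theorem IsDistinguished.unique {ρ ρ' : M.presheaf.obj (op ⊤)} (h : G.IsDistinguished ρ)
    (h' : G.IsDistinguished ρ') : ρ = ρ' := by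
  rw [isDistinguished_iff] at h h'
  apply TopCat.Presheaf.section_ext M
  intro x hx
  obtain ⟨i, u, rfl⟩ := G.covers x
  exact (h i u).trans (h' i u).symm

theorem IsDistinguished.germ_ne_one (h : G.IsDistinguished ρ) (x : X) :
    M.presheaf.germ ⊤ x trivial ρ ≠ 1 := by
  obtain ⟨i, u, rfl⟩ := G.covers x
  rw [(G.isDistinguished_iff ρ).1 h, Ne, κ_eq_one_iff]
  exact (G.chart i).ρ_notMem_face u

/-- Every face of a stalk of `M` not containing `ρ` comes from a generization in the fan. -/
theorem IsDistinguished.exists_mem_fanSet (h : G.IsDistinguished ρ) (x : X)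
    {N : Submonoid (M.presheaf.stalk x)} (hN : IsFace N)
    (hρ : M.presheaf.germ ⊤ x trivial ρ ∉ N) : ∃ y ∈ G.fanSet, ∃ hy : y ⤳ x,
      ∀ m, M.presheaf.stalkSpecializes hy m = 1 ↔ m ∈ N := by
  obtain ⟨i, u, rfl⟩ := G.covers x
  rw [(G.isDistinguished_iff ρ).1 h] at hρ
  let F := N.comap (G.κ i u)
  have hF : IsFace F := fun a b hab => by
    rw [Submonoid.mem_comap, map_mul] at hab
    exact hN _ _ hab
  have hu : (G.chart i).face u ≤ F := fun p hp => by
    rw [← κ_eq_one_iff] at hp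
    exact (Submonoid.mem_comap).2 (hp ▸ N.one_mem)
  have hw := (G.chart i).facePoint_specializes u hF hρ hu
  refine ⟨_, G.g_facePoint_mem_fanSet u hF hρ hu, hw.map (G.g i).continuous, fun m => ?_⟩
  obtain ⟨p, rfl⟩ := G.κ_surjective u m
  erw [G.κ_specializes hw, κ_eq_one_iff, (G.chart i).face_facePoint]
  rfl

end PreGTCAtlas

/-! ### Minimal neighbourhoods in the fan -/

theorem exists_finite_generic_points {α : Type*} [TopologicalSpace α] [NoetherianSpace α]
    [QuasiSober α] {Z : Set α} (hZ : IsClosed Z) :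
    ∃ S : Set α, S.Finite ∧ S ⊆ Z ∧ ∀ z ∈ Z, ∃ w ∈ S, w ⤳ z := by
  obtain ⟨S, hS, hcl, hirr, h⟩ := NoetherianSpace.exists_finite_set_isClosed_irreducible hZ
  have hgen : ∀ t : S, ∃ w : α, IsGenericPoint w t.1 := fun t =>
    QuasiSober.sober (hirr t.1 t.2) (hcl t.1 t.2)
  choose w hw using hgen
  have : Finite S := hS
  refine ⟨Set.range w, Set.finite_range w, ?_, fun z hz => ?_⟩
  · rintro _ ⟨t, rfl⟩
    rw [h]
    exact ⟨t.1, t.2, (hw t).mem⟩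
  · rw [h] at hz
    obtain ⟨t, ht, hzt⟩ := hz
    exact ⟨_, ⟨⟨t, ht⟩, rfl⟩, (hw ⟨t, ht⟩).specializes hzt⟩

namespace PreGTCAtlas

variable {k : Type u} [Field k] {X : Scheme.{u}} {s : X ⟶ Spec (CommRingCat.of k)}
  {M : TopCat.Sheaf CommMonCat.{u} X} (G : PreGTCAtlas.{u, v} s M)

/-- For each of the finitely many faces F, the closed locus in W where the face is contained in F
has finitely many generic points. A fan point with face F is the image of one of them. -/
theorem finite_fanSet_inter [LocallyOfFiniteType s] {i : G.ι} {W : (G.U i).Opens}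
    (hW : IsAffineOpen W) : (G.fanSet ∩ G.g i '' W).Finite := by
  have hN : IsLocallyNoetherian (G.U i) :=
    LocallyOfFiniteType.isLocallyNoetherian (G.g i ≫ s)
  have : IsNoetherianRing Γ(G.U i, W) := IsLocallyNoetherian.component_noetherian ⟨W, hW⟩
  have : NoetherianSpace {x // x ∈ W} := noetherianSpace_of_isAffineOpen W hW
  have : QuasiSober {x // x ∈ W} := W.isOpenEmbedding.quasiSober
  have h : ∀ F : Submonoid (G.chart i).P, ∃ S : Set (G.U i), S.Finite ∧
      (∀ w ∈ S, (G.chart i).face w ≤ F) ∧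
      ∀ z ∈ W, (G.chart i).face z ≤ F → ∃ w ∈ S, w ⤳ z := by
    intro F
    obtain ⟨S, hS, hS1, hS2⟩ := exists_finite_generic_points (α := {x // x ∈ W})
      (((G.chart i).isClosed_setOf_face_le F).preimage continuous_subtype_val)
    refine ⟨Subtype.val '' S, hS.image _, ?_, fun z hz hF => ?_⟩
    · rintro _ ⟨w, hw, rfl⟩
      exact hS1 hw
    · obtain ⟨w, hw, h⟩ := hS2 ⟨z, hz⟩ hF
      exact ⟨w, ⟨w, hw, rfl⟩, h.map continuous_subtype_val⟩
  choose S hS hS1 hS2 using h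
  refine Set.Finite.subset ((finite_setOf_isFace (G.chart i).toric.fg).biUnion
    fun F _ => (hS F).image (G.g i)) ?_
  rintro _ ⟨hy, v, hv, rfl⟩
  obtain ⟨w, hw, h⟩ := hS2 ((G.chart i).face v) v hv le_rfl
  refine Set.mem_biUnion ((G.chart i).isFace_face v) ⟨w, hw, ?_⟩
  -- The generic point `w` was chosen with face at most that of `v`, and generizing only enlarges
  -- the face; so the faces coincide.
  exact G.g_eq_of_face_eq hy h (le_antisymm (hS1 _ w hw) ((G.chart i).face_mono h))

/-- By local finiteness one can remove the closures of the fan points that do not generize x. The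
remaining ones generize π(x), because any element trivial at π(x) is already trivial at x. -/
theorem exists_nhds_specializes_proj [LocallyOfFiniteType s] (x : X) :
    ∃ V : X.Opens, x ∈ V ∧ ∀ y ∈ G.fanSet, y ∈ V → y ⤳ G.proj x := by
  obtain ⟨i, u, rfl⟩ := G.covers x
  obtain ⟨W, hW, huW, -⟩ := exists_isAffineOpen_mem_and_subset (U := (⊤ : (G.U i).Opens)) (x := u)
    trivial
  let S := {y | y ∈ G.fanSet ∩ G.g i '' W ∧ ¬ y ⤳ G.g i u}
  have hS : S.Finite := (G.finite_fanSet_inter hW).subset fun y hy => hy.1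
  refine ⟨⟨G.g i '' W ∩ ⋂ y ∈ S, (closure {y})ᶜ, ((G.g i).isOpenMap _ W.2).inter
    (hS.isOpen_biInter fun y _ => isClosed_closure.isOpen_compl)⟩, ⟨⟨u, huW, rfl⟩, ?_⟩, ?_⟩
  · refine Set.mem_iInter₂.2 fun y hy h => hy.2 ?_
    exact specializes_iff_mem_closure.2 h
  · rintro y hy ⟨hyW, hyS⟩
    have h : y ⤳ G.g i u := by
      by_contra h
      exact Set.mem_iInter₂.1 hyS y ⟨⟨hy, hyW⟩, h⟩ (subset_closure rfl)
    refine G.specializes_of_mem_fanSet (G.proj_mem_fanSet _) hy (G.proj_specializes _) h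
      fun m hm => ?_
    rw [(G.bijective_stalkSpecializes_proj _).1 (hm.trans (map_one _).symm), map_one]

end PreGTCAtlas

/-! ### The stalks of `M // (ρ)` -/

section Collapse

variable {X : Scheme.{u}} (M : TopCat.Sheaf CommMonCat.{u} X) (ρ : M.presheaf.obj (op ⊤))

/-- The quotient of the stalk of `M` at `x` by the ideal generated by `ρ`. -/
abbrev CollapsedStalk (x : X) : Type u := (idealCon (M.presheaf.germ ⊤ x trivial ρ)).Quotient

/-- The quotient map from the stalk of `M`. -/
def collapse (x : X) : M.presheaf.stalk x →* CollapsedStalk M ρ x := Con.mk' _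

theorem collapse_surjective (x : X) : Function.Surjective (collapse M ρ x) := Con.mk'_surjective

variable {M}

theorem collapse_eq_iff {x : X} (a b : M.presheaf.stalk x) : collapse M ρ x a = collapse M ρ x b ↔
    a = b ∨ (M.presheaf.germ ⊤ x trivial ρ ∣ a ∧ M.presheaf.germ ⊤ x trivial ρ ∣ b) :=
  Con.eq _

theorem collapse_mul_ρ {x : X} (a : M.presheaf.stalk x) :
    collapse M ρ x (a * M.presheaf.germ ⊤ x trivial ρ) =
      collapse M ρ x (M.presheaf.germ ⊤ x trivial ρ) :=
  (collapse_eq_iff ρ _ _).2 (Or.inr ⟨Dvd.intro_left _ rfl, dvd_rfl⟩)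

theorem stalkSpecializes_ρ {x y : X} (h : y ⤳ x) : M.presheaf.stalkSpecializes h
    (M.presheaf.germ ⊤ x trivial ρ) = M.presheaf.germ ⊤ y trivial ρ :=
  TopCat.Presheaf.germ_stalkSpecializes_apply M.presheaf (U := ⊤) trivial h ρ

/-- The specialization maps of `M // (ρ)`. -/
def collapsedSpecializes {x y : X} (h : y ⤳ x) : CollapsedStalk M ρ x →* CollapsedStalk M ρ y :=
  Con.lift _ ((collapse M ρ y).comp (M.presheaf.stalkSpecializes h).hom) fun a b hab => by
    refine (collapse_eq_iff ρ _ _).2 ?_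
    rcases hab with rfl | ⟨h1, h2⟩
    · exact Or.inl rfl
    · refine Or.inr ⟨?_, ?_⟩
      · rw [← stalkSpecializes_ρ ρ h]
        exact map_dvd (M.presheaf.stalkSpecializes h).hom h1
      · rw [← stalkSpecializes_ρ ρ h]
        exact map_dvd (M.presheaf.stalkSpecializes h).hom h2

theorem collapsedSpecializes_collapse {x y : X} (h : y ⤳ x) (a : M.presheaf.stalk x) :
    collapsedSpecializes ρ h (collapse M ρ x a) =
      collapse M ρ y (M.presheaf.stalkSpecializes h a) := rfl

theorem collapsedSpecializes_refl {x : X} (h : x ⤳ x) (a : CollapsedStalk M ρ x) :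
    collapsedSpecializes ρ h a = a := by
  obtain ⟨a, rfl⟩ := collapse_surjective M ρ x a
  rw [collapsedSpecializes_collapse, TopCat.Presheaf.stalkSpecializes_refl]
  rfl

theorem collapsedSpecializes_comp {x y z : X} (h : y ⤳ x) (h' : z ⤳ y) (a : CollapsedStalk M ρ x) :
    collapsedSpecializes ρ h' (collapsedSpecializes ρ h a) =
      collapsedSpecializes ρ (h'.trans h) a := by
  obtain ⟨a, rfl⟩ := collapse_surjective M ρ x a
  rw [collapsedSpecializes_collapse, collapsedSpecializes_collapse, collapsedSpecializes_collapse,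
    TopCat.Presheaf.stalkSpecializes_comp_apply]

theorem bijective_collapsedSpecializes {x y : X} (h : y ⤳ x)
    (hb : Function.Bijective (M.presheaf.stalkSpecializes h)) :
    Function.Bijective (collapsedSpecializes ρ h) := by
  constructor
  · intro a b hab
    obtain ⟨a, rfl⟩ := collapse_surjective M ρ x a
    obtain ⟨b, rfl⟩ := collapse_surjective M ρ x b
    rw [collapsedSpecializes_collapse, collapsedSpecializes_collapse, collapse_eq_iff] at hab
    have hdvd : ∀ a, M.presheaf.germ ⊤ y trivial ρ ∣ M.presheaf.stalkSpecializes h a →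
        M.presheaf.germ ⊤ x trivial ρ ∣ a := by
      rintro a ⟨n, hn⟩
      obtain ⟨n, rfl⟩ := hb.2 n
      rw [← stalkSpecializes_ρ ρ h, ← map_mul] at hn
      exact ⟨n, hb.1 hn⟩
    rw [collapse_eq_iff]
    exact hab.imp (fun h => hb.1 h) fun h => ⟨hdvd a h.1, hdvd b h.2⟩
  · intro b
    obtain ⟨b, rfl⟩ := collapse_surjective M ρ y b
    obtain ⟨a, rfl⟩ := hb.2 b
    exact ⟨collapse M ρ x a, rfl⟩

variable (M)

/-- The identification of the stalks of the sheaf `M // (ρ)`. -/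
def quotientSpaceEval (x : X) : (quotientSpace M ρ).presheaf.stalk x →* CollapsedStalk M ρ x :=
  quotientEval M.presheaf (fun x => idealCon (M.presheaf.germ ⊤ x trivial ρ)) x

theorem quotientSpaceEval_bijective (x : X) : Function.Bijective (quotientSpaceEval M ρ x) :=
  quotientEval_idealCon_bijective M.presheaf ρ x

variable {M}

theorem quotientSpaceEval_germ (x : X) (U : X.Opens) (hx : x ∈ U)
    (s : (quotientSpace M ρ).presheaf.obj (op U)) :
    quotientSpaceEval M ρ x ((quotientSpace M ρ).presheaf.germ U x hx s) = s.1 ⟨x, hx⟩ :=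
  quotientEval_germ _ _ _ _ _ _

theorem exists_section_eq_collapse {x : X} {U : X.Opens} (hx : x ∈ U)
    (s : (quotientSpace M ρ).presheaf.obj (op U)) :
    ∃ (V : X.Opens) (_ : x ∈ V) (h : V ≤ U) (m : M.presheaf.obj (op V)), ∀ (y : X) (hy : y ∈ V),
      s.1 ⟨y, h hy⟩ = collapse M ρ y (M.presheaf.germ V y hy m) :=
  exists_rep M.presheaf (fun x => idealCon (M.presheaf.germ ⊤ x trivial ρ)) x U hx s

end Collapse

/-! ### Stalks of restrictions to subsets -/

section Restrict

variable (T : SheafedSpace CommMonCat.{u}) (S : Set T)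

/-- The identification of the stalks of the restriction to a subset. -/
def restrictSubsetEval (x : S) : (restrictSubset T S).presheaf.stalk x →* T.presheaf.stalk x.1 :=
  (subsetBasic T S).eval x

theorem restrictSubsetEval_germ (x : S) (U : Opens (TopCat.of S)) (hx : x ∈ U)
    (s : (restrictSubset T S).presheaf.obj (op U)) :
    restrictSubsetEval T S x ((restrictSubset T S).presheaf.germ U x hx s) = s.1 ⟨x, hx⟩ :=
  (subsetBasic T S).eval_germ x U hx s

theorem restrictSubsetEval_bijective (x : S) : Function.Bijective (restrictSubsetEval T S x) := by
  constructor
  · refine (subsetBasic T S).eval_injective x ?_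
    rintro U hx s t ⟨W, hW, m, hm⟩ ⟨W', hW', m', hm'⟩ h
    rw [hm, hm'] at h
    obtain ⟨V, hV, i, j, h⟩ := TopCat.Presheaf.germ_eq _ _ _ _ _ _ h
    refine ⟨U ⊓ (Opens.map (TopCat.ofHom ⟨Subtype.val, continuous_subtype_val⟩)).obj V, ⟨hx, hV⟩,
      inf_le_left, fun y => ?_⟩
    rw [hm, hm']
    exact (T.presheaf.germ_res_apply i y.1.1 y.2.2 m).symm.trans
      ((congrArg (T.presheaf.germ V y.1.1 y.2.2) h).trans
        (T.presheaf.germ_res_apply j y.1.1 y.2.2 m'))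
  · refine (subsetBasic T S).eval_surjective x fun a => ?_
    obtain ⟨W, hW, m, rfl⟩ := T.presheaf.exists_germ_eq a
    exact ⟨(Opens.map (TopCat.ofHom ⟨Subtype.val, continuous_subtype_val⟩)).obj W, hW,
      fun y => T.presheaf.germ W y.1.1 y.2 m, ⟨W, fun y => y.2, m, fun y => rfl⟩, rfl⟩

end Restrict

namespace PreGTCAtlas

variable {k : Type u} [Field k] {X : Scheme.{u}} {s : X ⟶ Spec (CommRingCat.of k)}
  {M : TopCat.Sheaf CommMonCat.{u} X} (G : PreGTCAtlas.{u, v} s M) (ρ : M.presheaf.obj (op ⊤))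

/-- The identification of the stalks of the fan. -/
def fanEval (y : G.fanSet) : (G.fan ρ).presheaf.stalk y →* CollapsedStalk M ρ y.1 :=
  (quotientSpaceEval M ρ y.1).comp (restrictSubsetEval (quotientSpace M ρ) G.fanSet y)

theorem fanEval_bijective (y : G.fanSet) : Function.Bijective (G.fanEval ρ y) :=
  (quotientSpaceEval_bijective M ρ y.1).comp
    (restrictSubsetEval_bijective (quotientSpace M ρ) G.fanSet y)

theorem fanEval_germ (y : G.fanSet) (U : Opens (G.fan ρ)) (hy : y ∈ U)
    (t : (G.fan ρ).presheaf.obj (op U)) : G.fanEval ρ y ((G.fan ρ).presheaf.germ U y hy t) =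
      quotientSpaceEval M ρ y.1 (t.1 ⟨y, hy⟩) :=
  congrArg (quotientSpaceEval M ρ y.1)
    (restrictSubsetEval_germ (quotientSpace M ρ) G.fanSet y U hy t)

/-- Sections of the fan are locally given by sections of `M`. -/
theorem exists_section_fan {y : G.fanSet} {U : Opens (G.fan ρ)} (hy : y ∈ U)
    (t : (G.fan ρ).presheaf.obj (op U)) : ∃ (V : X.Opens) (_ : y.1 ∈ V) (m : M.presheaf.obj (op V)),
      ∀ (z : G.fanSet) (hz : z ∈ U), z ⤳ y → ∀ hV : z.1 ∈ V,
        quotientSpaceEval M ρ z.1 (t.1 ⟨z, hz⟩) =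
          collapse M ρ z.1 (M.presheaf.germ V z.1 hV m) := by
  obtain ⟨O, hO, h, W, hW, m, hm⟩ := (subsetBasic (quotientSpace M ρ) G.fanSet).exists_basic t hy
  obtain ⟨V, hV, i, m', hm'⟩ := exists_section_eq_collapse ρ (hW ⟨y, hO⟩) m
  refine ⟨V, hV, m', fun z hz hzy hzV => ?_⟩
  have hzO : z ∈ O := hzy.mem_open O.2 hO
  have h1 := hm ⟨z, hzO⟩
  rw [← hm' z hzV]
  exact (congrArg (quotientSpaceEval M ρ z.1) h1).trans (quotientSpaceEval_germ ρ z.1 W _ m)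

/-- By `exists_nhds_specializes_proj`, the generizations of a fan point contain a neighbourhood of
it. So openness in the fan is just stability under generization. -/
theorem isOpen_fan_of_stable [LocallyOfFiniteType s] {O : Set G.fanSet}
    (h : ∀ y z : G.fanSet, z ⤳ y → y ∈ O → z ∈ O) : IsOpen O := by
  refine isOpen_iff_forall_mem_open.2 fun y hy => ?_
  obtain ⟨V, hV, hs⟩ := G.exists_nhds_specializes_proj y.1
  refine ⟨Subtype.val ⁻¹' V, fun z hz => h y z ?_ hy, V.2.preimage continuous_subtype_val, hV⟩
  rw [subtype_specializes_iff]
  exact G.proj_eq_self y.2 ▸ hs z.1 z.2 hz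

end PreGTCAtlas

namespace PreGTCAtlas

variable {k : Type u} [Field k] {X : Scheme.{u}} {s : X ⟶ Spec (CommRingCat.of k)}
  {M : TopCat.Sheaf CommMonCat.{u} X} (G : PreGTCAtlas.{u, v} s M) (ρ : M.presheaf.obj (op ⊤))

/-! ### The retraction to the fan -/

/-- The isomorphism between the stalks of `M // (ρ)` at `x` and at the generic point of its
stratum. -/
def projEquiv (x : X) : CollapsedStalk M ρ x ≃* CollapsedStalk M ρ (G.proj x) :=
  MulEquiv.ofBijective (collapsedSpecializes ρ (G.proj_specializes x))
    (bijective_collapsedSpecializes ρ _ (G.bijective_stalkSpecializes_proj x))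

/-- The retraction to the fan. -/
def projFan (x : X) : G.fanSet := ⟨G.proj x, G.proj_mem_fanSet x⟩

theorem continuous_projFan [LocallyOfFiniteType s] : Continuous G.projFan := by
  refine continuous_def.2 fun O hO => isOpen_iff_forall_mem_open.2 fun x hx => ?_
  obtain ⟨V, hV, hs⟩ := G.exists_nhds_specializes_proj x
  refine ⟨V, fun z hz => ?_, V.2, hV⟩
  have h : G.projFan z ⤳ G.projFan x := by
    rw [subtype_specializes_iff]
    exact hs _ (G.proj_mem_fanSet z) ((G.proj_specializes z).mem_open V.2 hz)
  exact h.mem_open hO hx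

/-- The retraction to the fan on sections. -/
def retractionFamily (O : Opens (G.fan ρ)) (W : X.Opens) (hW : ∀ x ∈ W, G.projFan x ∈ O) :
    (G.fan ρ).presheaf.obj (op O) →* ∀ x : W, CollapsedStalk M ρ x.1 where
  toFun t x := (G.projEquiv ρ x.1).symm
    (quotientSpaceEval M ρ (G.proj x.1) (t.1 ⟨G.projFan x.1, hW x.1 x.2⟩))
  map_one' := funext fun x => by
    refine (congrArg (fun a => (G.projEquiv ρ x.1).symm a)
      (map_one (quotientSpaceEval M ρ (G.proj x.1)))).trans (map_one _)
  map_mul' a b := funext fun x => by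
    refine (congrArg (fun a => (G.projEquiv ρ x.1).symm a)
      (map_mul (quotientSpaceEval M ρ (G.proj x.1)) _ _)).trans (map_mul _ _ _)

/-- A local representative at π(x) lifts to a section near x, as M_x → M_π(x) is bijective. The two
agree on a neighbourhood of π(x), which contains π(z) for all z near x, since π(z) generizes π(x).
-/
theorem retractionFamily_mem (O : Opens (G.fan ρ)) (W : X.Opens)
    (hW : ∀ x ∈ W, G.projFan x ∈ O) [LocallyOfFiniteType s] (t : (G.fan ρ).presheaf.obj (op O)) :
    G.retractionFamily ρ O W hW t ∈ (quotientBasic M.presheaf fun x =>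
      idealCon (M.presheaf.germ ⊤ x trivial ρ)).sections W := by
  rintro ⟨x, hx⟩
  obtain ⟨V, hV, m, hm⟩ := G.exists_section_fan ρ (hW x hx) t
  obtain ⟨a, ha⟩ := (G.bijective_stalkSpecializes_proj x).2 (M.presheaf.germ V (G.proj x) hV m)
  obtain ⟨V', hV', m', rfl⟩ := M.presheaf.exists_germ_eq a
  rw [TopCat.Presheaf.germ_stalkSpecializes_apply] at ha
  obtain ⟨V₁, hV₁, i, j, h⟩ := TopCat.Presheaf.germ_eq _ _ _ _ _ _ ha
  obtain ⟨V₂, hV₂, hs⟩ := G.exists_nhds_specializes_proj x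
  refine ⟨W ⊓ V' ⊓ V₂, ⟨⟨hx, hV'⟩, hV₂⟩, homOfLE (inf_le_left.trans inf_le_left),
    M.presheaf.map (homOfLE (inf_le_left.trans inf_le_right)).op m', funext fun z => ?_⟩
  have hz : G.proj z.1 ⤳ G.proj x := hs _ (G.proj_mem_fanSet _)
    ((G.proj_specializes z.1).mem_open V₂.2 z.2.2)
  have hz₁ : G.proj z.1 ∈ V₁ := hz.mem_open V₁.2 hV₁
  have h1 := hm (G.projFan z.1) (hW z.1 z.2.1.1) ((subtype_specializes_iff _ _).2 hz)
    (j.le hz₁)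
  have h2 : M.presheaf.germ V (G.proj z.1) (j.le hz₁) m =
      M.presheaf.germ V' (G.proj z.1) (i.le hz₁) m' := by
    have := congrArg (M.presheaf.germ V₁ (G.proj z.1) hz₁) h
    rw [M.presheaf.germ_res_apply i, M.presheaf.germ_res_apply j] at this
    exact this.symm
  change collapse M ρ z.1 (M.presheaf.germ _ z.1 z.2 _) = (G.projEquiv ρ z.1).symm
    (quotientSpaceEval M ρ (G.proj z.1) (t.1 ⟨G.projFan z.1, hW z.1 z.2.1.1⟩))
  rw [MulEquiv.eq_symm_apply, TopCat.Presheaf.germ_res_apply]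
  refine Eq.trans ?_ h1.symm
  refine (collapsedSpecializes_collapse ρ (G.proj_specializes z.1) _).trans ?_
  rw [TopCat.Presheaf.germ_stalkSpecializes_apply]
  exact congrArg (collapse M ρ (G.proj z.1)) h2.symm

/-- The continuous map underlying the retraction to the fan. -/
def retractionBase [LocallyOfFiniteType s] :
    (quotientSpace M ρ).carrier ⟶ (G.fan ρ).carrier :=
  TopCat.ofHom ⟨G.projFan, G.continuous_projFan⟩

/-- The retraction of `X` with the sheaf `M // (ρ)` to the fan. -/
def retraction [LocallyOfFiniteType s] : quotientSpace M ρ ⟶ G.fan ρ := InducedCategory.homMk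
  { base := G.retractionBase ρ
    c :=
      { app := fun O => CommMonCat.ofHom
          ((G.retractionFamily ρ O.unop ((Opens.map (G.retractionBase ρ)).obj O.unop)
            fun x hx => hx).codRestrict _ fun t => G.retractionFamily_mem ρ _ _ _ t)
        naturality := fun U V i => by
          ext t
          rfl } }

theorem projEquiv_stalkMap_retraction [LocallyOfFiniteType s] (x : X)
    (a : (G.fan ρ).presheaf.stalk (G.projFan x)) :
    G.projEquiv ρ x (quotientSpaceEval M ρ x ((G.retraction ρ).hom.stalkMap x a)) =
      G.fanEval ρ (G.projFan x) a := by
  obtain ⟨O, hO, t, rfl⟩ := (G.fan ρ).presheaf.exists_germ_eq a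
  have h1 := PresheafedSpace.stalkMap_germ_apply (G.retraction ρ).hom O x hO t
  rw [fanEval_germ]
  refine (congrArg (fun a => G.projEquiv ρ x (quotientSpaceEval M ρ x a)) h1).trans ?_
  refine (congrArg (fun a => G.projEquiv ρ x a) (quotientSpaceEval_germ ρ x _ hO _)).trans ?_
  exact (G.projEquiv ρ x).apply_symm_apply _

theorem bijective_stalkMap_retraction [LocallyOfFiniteType s] (x : X) :
    Function.Bijective ((G.retraction ρ).hom.stalkMap x) := by
  have h : Function.Bijective ((G.projEquiv ρ x ∘ quotientSpaceEval M ρ x) ∘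
      (G.retraction ρ).hom.stalkMap x) := by
    have e : (G.projEquiv ρ x ∘ quotientSpaceEval M ρ x) ∘ (G.retraction ρ).hom.stalkMap x =
        G.fanEval ρ (G.projFan x) := funext fun a => G.projEquiv_stalkMap_retraction ρ x a
    rw [e]
    exact G.fanEval_bijective ρ (G.projFan x)
  exact (Function.Bijective.of_comp_iff' ((G.projEquiv ρ x).bijective.comp
    (quotientSpaceEval_bijective M ρ x)) _).1 h

theorem fanInclusion_comp_retraction [LocallyOfFiniteType s] :
    G.fanInclusion ρ ≫ G.retraction ρ = 𝟙 (G.fan ρ) := by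
  have hbase : (G.fanInclusion ρ ≫ G.retraction ρ).hom.base =
      (𝟙 (G.fan ρ) : G.fan ρ ⟶ G.fan ρ).hom.base := by
    ext y
    exact Subtype.ext (G.proj_eq_self y.2)
  refine SheafedSpace.ext _ _ hbase ?_
  ext O t
  apply Subtype.ext
  funext y
  apply (quotientSpaceEval_bijective M ρ y.1.1).1
  -- The point `z` is kept variable so that the equality of π(y) with y can be substituted; the
  -- specialization map is then the identity.
  have key : ∀ (z : G.fanSet) (hz : z ∈ O) (hzy : z.1 ⤳ y.1.1) (h : z.1 = y.1.1) (hy : y.1 ∈ O),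
      collapsedSpecializes ρ hzy (quotientSpaceEval M ρ y.1.1 (t.1 ⟨y.1, hy⟩)) =
        quotientSpaceEval M ρ z.1 (t.1 ⟨z, hz⟩) := by
    rintro ⟨z, hz'⟩ hz hzy rfl hy
    exact collapsedSpecializes_refl ρ _ _
  refine (quotientSpaceEval_germ ρ y.1.1 _ _ _).trans ?_
  refine ((G.projEquiv ρ y.1.1).symm_apply_eq.2 ?_)
  exact (key (G.projFan y.1.1) _ (G.proj_specializes _) (G.proj_eq_self y.1.2) _).symm

end PreGTCAtlas

/-! ### Stalks of affine Kato fans -/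

section Spec

variable (P : Type u) [CommMonoid P]

/-- The localization map to the stalk at a prime ideal. -/
def specMk (I : PrimeIdeal P) : P →* SpecStalk P I where
  toFun a := Associates.mk (Localization.mk a 1)
  map_one' := by rw [Localization.mk_one, Associates.mk_one]
  map_mul' a b := by rw [Associates.mk_mul_mk, Localization.mk_mul, mul_one]

variable {P}

theorem PrimeIdeal.mem_primeCompl_of_mul {I : PrimeIdeal P} {a b : P} (h : a * b ∈ I.primeCompl) :
    b ∈ I.primeCompl := fun hb => h (I.mul_mem a b hb)

/-- Denominators become units, so they disappear in the quotient by units. -/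
theorem mk_eq_specMk (I : PrimeIdeal P) (a : P) (f : I.primeCompl) :
    Associates.mk (Localization.mk a f) = specMk P I a := by
  refine Associates.mk_eq_mk_iff_associated.2
    ⟨⟨Localization.mk f.1 1, Localization.mk 1 f, ?_, ?_⟩, ?_⟩
  · rw [Localization.mk_mul, mul_one, one_mul, Localization.mk_self]
  · rw [Localization.mk_mul, mul_one, one_mul, Localization.mk_self]
  · change Localization.mk a f * Localization.mk f.1 1 = Localization.mk a 1
    rw [Localization.mk_mul, mul_one, Localization.mk_eq_mk_iff, Localization.r_iff_exists]
    exact ⟨1, by simp [mul_comm]⟩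

theorem specMk_surjective (I : PrimeIdeal P) : Function.Surjective (specMk P I) := by
  intro b
  obtain ⟨b, rfl⟩ := Associates.mk_surjective b
  induction b using Localization.induction_on with
  | _ y => exact ⟨y.1, (mk_eq_specMk I y.1 y.2).symm⟩

theorem specMk_eq_iff (I : PrimeIdeal P) (a b : P) : specMk P I a = specMk P I b ↔
    ∃ p ∈ I.primeCompl, ∃ q ∈ I.primeCompl, a * p = b * q := by
  constructor
  · intro h
    obtain ⟨⟨w, w', h1, h2⟩, h⟩ := Associates.mk_eq_mk_iff_associated.1 h
    change Localization.mk a 1 * w = Localization.mk b 1 at h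
    clear h2
    induction w using Localization.induction_on with
    | _ w =>
    induction w' using Localization.induction_on with
    | _ w' =>
    rw [Localization.mk_mul, ← Localization.mk_one, Localization.mk_eq_mk_iff,
      Localization.r_iff_exists] at h1
    rw [Localization.mk_mul, Localization.mk_eq_mk_iff, Localization.r_iff_exists] at h
    obtain ⟨z, hz⟩ := h1
    obtain ⟨y, hy⟩ := h
    -- The complement of a prime contains all factors of its elements, so the numerator of an
    -- invertible fraction lies in it.
    have hw : w.1 ∈ I.primeCompl := by
      have : (z : P) * (((1 : I.primeCompl) : P) * (w.1 * w'.1)) ∈ I.primeCompl := by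
        rw [hz, mul_one]
        exact (z * (w.2 * w'.2)).2
      refine PrimeIdeal.mem_primeCompl_of_mul (a := z * w'.1) ?_
      convert this using 1
      simp only [OneMemClass.coe_one, one_mul]
      rw [mul_assoc, mul_comm w'.1]
    refine ⟨y * w.1, I.primeCompl.mul_mem y.2 hw, y * w.2, (y * w.2).2, ?_⟩
    simp only [OneMemClass.coe_one, one_mul] at hy
    rw [mul_left_comm, hy]
    exact (mul_assoc _ _ _).symm.trans (mul_comm _ _)
  · rintro ⟨p, hp, q, hq, h⟩
    rw [← mk_eq_specMk I a 1, ← mk_eq_specMk I b 1]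
    have h1 : ∀ (a p : P), p ∈ I.primeCompl → specMk P I (a * p) = specMk P I a := by
      intro a p hp
      rw [← mk_eq_specMk I a ⟨p, hp⟩, ← mk_eq_specMk I (a * p) (⟨p, hp⟩ * ⟨p, hp⟩)]
      congr 1
      rw [Localization.mk_eq_mk_iff, Localization.r_iff_exists]
      exact ⟨1, by simp only [OneMemClass.coe_one, one_mul, Submonoid.coe_mul]; ac_rfl⟩
    rw [mk_eq_specMk, mk_eq_specMk, ← h1 a p hp, h, h1 b q hq]

theorem isOpen_setOf_notMem (f : P) : IsOpen {I : PrimeIdeal P | f ∉ I.carrier} :=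
  TopologicalSpace.GenerateOpen.basic _ ⟨f, rfl⟩

/-- The identification of the stalks of an affine Kato fan. -/
def specEval (I : monoidSpec P) : (monoidSpec P).presheaf.stalk I →* SpecStalk P I :=
  (specBasic P).eval I

theorem specEval_germ (I : monoidSpec P) (U : Opens (monoidSpec P)) (hI : I ∈ U)
    (t : (monoidSpec P).presheaf.obj (op U)) :
    specEval I ((monoidSpec P).presheaf.germ U I hI t) = t.1 ⟨I, hI⟩ :=
  (specBasic P).eval_germ I U hI t

theorem exists_specMk {I : monoidSpec P} {U : Opens (monoidSpec P)} (hI : I ∈ U)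
    (t : (monoidSpec P).presheaf.obj (op U)) :
    ∃ (V : Opens (monoidSpec P)) (_ : I ∈ V) (h : V ≤ U) (a : P), ∀ (J : monoidSpec P) (hJ : J ∈ V),
      t.1 ⟨J, h hJ⟩ = specMk P J a := by
  obtain ⟨V, hV, h, a, f, ht⟩ := (specBasic P).exists_basic t hI
  refine ⟨V, hV, h, a, fun J hJ => ?_⟩
  obtain ⟨hf, h'⟩ := ht ⟨J, hJ⟩
  exact h'.trans (mk_eq_specMk J a ⟨f, hf⟩)

theorem specEval_bijective (I : monoidSpec P) : Function.Bijective (specEval I) := by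
  constructor
  · refine (specBasic P).eval_injective I ?_
    rintro U hI s t ⟨a, f, hs⟩ ⟨b, g, ht⟩ h
    have hs' : ∀ J : U, s J = specMk P J.1 a := fun J => by
      obtain ⟨hf, h⟩ := hs J
      exact h.trans (mk_eq_specMk J.1 a ⟨f, hf⟩)
    have ht' : ∀ J : U, t J = specMk P J.1 b := fun J => by
      obtain ⟨hf, h⟩ := ht J
      exact h.trans (mk_eq_specMk J.1 b ⟨g, hf⟩)
    rw [hs', ht'] at h
    obtain ⟨p, hp, q, hq, h⟩ := (specMk_eq_iff I a b).1 h
    refine ⟨U ⊓ (⟨_, isOpen_setOf_notMem p⟩ ⊓ ⟨_, isOpen_setOf_notMem q⟩), ⟨hI, hp, hq⟩,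
      inf_le_left, fun J => ?_⟩
    rw [hs', ht']
    exact (specMk_eq_iff J.1 a b).2 ⟨p, J.2.2.1, q, J.2.2.2, h⟩
  · refine (specBasic P).eval_surjective I fun a => ?_
    obtain ⟨a, rfl⟩ := specMk_surjective I a
    exact ⟨⊤, trivial, fun J => specMk P J.1 a, ⟨a, 1, fun J => ⟨J.1.primeCompl.one_mem, rfl⟩⟩, rfl⟩

end Spec

/-- Two quotients of a monoid by the same congruence are isomorphic. -/
def mulEquivOfSurjective {P A B : Type*} [CommMonoid P] [CommMonoid A] [CommMonoid B] (f : P →* A)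
    (g : P →* B) (hf : Function.Surjective f) (hg : Function.Surjective g)
    (h : ∀ a b, f a = f b ↔ g a = g b) : A ≃* B :=
  have key : ∀ p, g (Function.surjInv hf (f p)) = g p := fun p =>
    (h _ _).1 (Function.surjInv_eq hf _)
  MulEquiv.ofBijective
    ({ toFun := fun a => g (Function.surjInv hf a)
       map_one' := by simpa only [map_one] using key 1
       map_mul' := fun a b => by
        obtain ⟨a, rfl⟩ := hf a
        obtain ⟨b, rfl⟩ := hf b
        rw [← map_mul, key, key, key, map_mul] } : A →* B)
    ⟨fun a b hab => by
      obtain ⟨a, rfl⟩ := hf a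
      obtain ⟨b, rfl⟩ := hf b
      exact (h a b).2 ((key a).symm.trans (hab.trans (key b))), fun b => by
      obtain ⟨p, rfl⟩ := hg b
      exact ⟨f p, key p⟩⟩

theorem mulEquivOfSurjective_apply {P A B : Type*} [CommMonoid P] [CommMonoid A] [CommMonoid B]
    (f : P →* A) (g : P →* B) (hf : Function.Surjective f) (hg : Function.Surjective g)
    (h : ∀ a b, f a = f b ↔ g a = g b) (p : P) : mulEquivOfSurjective f g hf hg h (f p) = g p :=
  (h _ _).1 (Function.surjInv_eq hf _)

/-- In a sharp monoid ρ ≠ 1 divides no unit, so collapsing its ideal leaves the class of 1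
untouched. -/
theorem collapse_eq_one_iff {X : Scheme.{u}} {M : TopCat.Sheaf CommMonCat.{u} X}
    {ρ : M.presheaf.obj (op ⊤)} {x : X} (hx : IsSharp (M.presheaf.stalk x))
    (h1 : M.presheaf.germ ⊤ x trivial ρ ≠ 1) (a : M.presheaf.stalk x) :
    collapse M ρ x a = 1 ↔ a = 1 := by
  rw [← map_one (collapse M ρ x), collapse_eq_iff]
  exact or_iff_left fun h => h1 (hx _ (isUnit_of_dvd_one h.2))

theorem isSharp_collapsedStalk {X : Scheme.{u}} {M : TopCat.Sheaf CommMonCat.{u} X}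
    {ρ : M.presheaf.obj (op ⊤)} {x : X} (hx : IsSharp (M.presheaf.stalk x))
    (h1 : M.presheaf.germ ⊤ x trivial ρ ≠ 1) : IsSharp (CollapsedStalk M ρ x) := by
  intro a ha
  obtain ⟨b, hb⟩ := ha.exists_right_inv
  obtain ⟨a, rfl⟩ := collapse_surjective M ρ x a
  obtain ⟨b, rfl⟩ := collapse_surjective M ρ x b
  rw [← map_mul, collapse_eq_one_iff hx h1] at hb
  rw [hx a (IsUnit.of_mul_eq_one b hb), map_one]

/-! ### Collapsed stalks as localizations, and their prime ideals -/

namespace PreGTCAtlas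

variable {k : Type u} [Field k] {X : Scheme.{u}} {s : X ⟶ Spec (CommRingCat.of k)}
  {M : TopCat.Sheaf CommMonCat.{u} X} (G : PreGTCAtlas.{u, v} s M) {ρ : M.presheaf.obj (op ⊤)}

theorem collapsedSpecializes_surjective (G : PreGTCAtlas.{u, v} s M) {x y : X} (h : y ⤳ x) :
    Function.Surjective (collapsedSpecializes ρ h) := by
  intro b
  obtain ⟨b, rfl⟩ := collapse_surjective M ρ y b
  obtain ⟨a, rfl⟩ := G.stalkSpecializes_surjective h b
  exact ⟨collapse M ρ x a, rfl⟩

/-- This matches the relation `specMk_eq_iff`, so the stalk at a generization is a localization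
modulo units. If both images are ∞, each element can be multiplied into the ideal of ρ by one that
becomes trivial. -/
theorem collapsedSpecializes_eq_iff (G : PreGTCAtlas.{u, v} s M) {x y : X} (h : y ⤳ x)
    (a b : CollapsedStalk M ρ x) : collapsedSpecializes ρ h a = collapsedSpecializes ρ h b ↔
      ∃ p, collapsedSpecializes ρ h p = 1 ∧ ∃ q, collapsedSpecializes ρ h q = 1 ∧
        a * p = b * q := by
  constructor
  · intro hab
    obtain ⟨a, rfl⟩ := collapse_surjective M ρ x a
    obtain ⟨b, rfl⟩ := collapse_surjective M ρ x b
    have h1 : ∀ r, M.presheaf.stalkSpecializes h r = 1 →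
        collapsedSpecializes ρ h (collapse M ρ x r) = 1 := fun r hr => by
      rw [collapsedSpecializes_collapse, hr, map_one]
    rw [collapsedSpecializes_collapse, collapsedSpecializes_collapse, collapse_eq_iff] at hab
    rcases hab with hab | ⟨ha, hb⟩
    · obtain ⟨r, r', hr, hr', h⟩ := G.exists_of_stalkSpecializes_eq h hab
      exact ⟨_, h1 r hr, _, h1 r' hr', by rw [← map_mul, h, map_mul]⟩
    · have key : ∀ a, M.presheaf.germ ⊤ y trivial ρ ∣ M.presheaf.stalkSpecializes h a →
          ∃ r, M.presheaf.stalkSpecializes h r = 1 ∧ collapse M ρ x a * collapse M ρ x r =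
            collapse M ρ x (M.presheaf.germ ⊤ x trivial ρ) := by
        rintro a ⟨n, hn⟩
        obtain ⟨n, rfl⟩ := G.stalkSpecializes_surjective h n
        rw [← stalkSpecializes_ρ ρ h, ← map_mul] at hn
        obtain ⟨r, r', hr, hr', h⟩ := G.exists_of_stalkSpecializes_eq h hn
        refine ⟨r, hr, ?_⟩
        rw [← map_mul, h, mul_assoc, mul_comm, collapse_mul_ρ]
      obtain ⟨r, hr, ha⟩ := key a ha
      obtain ⟨r', hr', hb⟩ := key b hb
      exact ⟨_, h1 r hr, _, h1 r' hr', ha.trans hb.symm⟩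
  · rintro ⟨p, hp, q, hq, h'⟩
    have := congrArg (collapsedSpecializes ρ h) h'
    rwa [map_mul, map_mul, hp, hq, mul_one, mul_one] at this

theorem specializes_of_collapsed (hM : ∀ x : X, IsSharp (M.presheaf.stalk x))
    (hρ : G.IsDistinguished ρ) {x y y' : X} (hy : y ∈ G.fanSet) (hy' : y' ∈ G.fanSet)
    (h : y ⤳ x) (h' : y' ⤳ x) (H : ∀ n, collapsedSpecializes ρ h n = 1 →
      collapsedSpecializes ρ h' n = 1) : y' ⤳ y := by
  refine G.specializes_of_mem_fanSet hy hy' h h' fun m hm => ?_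
  rw [← collapse_eq_one_iff (hM _) (hρ.germ_ne_one G _)] at hm ⊢
  exact H (collapse M ρ x m) hm

theorem isSharp_stalk_fan (hM : ∀ x : X, IsSharp (M.presheaf.stalk x)) (hρ : G.IsDistinguished ρ) :
    IsMonoidalSpace (G.fan ρ) := by
  intro y a ha
  apply (G.fanEval_bijective ρ y).1
  rw [map_one]
  exact isSharp_collapsedStalk (hM _) (hρ.germ_ne_one G _) _ (ha.map (G.fanEval ρ y))

/-- The prime ideal of the elements which do not become trivial at a generization. -/
def chartPrime (hM : ∀ x : X, IsSharp (M.presheaf.stalk x)) (hρ : G.IsDistinguished ρ) {x y : X}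
    (h : y ⤳ x) : PrimeIdeal (CollapsedStalk M ρ x) where
  carrier := {n | collapsedSpecializes ρ h n ≠ 1}
  mul_mem a b hb hab := hb (isSharp_collapsedStalk (hM y) (hρ.germ_ne_one G y) _
    (IsUnit.of_mul_eq_one (collapsedSpecializes ρ h a) (by rw [mul_comm, ← map_mul, hab])))
  absorbing_mem z _ hz hz1 := by
    -- An absorbing element must be the class ∞ of ρ, which remains nontrivial at every
    -- generization.
    have h1 : collapse M ρ x (M.presheaf.germ ⊤ x trivial ρ) = z := by
      obtain ⟨m, rfl⟩ := collapse_surjective M ρ x z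
      rw [← hz, ← map_mul, mul_comm, collapse_mul_ρ]
    rw [← h1, collapsedSpecializes_collapse, stalkSpecializes_ρ,
      collapse_eq_one_iff (hM y) (hρ.germ_ne_one G y)] at hz1
    exact hρ.germ_ne_one G y hz1
  one_notMem h1 := h1 (map_one _)
  mem_or_mem a b hab := by
    by_contra! hc
    obtain ⟨ha, hb⟩ := hc
    rw [Set.mem_ofPred_eq, not_not] at ha hb
    exact hab (by rw [map_mul, ha, hb, mul_one])

theorem mem_primeCompl_chartPrime (hM : ∀ x : X, IsSharp (M.presheaf.stalk x))
    (hρ : G.IsDistinguished ρ) {x y : X} (h : y ⤳ x) (n : CollapsedStalk M ρ x) :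
    n ∈ (G.chartPrime hM hρ h).primeCompl ↔ collapsedSpecializes ρ h n = 1 := not_not

/-- The identification of the stalk of a chart with the stalk of the fan. -/
def chartStalkEquiv (hM : ∀ x : X, IsSharp (M.presheaf.stalk x)) (hρ : G.IsDistinguished ρ)
    {x y : X} (h : y ⤳ x) :
    SpecStalk (CollapsedStalk M ρ x) (G.chartPrime hM hρ h) ≃* CollapsedStalk M ρ y :=
  mulEquivOfSurjective (specMk _ _) (collapsedSpecializes ρ h) (specMk_surjective _)
    (G.collapsedSpecializes_surjective h) fun a b => by
      rw [specMk_eq_iff, G.collapsedSpecializes_eq_iff]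
      simp only [mem_primeCompl_chartPrime]

theorem chartStalkEquiv_specMk (hM : ∀ x : X, IsSharp (M.presheaf.stalk x))
    (hρ : G.IsDistinguished ρ) {x y : X} (h : y ⤳ x) (n : CollapsedStalk M ρ x) :
    G.chartStalkEquiv hM hρ h (specMk _ _ n) = collapsedSpecializes ρ h n :=
  mulEquivOfSurjective_apply _ _ _ _ _ n

/-- A prime must contain the absorbing element ∞, so its complement pulls back to a face of M_x
avoiding ρ, which a fan point realizes. -/
theorem exists_chartPrime_eq (hM : ∀ x : X, IsSharp (M.presheaf.stalk x))
    (hρ : G.IsDistinguished ρ) {x : X} (I : PrimeIdeal (CollapsedStalk M ρ x)) :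
    ∃ y ∈ G.fanSet, ∃ h : y ⤳ x, G.chartPrime hM hρ h = I := by
  let N : Submonoid (M.presheaf.stalk x) := I.primeCompl.comap (collapse M ρ x)
  have hN : IsFace N := fun a b hab => by
    rw [Submonoid.mem_comap, map_mul, mul_comm] at hab
    exact PrimeIdeal.mem_primeCompl_of_mul hab
  have hmem : collapse M ρ x (M.presheaf.germ ⊤ x trivial ρ) ∈ I.carrier := by
    refine I.absorbing_mem _ ?_ fun a => ?_
    · rw [Ne, collapse_eq_one_iff (hM x) (hρ.germ_ne_one G x)]
      exact hρ.germ_ne_one G x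
    · obtain ⟨m, rfl⟩ := collapse_surjective M ρ x a
      rw [← map_mul, collapse_mul_ρ]
  obtain ⟨y, hy, h, hm⟩ := hρ.exists_mem_fanSet G x hN fun h => h hmem
  refine ⟨y, hy, h, PrimeIdeal.ext (Set.ext fun n => ?_)⟩
  obtain ⟨m, rfl⟩ := collapse_surjective M ρ x n
  change ¬ (collapse M ρ y (M.presheaf.stalkSpecializes h m) = 1) ↔ _
  rw [collapse_eq_one_iff (hM y) (hρ.germ_ne_one G y), hm]
  exact not_not

/-! ### Charts of the fan -/

/-- The smallest open neighbourhood of a point of the fan. -/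
def minNhds [LocallyOfFiniteType s] (ρ : M.presheaf.obj (op ⊤)) (t : G.fanSet) :
    Opens (G.fan ρ) :=
  ⟨{y : G.fanSet | y ⤳ t}, G.isOpen_fan_of_stable fun _ _ h h' => h.trans h'⟩

theorem specializes_of_mem_minNhds [LocallyOfFiniteType s] {t : G.fanSet} {y : G.fanSet}
    (hy : y ∈ G.minNhds ρ t) : y.1 ⤳ t.1 := (subtype_specializes_iff _ _).1 hy

variable [LocallyOfFiniteType s] (hM : ∀ x : X, IsFineSharp (M.presheaf.stalk x))
  (hρ : G.IsDistinguished ρ) (t : G.fanSet)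

/-- The identification of the smallest open neighbourhood with an affine Kato fan on points. -/
def chartPoint (y : G.minNhds ρ t) : PrimeIdeal (CollapsedStalk M ρ t.1) :=
  G.chartPrime (fun x => (hM x).sharp) hρ (G.specializes_of_mem_minNhds y.2)

theorem fg_collapsedStalk (hM : ∀ x : X, IsFineSharp (M.presheaf.stalk x))
    (ρ : M.presheaf.obj (op ⊤)) (x : X) : Monoid.FG (CollapsedStalk M ρ x) :=
  have := (hM x).fg
  Monoid.fg_of_surjective (collapse M ρ x) (collapse_surjective M ρ x)

theorem chartPoint_mem_iff (y : G.minNhds ρ t) (n : CollapsedStalk M ρ t.1) :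
    n ∉ (G.chartPoint hM hρ t y).carrier ↔
      collapsedSpecializes ρ (G.specializes_of_mem_minNhds y.2) n = 1 := not_not

theorem continuous_chartPoint : Continuous (G.chartPoint hM hρ t) := by
  refine continuous_generateFrom_iff.2 ?_
  rintro _ ⟨n, rfl⟩
  have h : IsOpen {y : G.fanSet | ∃ hy : y ⤳ t,
      collapsedSpecializes ρ ((subtype_specializes_iff _ _).1 hy) n = 1} := by
    refine G.isOpen_fan_of_stable ?_
    rintro y z hzy ⟨hy, h⟩
    refine ⟨hzy.trans hy, ?_⟩
    rw [← collapsedSpecializes_comp ρ ((subtype_specializes_iff _ _).1 hy)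
      ((subtype_specializes_iff _ _).1 hzy), h, map_one]
  convert h.preimage (continuous_subtype_val : Continuous (Subtype.val : G.minNhds ρ t → G.fanSet))
    using 1
  ext y
  refine (G.chartPoint_mem_iff hM hρ t y n).trans ?_
  exact ⟨fun h => ⟨y.2, h⟩, fun ⟨_, h⟩ => h⟩

theorem chartPoint_surjective : Function.Surjective (G.chartPoint hM hρ t) := by
  intro I
  obtain ⟨y, hy, h, rfl⟩ := G.exists_chartPrime_eq (fun x => (hM x).sharp) hρ I
  exact ⟨⟨⟨y, hy⟩, (subtype_specializes_iff _ _).2 h⟩, rfl⟩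

theorem specializes_of_chartPoint {y y' : G.minNhds ρ t}
    (h : (G.chartPoint hM hρ t y').carrier ⊆ (G.chartPoint hM hρ t y).carrier) : y'.1 ⤳ y.1 := by
  refine (subtype_specializes_iff _ _).2 (G.specializes_of_collapsed (fun x => (hM x).sharp) hρ
    y.1.2 y'.1.2 (G.specializes_of_mem_minNhds y.2) (G.specializes_of_mem_minNhds y'.2)
    fun n hn => ?_)
  rw [← chartPoint_mem_iff G hM hρ] at hn ⊢
  exact fun h' => hn (h h')

theorem chartPoint_injective : Function.Injective (G.chartPoint hM hρ t) := by
  intro y y' h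
  have h1 := G.specializes_of_chartPoint hM hρ t (y := y) (y' := y') (h ▸ subset_rfl)
  have h2 := G.specializes_of_chartPoint hM hρ t (y := y') (y' := y) (h ▸ subset_rfl)
  apply Subtype.ext
  apply Subtype.ext
  exact Inseparable.eq (X := X)
    (((subtype_specializes_iff _ _).1 h2).antisymm ((subtype_specializes_iff _ _).1 h1))

/-- The complement of a prime is a face of a finitely generated monoid, hence finitely generated. A
finite intersection of sets D(n) is thus the set of generizations of the prime, matching the
smallest neighbourhoods in the fan. -/
theorem isOpenMap_chartPoint : IsOpenMap (G.chartPoint hM hρ t) := by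
  intro O hO
  refine isOpen_iff_forall_mem_open.2 ?_
  rintro _ ⟨y, hy, rfl⟩
  have hface : IsFace (G.chartPoint hM hρ t y).primeCompl := fun a b hab =>
    PrimeIdeal.mem_primeCompl_of_mul ((mul_comm a b) ▸ hab)
  obtain ⟨S, hS⟩ := hface.fg (fg_collapsedStalk hM ρ t.1)
  refine ⟨⋂ n ∈ S, {I | n ∉ I.carrier}, fun J hJ => ?_,
    isOpen_biInter_finset fun n _ => isOpen_setOf_notMem n, Set.mem_iInter₂.2 fun n hn => ?_⟩
  · obtain ⟨y', rfl⟩ := G.chartPoint_surjective hM hρ t J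
    refine ⟨y', ?_, rfl⟩
    have h1 : (G.chartPoint hM hρ t y).primeCompl ≤ (G.chartPoint hM hρ t y').primeCompl := by
      rw [← hS, Submonoid.closure_le]
      exact fun n hn => Set.mem_iInter₂.1 hJ n hn
    have h2 : y'.1 ⤳ y.1 := G.specializes_of_chartPoint hM hρ t fun n hn =>
      by_contra fun hn' => h1 hn' hn
    have h3 : y' ⤳ y := (subtype_specializes_iff _ _).2 h2
    exact h3.mem_open hO hy
  · have : n ∈ Submonoid.closure (S : Set (CollapsedStalk M ρ t.1)) := Submonoid.subset_closure hn
    rw [hS] at this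
    exact this

end PreGTCAtlas

/-! ### Isomorphism of smallest neighbourhoods with affine Kato fans -/

namespace PreGTCAtlas

variable {k : Type u} [Field k] {X : Scheme.{u}} {s : X ⟶ Spec (CommRingCat.of k)}
  {M : TopCat.Sheaf CommMonCat.{u} X} (G : PreGTCAtlas.{u, v} s M) {ρ : M.presheaf.obj (op ⊤)}
  [LocallyOfFiniteType s] (hM : ∀ x : X, IsFineSharp (M.presheaf.stalk x))
  (hρ : G.IsDistinguished ρ) (t : G.fanSet)

/-- The isomorphism of the stalks of the fan and of the sheaf `M // (ρ)`. -/
def quotientSpaceEquiv (M : TopCat.Sheaf CommMonCat.{u} X) (ρ : M.presheaf.obj (op ⊤)) (x : X) :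
    (quotientSpace M ρ).presheaf.stalk x ≃* CollapsedStalk M ρ x :=
  MulEquiv.ofBijective _ (quotientSpaceEval_bijective M ρ x)

/-- The identification of a neighbourhood in the fan with an affine Kato fan on sections. -/
def chartFamily (O : Opens (monoidSpec (CollapsedStalk M ρ t.1))) (W : Opens (G.fan ρ))
    (hW : ∀ y ∈ W, ∃ hy : y ∈ G.minNhds ρ t, G.chartPoint hM hρ t ⟨y, hy⟩ ∈ O) :
    (monoidSpec (CollapsedStalk M ρ t.1)).presheaf.obj (op O) →*
      ∀ y : W, (quotientSpace M ρ).presheaf.stalk y.1.1 where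
  toFun a y := (quotientSpaceEquiv M ρ y.1.1).symm
    (G.chartStalkEquiv (fun x => (hM x).sharp) hρ (G.specializes_of_mem_minNhds (hW y.1 y.2).1)
      (a.1 ⟨_, (hW y.1 y.2).2⟩))
  map_one' := funext fun y => ((quotientSpaceEquiv M ρ y.1.1).symm_apply_eq).2
    ((map_one (G.chartStalkEquiv _ hρ _)).trans (map_one _).symm)
  map_mul' a b := funext fun y => ((quotientSpaceEquiv M ρ y.1.1).symm_apply_eq).2 <| by
    refine (map_mul (G.chartStalkEquiv _ hρ _) _ _).trans ?_
    rw [Pi.mul_apply, map_mul, MulEquiv.apply_symm_apply, MulEquiv.apply_symm_apply]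

/-- Near a prime a section is given by one element of M_t // (ρ). It lifts to a section of M around
t, whose domain contains all generizations of t and which therefore represents the family on the
smallest neighbourhood of `y`. -/
theorem chartFamily_mem (O : Opens (monoidSpec (CollapsedStalk M ρ t.1))) (W : Opens (G.fan ρ))
    (hW : ∀ y ∈ W, ∃ hy : y ∈ G.minNhds ρ t, G.chartPoint hM hρ t ⟨y, hy⟩ ∈ O)
    (a : (monoidSpec (CollapsedStalk M ρ t.1)).presheaf.obj (op O)) :
    G.chartFamily hM hρ t O W hW a ∈ (subsetBasic (quotientSpace M ρ) G.fanSet).sections W := by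
  rintro ⟨y, hy⟩
  obtain ⟨O', hO', i, n, hn⟩ := exists_specMk (hW y hy).2 a
  obtain ⟨m, rfl⟩ := collapse_surjective M ρ t.1 n
  obtain ⟨V, hV, m, rfl⟩ := M.presheaf.exists_germ_eq m
  have hzV : ∀ z : G.fanSet, z ⤳ y → z.1 ∈ V := fun z hz =>
    (G.specializes_of_mem_minNhds (ρ := ρ) (hz.trans (hW y hy).1)).mem_open V.2 hV
  refine ⟨G.minNhds ρ y, specializes_rfl, homOfLE fun z hz => hz.mem_open W.2 hy,
    V, fun z => hzV z.1 z.2, (toQuotientSheaf M.presheaf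
      fun x => idealCon (M.presheaf.germ ⊤ x trivial ρ)).app (op V) m, fun z => ?_⟩
  have hzW : z.1 ∈ W := Specializes.mem_open z.2 W.2 hy
  refine ((quotientSpaceEquiv M ρ z.1.1).symm_apply_eq).2 ?_
  have hzO : G.chartPoint hM hρ t ⟨z.1, (hW z.1 hzW).1⟩ ∈ O' := by
    have h1 : (⟨z.1, (hW z.1 hzW).1⟩ : G.minNhds ρ t) ⤳ ⟨y, (hW y hy).1⟩ :=
      (subtype_specializes_iff _ _).2 z.2
    exact (h1.map (G.continuous_chartPoint hM hρ t)).mem_open O'.2 hO'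
  refine (congrArg (fun b => G.chartStalkEquiv (fun x => (hM x).sharp) hρ
    (G.specializes_of_mem_minNhds (hW z.1 hzW).1) b) (hn _ hzO)).trans ?_
  refine (G.chartStalkEquiv_specMk _ _ _ _).trans ?_
  rw [collapsedSpecializes_collapse, TopCat.Presheaf.germ_stalkSpecializes_apply]
  exact (quotientSpaceEval_germ ρ z.1.1 V (hzV z.1 z.2) ((toQuotientSheaf M.presheaf
    fun x => idealCon (M.presheaf.germ ⊤ x trivial ρ)).app (op V) m)).symm

/-- The continuous map underlying a chart of the fan. -/
def chartBase : ((G.fan ρ).restrict (G.minNhds ρ t).isOpenEmbedding).carrier ⟶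
    (monoidSpec (CollapsedStalk M ρ t.1)).carrier :=
  TopCat.ofHom ⟨G.chartPoint hM hρ t, G.continuous_chartPoint hM hρ t⟩

/-- The chart of the fan on the smallest open neighbourhood of a point. -/
def fanChart : (G.fan ρ).restrict (G.minNhds ρ t).isOpenEmbedding ⟶
    monoidSpec (CollapsedStalk M ρ t.1) := InducedCategory.homMk
  { base := G.chartBase hM hρ t
    c :=
      { app := fun O => CommMonCat.ofHom
          ((G.chartFamily hM hρ t O.unop ((G.minNhds ρ t).isOpenEmbedding.isOpenMap.functor.obj
            ((Opens.map (G.chartBase hM hρ t)).obj O.unop)) (by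
              rintro _ ⟨y, hy, rfl⟩
              exact ⟨y.2, hy⟩)).codRestrict _ fun a => G.chartFamily_mem hM hρ t _ _ _ a)
        naturality := fun U V i => by
          ext a
          rfl } }

theorem fanEval_stalkMap_fanChart (y : G.minNhds ρ t)
    (a : (monoidSpec (CollapsedStalk M ρ t.1)).presheaf.stalk (G.chartPoint hM hρ t y)) :
    G.fanEval ρ y.1 (((G.fan ρ).restrictStalkIso (G.minNhds ρ t).isOpenEmbedding y).hom
      ((G.fanChart hM hρ t).hom.stalkMap y a)) =
      G.chartStalkEquiv (fun x => (hM x).sharp) hρ (G.specializes_of_mem_minNhds y.2)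
        (specEval (G.chartPoint hM hρ t y) a) := by
  obtain ⟨O, hO, a, rfl⟩ := (monoidSpec (CollapsedStalk M ρ t.1)).presheaf.exists_germ_eq a
  have h1 := PresheafedSpace.stalkMap_germ_apply (G.fanChart hM hρ t).hom O y hO a
  refine Eq.trans ?_ (congrArg (fun b => G.chartStalkEquiv (fun x => (hM x).sharp) hρ
    (G.specializes_of_mem_minNhds y.2) b) (specEval_germ (G.chartPoint hM hρ t y) O hO a).symm)
  refine (congrArg (fun b => G.fanEval ρ y.1 (((G.fan ρ).restrictStalkIso
    (G.minNhds ρ t).isOpenEmbedding y).hom b)) h1).trans ?_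
  refine (congrArg (G.fanEval ρ y.1)
    (PresheafedSpace.restrictStalkIso_hom_eq_germ_apply _ _ _ _ _ _)).trans ?_
  refine (G.fanEval_germ ρ y.1 _ _ _).trans ?_
  exact (quotientSpaceEquiv M ρ y.1.1).apply_symm_apply _

/-- The map is a homeomorphism, and on stalks it is, up to the identifications, the isomorphism
`chartStalkEquiv`. -/
theorem isIso_fanChart : IsIso (G.fanChart hM hρ t) := by
  have h : ∀ y : ((G.fan ρ).restrict (G.minNhds ρ t).isOpenEmbedding),
      IsIso ((G.fanChart hM hρ t).hom.stalkMap y) := by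
    intro y
    rw [ConcreteCategory.isIso_iff_bijective]
    have e : (G.fanEval ρ y.1 ∘
        ((G.fan ρ).restrictStalkIso (G.minNhds ρ t).isOpenEmbedding y).hom) ∘
        (G.fanChart hM hρ t).hom.stalkMap y =
        G.chartStalkEquiv (fun x => (hM x).sharp) hρ (G.specializes_of_mem_minNhds y.2) ∘
        specEval (G.chartPoint hM hρ t y) :=
      funext fun a => G.fanEval_stalkMap_fanChart hM hρ t y a
    refine (Function.Bijective.of_comp_iff' ((G.fanEval_bijective ρ y.1).comp
      (ConcreteCategory.bijective_of_isIso
        ((G.fan ρ).restrictStalkIso (G.minNhds ρ t).isOpenEmbedding y).hom)) _).1 ?_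
    rw [e]
    exact (MulEquiv.bijective _).comp (specEval_bijective _)
  have hb : Topology.IsOpenEmbedding (G.fanChart hM hρ t).hom.base :=
    Topology.IsOpenEmbedding.of_continuous_injective_isOpenMap (G.continuous_chartPoint hM hρ t)
      (G.chartPoint_injective hM hρ t) (G.isOpenMap_chartPoint hM hρ t)
  have : SheafedSpace.IsOpenImmersion (G.fanChart hM hρ t) :=
    SheafedSpace.IsOpenImmersion.of_stalk_iso _ hb
  have : Epi (G.fanChart hM hρ t).hom.base :=
    (TopCat.epi_iff_surjective _).2 (G.chartPoint_surjective hM hρ t)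
  exact SheafedSpace.IsOpenImmersion.to_iso _

theorem isKatoFanLocallyOfFiniteType_fan (hM : ∀ x : X, IsFineSharp (M.presheaf.stalk x))
    (hρ : G.IsDistinguished ρ) : IsKatoFanLocallyOfFiniteType (G.fan ρ) :=
  ⟨G.isSharp_stalk_fan (fun x => (hM x).sharp) hρ, fun t => ⟨G.minNhds ρ t, specializes_rfl,
    CollapsedStalk M ρ t.1, inferInstance, fg_collapsedStalk hM ρ t.1,
    ⟨@asIso _ _ _ _ _ (G.isIso_fanChart hM hρ t)⟩⟩⟩

end PreGTCAtlas

theorem IsKatoFanLocallyOfFiniteType.isKatoFan {T : SheafedSpace CommMonCat.{u}}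
    (h : IsKatoFanLocallyOfFiniteType T) : IsKatoFan T :=
  ⟨h.1, fun t => by
    obtain ⟨V, hV, P, hP, -, e⟩ := h.2 t
    exact ⟨V, hV, P, hP, e⟩⟩

end GTC

end

theorem mainTheorem10 {k : Type u} [Field k] (X : Scheme.{u}) (s : X ⟶ Spec (CommRingCat.of k))
    [LocallyOfFiniteType s] (M : TopCat.Sheaf CommMonCat.{u} X)
    (hM : ∀ x : X, GTC.IsFineSharp (M.presheaf.stalk x)) (G : GTC.PreGTCAtlas.{u, v} s M) :
    (∃! ρ : M.presheaf.obj (op ⊤), G.IsDistinguished ρ) ∧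
    ∀ ρ : M.presheaf.obj (op ⊤), G.IsDistinguished ρ →
      ∃ hprime : ∀ x : X, (G.ideal x).IsPrime,
        (GTC.IsKatoFan (G.fan ρ) ∧ GTC.IsKatoFanLocallyOfFiniteType (G.fan ρ)) ∧
        ∃ π : GTC.quotientSpace M ρ ⟶ G.fan ρ,
          (∀ x : X, (π.hom.base x).1 = X.fromSpecStalk x ⟨G.ideal x, hprime x⟩) ∧
          (∀ x : X, Function.Bijective (π.hom.stalkMap x)) ∧
          G.fanInclusion ρ ≫ π = 𝟙 (G.fan ρ) := by
  refine ⟨?_, fun ρ hρ => ⟨G.isPrime_ideal, ?_, G.retraction ρ, fun x => rfl,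
    G.bijective_stalkMap_retraction ρ, G.fanInclusion_comp_retraction ρ⟩⟩
  · obtain ⟨ρ, hρ⟩ := G.exists_isDistinguished hM
    exact ⟨ρ, hρ, fun ρ' hρ' => hρ'.unique G hρ⟩
  · have h := G.isKatoFanLocallyOfFiniteType_fan hM hρ
    exact ⟨h.isKatoFan, h⟩
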